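/- Let $\mathcal D=(\mathbb R/S\mathbb Z)^2$ be the square torus of side $S>0$ with its Euclidean distance $\|x-y\|$, let $K$ be a number of channels and $\mathcal P(K)$ the set of non-empty subsets of $\{1,\dots,K\}$ (the classes). Let $\lambda>0$, $\mathcal N_0>0$, $L_C>0$ for $C\in\mathcal P(K)$, let $(p_C)_{C\in\mathcal P(K)}$ be a probability distribution on $\mathcal P(K)$, and let $\ell:[0,\infty)\to[0,\infty)$ be non-increasing with $\ell(0)=1$. *Original dynamics (link length $0$).* $\Phi=(\Phi_t)_{t\ge0}$ is the Markov jump process on finite configurations of users $z=(x,C)\in\mathcal D\times\mathcal P(K)$ (location and class) in which users of class $C$ arrive as a Poisson rain of intensity $\lambda p_C\,dx\,dt$ on $\mathcal D$, and each user $z=(x,C)$ present in the configuration $\Phi$ leaves at rate $$\frac1{L_C}\,\frac{|C|\,\ell(0)}{\mathcal N_0+I(z,\Phi)},\qquad I(z,\Phi)=\sum_{(x',C')\in\Phi\setminus\{z\}}|C\cap C'|\,\ell(\|x-x'\|).$$ *Discretization.* Let $n\ge2$, $\varepsilon=S/n$, and tessellate $\mathcal D$ into $N_\varepsilon=n^2$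 square cells $A_i$ of side $\varepsilon$ with centers $a_i\in(\varepsilon\mathbb Z/S\mathbb Z)^2$ (so the origin is the center of its cell). Let $X_{i,C}(t)$ be the number of users of $\Phi_t$ of class $C$ located in $A_i$, and $\mathbf X_\varepsilon(t)=(X_{i,C}(t))_{i,C}$. Put $\mathcal V_i=\{b\in\mathcal D:\|b-a_i\|\in\{0,\varepsilon\}\}$ and $$\ell^\varepsilon(a_i,a_j)=\max\{\ell(\|b-b'\|):b\in\mathcal V_i,\,b'\in\mathcal V_j\},\qquad \ell_\varepsilon(a_i,a_j)=\min\{\ell(\|b-b'\|):b\in\mathcal V_i,\,b'\in\mathcal V_j\}.$$ *Interference queueing networks.* $\bar{\mathbf X}_\varepsilon$ (with $l=\ell^\varepsilon$) and $\underline{\mathbf X}_\varepsilon$ (with $l=\ell_\varepsilon$) are the processes on $\mathbb N^{N_\varepsilon\times(2^K-1)}$ in which, from the state $\mathbf x=(x_{i,C})$, the coordinate $x_{i,C}$ increases by $1$ at rate $\lambda p_C\varepsilon^2$ and decreases by $1$ at rate $$\frac{x_{i,C}}{L_C}\,\frac{|C|}{\mathcal N_0+\sum_{k,U}|C\cap U|\,l(a_k,a_i)\,\bigl(x_{k,U}-\mathbf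 1_{\{k=i,\,U=C\}}\bigr)}.$$ All three processes are constructed, from any initial law, from their jump chain and independent exponential holding times. For processes $X,Y$ with values in a partially ordered space of vectors, $Y$ stochastically dominates $X$ if for all times $t_1,\dots,t_m$ and every coordinate-wise non-decreasing $f\ge0$, $\mathbb E f(X(t_1),\dots,X(t_m))\le\mathbb E f(Y(t_1),\dots,Y(t_m))$. **Theorem.** (i) $\bar{\mathbf X}_\varepsilon$ and $\underline{\mathbf X}_\varepsilon$ are non-explosive Markov jump processes with state space $\mathbb N^{N_\varepsilon\times(2^K-1)}$ and the above jump rates; they are irreducible if $p_C>0$ for every $C\in\mathcal P(K)$. (ii) $\Phi$ is non-explosive, and $\bar{\mathbf X}_\varepsilon$ stochastically dominates $\mathbf X_\varepsilon$ whenever the law of $\bar{\mathbf X}_\varepsilon(0)$ dominates that of $\mathbf X_\varepsilon(0)$ (i.e. $\mathbb E f(\mathbf X_\varepsilon(0))\le\mathbb E f(\bar{\mathbf X}_\varepsilon(0))$ for every non-decreasing $f\ge0$). (iii) $\underline{\mathbf X}_\varepsilon$ is stochastically dominated by $\mathbf X_\varepsilon$ whenever the law of $\underline{\mathbf X}_\varepsilon(0)$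 is dominated by that of $\mathbf X_\varepsilon(0)$. In particular (ii) and (iii) hold when the initial conditions coincide. -/

import Mathlib

open MeasureTheory ProbabilityTheory Filter Topology
open scoped NNReal ENNReal

noncomputable section

namespace InterferenceQueues

/-! ### Markov jump processes: construction from a rate kernel

A rate kernel `q` on `E` gives, for every state `x`, the finite measure `q x` of jump rates.
The associated process is built from its jump chain `Y₀, Y₁, …` (transition kernel
`q x / q x E`) and an independent i.i.d. sequence `e₀, e₁, …` of exponential variables of mean
one: the process stays in `Yₖ` during a time `eₖ / q Yₖ E`. -/

section Jump

variable {E : Type*} [MeasurableSpace E]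

/-- States that are left at a positive and finite total rate. -/
def activeStates (q : Kernel E E) : Set E := {x | q x Set.univ ≠ 0 ∧ q x Set.univ ≠ ∞}

lemma measurable_totalRate (q : Kernel E E) : Measurable fun x => q x Set.univ :=
  q.measurable_coe MeasurableSet.univ

lemma measurableSet_activeStates (q : Kernel E E) : MeasurableSet (activeStates q) := by
  have h := measurable_totalRate q
  exact (h (measurableSet_singleton (0 : ℝ≥0∞))).compl.inter
    (h (measurableSet_singleton (∞ : ℝ≥0∞))).compl

/-- The normalized rates `q x / q x E`. -/
def normalizedRates (q : Kernel E E) : Kernel E E where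
  toFun x := (q x Set.univ)⁻¹ • q x
  measurable' := by
    refine Measure.measurable_of_measurable_coe _ fun A hA => ?_
    simp only [Measure.smul_apply, smul_eq_mul]
    exact (measurable_totalRate q).inv.mul (q.measurable_coe hA)

open Classical in
/-- Transition kernel of the jump chain (a state without outgoing rate is absorbing). -/
def jumpKernel (q : Kernel E E) : Kernel E E :=
  Kernel.piecewise (measurableSet_activeStates q) (normalizedRates q) Kernel.id

instance (q : Kernel E E) : IsMarkovKernel (jumpKernel q) := by
  refine ⟨fun x => ⟨?_⟩⟩
  classical
  rw [jumpKernel, Kernel.piecewise_apply]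
  split_ifs with hx
  · change ((q x Set.univ)⁻¹ • q x) Set.univ = 1
    rw [Measure.smul_apply, smul_eq_mul]
    exact ENNReal.inv_mul_cancel hx.1 hx.2
  · exact measure_univ

/-- Law of the jump chain with initial law `ν`. -/
def chainLaw (q : Kernel E E) (ν : Measure E) : Measure (ℕ → E) :=
  Kernel.trajMeasure (X := fun _ => E) ν
    (fun n => (jumpKernel q).comap (fun h : (Π _ : Finset.Iic n, E) => h ⟨n, by simp⟩)
      (measurable_pi_apply _))

/-- Sample space: a jump chain and a sequence of unit exponential variables. -/
abbrev JumpPath (E : Type*) : Type _ := (ℕ → E) × (ℕ → ℝ)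

/-- Law of the jump process with rates `q` and initial law `ν`. -/
def jumpLaw (q : Kernel E E) (ν : Measure E) : Measure (JumpPath E) :=
  (chainLaw q ν).prod (Measure.infinitePi fun _ : ℕ => expMeasure 1)

/-- Time of the `n`-th jump (with `jumpTime q 0 ω = 0`). -/
def jumpTime (q : Kernel E E) (n : ℕ) (ω : JumpPath E) : ℝ≥0∞ :=
  ∑ k ∈ Finset.range n, ENNReal.ofReal (ω.2 k) / q (ω.1 k) Set.univ

open Classical in
/-- State at time `t`: it is `Yₙ` if `t` lies between the `n`-th and the `(n+1)`-st jump time.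
(Past an explosion the value is immaterial; see `NonExplosive`.) -/
def jumpProcess (q : Kernel E E) (t : ℝ≥0) (ω : JumpPath E) : E :=
  if h : ∃ n, (t : ℝ≥0∞) < jumpTime q (n + 1) ω then ω.1 (Nat.find h) else ω.1 0

/-- Almost surely there are only finitely many jumps in bounded time. -/
def NonExplosive (q : Kernel E E) (ν : Measure E) : Prop :=
  ∀ᵐ ω ∂(jumpLaw q ν), ∀ t : ℝ≥0, ∃ n, (t : ℝ≥0∞) < jumpTime q n ω

/-! ### Markov jump processes: the properties -/

/-- `P` is a transition semigroup of probability kernels with jump intensities `q`, that is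
`P_t(x, A) = 1_A(x) + t (q(x, A) - q(x, E) 1_A(x)) + o(t)` as `t ↓ 0`. -/
structure IsTransitionFunction (P : ℝ≥0 → Kernel E E) (q : Kernel E E) : Prop where
  markov : ∀ t, IsMarkovKernel (P t)
  zero : P 0 = Kernel.id
  chapman_kolmogorov : ∀ s t, P (s + t) = (P t) ∘ₖ (P s)
  intensity : ∀ x A, MeasurableSet A →
    Tendsto (fun t : ℝ≥0 => ((P t x).real A - A.indicator (fun _ => (1 : ℝ)) x) / t)
      (𝓝[>] 0) (𝓝 ((q x).real A - (q x).real Set.univ * A.indicator (fun _ => (1 : ℝ)) x))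

/-- Piecewise constant right-continuous paths with finitely many jumps in bounded time. -/
def IsStepPath (x : ℝ≥0 → E) : Prop :=
  ∃ T : ℕ → ℝ≥0, T 0 = 0 ∧ Monotone T ∧ Tendsto T atTop atTop ∧
    ∀ n, ∀ t ∈ Set.Ico (T n) (T (n + 1)), x t = x (T n)

/-- `X` is a Markov jump process under `μ` with initial law `ν` and transition semigroup `P`:
its paths are step functions and, for all `s, t`, the conditional law of `X (s + t)` given
`(X u)_{u ≤ s}` is `P t (X s)`. -/
structure IsMarkovJumpProcess {Ω : Type*} [MeasurableSpace Ω] (P : ℝ≥0 → Kernel E E)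
    (ν : Measure E) (X : ℝ≥0 → Ω → E) (μ : Measure Ω) : Prop where
  measurable : ∀ t, Measurable (X t)
  initial : μ.map (X 0) = ν
  step : ∀ᵐ ω ∂μ, IsStepPath fun t => X t ω
  markov : ∀ (s t : ℝ≥0) (A : Set E), MeasurableSet A →
    μ[fun ω => A.indicator (fun _ => (1 : ℝ)) (X (s + t) ω) |
        ⨆ u : Set.Iic s, MeasurableSpace.comap (X u) inferInstance]
      =ᵐ[μ] fun ω => (P t (X s ω)).real A

/-- Irreducibility: every state can be reached from every state. -/
def IsIrreducibleSemigroup (P : ℝ≥0 → Kernel E E) : Prop :=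
  ∀ x y, ∃ t, 0 < P t x {y}

end Jump

/-! ### Stochastic order -/

/-- `X` (under `μ`) is stochastically dominated by `Y` (under `μ'`): `E f(X) ≤ E f(Y)` for every
non-decreasing `f ≥ 0`. -/
def StochLE {Ω Ω' V : Type*} [MeasurableSpace Ω] [MeasurableSpace Ω'] [Preorder V]
    (X : Ω → V) (μ : Measure Ω) (Y : Ω' → V) (μ' : Measure Ω') : Prop :=
  ∀ f : V → ℝ≥0∞, Monotone f → ∫⁻ ω, f (X ω) ∂μ ≤ ∫⁻ ω, f (Y ω) ∂μ'

/-- Stochastic domination of processes: domination, for all times `t₁, …, tₘ`, of the random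
vectors `(X t₁, …, X tₘ)` by `(Y t₁, …, Y tₘ)` for the coordinate-wise order. -/
def ProcessStochLE {Ω Ω' V : Type*} [MeasurableSpace Ω] [MeasurableSpace Ω'] [Preorder V]
    (X : ℝ≥0 → Ω → V) (μ : Measure Ω) (Y : ℝ≥0 → Ω' → V) (μ' : Measure Ω') : Prop :=
  ∀ (m : ℕ) (t : Fin m → ℝ≥0),
    StochLE (fun ω (j : Fin m) => X (t j) ω) μ (fun ω (j : Fin m) => Y (t j) ω) μ'

/-! ### The network -/

/-- Classes: non-empty sets of channels among `K` channels. -/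
abbrev UserClass (K : ℕ) : Type := {C : Finset (Fin K) // C.Nonempty}

/-- Parameters of the network. -/
structure NetworkParams (K : ℕ) where
  /-- arrival intensity -/
  lam : ℝ
  lam_pos : 0 < lam
  /-- distribution of the class of an arriving user -/
  p : UserClass K → ℝ
  p_nonneg : ∀ C, 0 ≤ p C
  p_sum : ∑ C, p C = 1
  /-- mean file size of each class -/
  L : UserClass K → ℝ
  L_pos : ∀ C, 0 < L C
  /-- thermal noise -/
  N0 : ℝ
  N0_pos : 0 < N0
  /-- path-loss function -/
  pathLoss : ℝ≥0 → ℝ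
  pathLoss_nonneg : ∀ r, 0 ≤ pathLoss r
  pathLoss_antitone : Antitone pathLoss
  pathLoss_zero : pathLoss 0 = 1

/-- Number of channels used by both classes. -/
def overlap {K : ℕ} (C U : UserClass K) : ℝ := ((C.1 ∩ U.1).card : ℝ)

/-- Number of channels used by a class. -/
def numChannels {K : ℕ} (C : UserClass K) : ℝ := (C.1.card : ℝ)

/-- The square torus of side `S`. -/
abbrev Torus (S : ℝ) : Type := AddCircle S × AddCircle S

/-- Euclidean distance on the torus. -/
def torusDist {S : ℝ} (x y : Torus S) : ℝ≥0 :=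
  NNReal.sqrt (‖x.1 - y.1‖₊ ^ 2 + ‖x.2 - y.2‖₊ ^ 2)

/-! ### Finite configurations of points -/

/-- The configuration made of the coordinates of a vector. -/
def configOf {α : Type*} {n : ℕ} (v : Fin n → α) : Multiset α :=
  (Finset.univ : Finset (Fin n)).val.map v

/-- Finite configurations (finite counting measures) on `α` are multisets. A set of configurations
is measurable if, for each `n`, it corresponds to a measurable set of `α ^ n`. -/
instance instMeasurableSpaceConfig {α : Type*} [MeasurableSpace α] :
    MeasurableSpace (Multiset α) :=
  ⨅ n : ℕ, MeasurableSpace.map (configOf (α := α) (n := n)) inferInstance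

section Config

variable {α β : Type*}

lemma measurable_of_config [MeasurableSpace α] [MeasurableSpace β] {f : Multiset α → β}
    (h : ∀ n : ℕ, Measurable fun v : Fin n → α => f (configOf v)) : Measurable f := by
  intro A hA
  rw [instMeasurableSpaceConfig, MeasurableSpace.measurableSet_iInf]
  exact fun n => h n hA

lemma measurable_configOf [MeasurableSpace α] (n : ℕ) : Measurable (configOf (α := α) (n := n)) := by
  intro A hA
  rw [instMeasurableSpaceConfig, MeasurableSpace.measurableSet_iInf] at hA
  exact hA n

lemma cons_configOf {n : ℕ} (a : α) (v : Fin n → α) :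
    a ::ₘ configOf v = configOf (Fin.cons a v : Fin (n + 1) → α) := by
  simp only [configOf, Fin.univ_succAbove n 0, Finset.cons_val, Multiset.map_cons, Fin.cons_zero,
    Finset.map_val, Multiset.map_map]
  rfl

lemma erase_configOf [DecidableEq α] {n : ℕ} (v : Fin (n + 1) → α) (i : Fin (n + 1)) :
    (configOf v).erase (v i) = configOf fun j => v (i.succAbove j) := by
  have h : configOf v = v i ::ₘ configOf fun j => v (i.succAbove j) := by
    simp only [configOf, Fin.univ_succAbove n i, Finset.cons_val, Multiset.map_cons,
      Finset.map_val, Multiset.map_map]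
    rfl
  rw [h, Multiset.erase_cons_head]

end Config

/-! ### The original dynamics -/

section Dynamics

variable {K : ℕ} (prm : NetworkParams K) {S : ℝ}

/-- A user: a location (of both its transmitter and its receiver) and a class. -/
abbrev User (S : ℝ) (K : ℕ) : Type := Torus S × UserClass K

open Classical in
/-- Interference seen by the user `z` of the configuration `s`: the sum over all other users. -/
def interference (z : User S K) (s : Multiset (User S K)) : ℝ :=
  ((s.erase z).map fun w => overlap z.2 w.2 * prm.pathLoss (torusDist z.1 w.1)).sum

/-- Transmission rate of the user `z` in the configuration `s` (link length `0`). -/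
def transmissionRate (z : User S K) (s : Multiset (User S K)) : ℝ :=
  numChannels z.2 * prm.pathLoss 0 / (prm.N0 + interference prm z s)

/-- Departure rate of the user `z` in the configuration `s`. -/
def departureRate (z : User S K) (s : Multiset (User S K)) : ℝ :=
  transmissionRate prm z s / prm.L z.2

lemma measurable_torusDist : Measurable fun x : Torus S × Torus S => torusDist x.1 x.2 := by
  unfold torusDist
  have : Continuous fun x : Torus S × Torus S =>
      NNReal.sqrt (‖x.1.1 - x.2.1‖₊ ^ 2 + ‖x.1.2 - x.2.2‖₊ ^ 2) := by fun_prop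
  exact this.measurable

lemma measurable_departureRate_configOf {n : ℕ} (i : Fin (n + 1)) :
    Measurable fun v : Fin (n + 1) → User S K => departureRate prm (v i) (configOf v) := by
  have hI : Measurable fun v : Fin (n + 1) → User S K => interference prm (v i) (configOf v) := by
    have : (fun v : Fin (n + 1) → User S K => interference prm (v i) (configOf v)) =
        fun v => ∑ j : Fin n, overlap (v i).2 (v (i.succAbove j)).2 *
          prm.pathLoss (torusDist (v i).1 (v (i.succAbove j)).1) := by
      funext v
      rw [interference, erase_configOf, configOf, Multiset.map_map]
      rfl
    rw [this]
    refine Finset.measurable_sum _ fun j _ => Measurable.mul ?_ ?_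
    · have h : Measurable fun c : UserClass K × UserClass K => overlap c.1 c.2 :=
        measurable_of_countable _
      exact h.comp (f := fun v : Fin (n + 1) → User S K => ((v i).2, (v (i.succAbove j)).2))
        ((measurable_pi_apply i).snd.prodMk (measurable_pi_apply (i.succAbove j)).snd)
    · exact prm.pathLoss_antitone.measurable.comp (measurable_torusDist.comp
        (f := fun v : Fin (n + 1) → User S K => ((v i).1, (v (i.succAbove j)).1))
        ((measurable_pi_apply i).fst.prodMk (measurable_pi_apply (i.succAbove j)).fst))
  have hN : Measurable fun v : Fin (n + 1) → User S K => numChannels (v i).2 :=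
    (measurable_of_countable (numChannels (K := K))).comp (measurable_pi_apply i).snd
  have hL : Measurable fun v : Fin (n + 1) → User S K => prm.L (v i).2 :=
    (measurable_of_countable prm.L).comp (measurable_pi_apply i).snd
  unfold departureRate transmissionRate
  exact ((hN.mul_const _).div (hI.const_add _)).div hL

open Classical in
/-- Departures: each user `z` of the configuration `s` leaves at rate `departureRate prm z s`. -/
def departureKernel (S : ℝ) : Kernel (Multiset (User S K)) (Multiset (User S K)) where
  toFun s := (s.map fun z =>
    ENNReal.ofReal (departureRate prm z s) • Measure.dirac (s.erase z)).sum
  measurable' := by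
    refine measurable_of_config fun n => ?_
    cases n with
    | zero =>
      have : (fun v : Fin 0 → User S K => ((configOf v).map fun z =>
          ENNReal.ofReal (departureRate prm z (configOf v)) •
            Measure.dirac ((configOf v).erase z)).sum) = fun _ => 0 := by
        funext v
        simp [configOf]
      rw [this]
      exact measurable_const
    | succ n =>
      have : (fun v : Fin (n + 1) → User S K => ((configOf v).map fun z =>
          ENNReal.ofReal (departureRate prm z (configOf v)) •
            Measure.dirac ((configOf v).erase z)).sum) = fun v => ∑ i : Fin (n + 1),
          ENNReal.ofReal (departureRate prm (v i) (configOf v)) •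
            Measure.dirac (configOf fun j => v (i.succAbove j)) := by
        funext v
        simp_rw [← erase_configOf v]
        exact congrArg Multiset.sum (Multiset.map_map
          (fun z => ENNReal.ofReal (departureRate prm z (configOf v)) •
            Measure.dirac ((configOf v).erase z)) v Finset.univ.val)
      rw [this]
      refine Measure.measurable_of_measurable_coe _ fun A hA => ?_
      simp only [Measure.finsetSum_apply, Measure.smul_apply, smul_eq_mul]
      refine Finset.measurable_sum _ fun i _ =>
        (measurable_departureRate_configOf prm i).ennreal_ofReal.mul ?_
      have h1 : Measurable fun v : Fin (n + 1) → User S K =>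
          configOf fun j => v (i.succAbove j) :=
        (measurable_configOf n).comp (by fun_prop)
      exact (Measure.measurable_coe hA).comp (Measure.measurable_dirac.comp h1)

/-- Arrivals: users of class `C` arrive as a Poisson rain of intensity `λ p_C` on the torus. -/
def arrivalKernel (S : ℝ) [Fact (0 < S)] :
    Kernel (Multiset (User S K)) (Multiset (User S K)) where
  toFun s := ∑ C, ENNReal.ofReal (prm.lam * prm.p C) •
    (volume : Measure (Torus S)).map fun x => (x, C) ::ₘ s
  measurable' := by
    refine measurable_of_config fun n => ?_
    refine Measure.measurable_of_measurable_coe _ fun A hA => ?_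
    simp only [Measure.finsetSum_apply, Measure.smul_apply, smul_eq_mul]
    refine Finset.measurable_sum _ fun C _ => Measurable.const_mul ?_ _
    have h : Measurable fun w : (Fin n → User S K) × Torus S =>
        ((w.2, C) : User S K) ::ₘ configOf w.1 := by
      simp_rw [cons_configOf]
      refine (measurable_configOf (n + 1)).comp (measurable_pi_iff.2 fun j => ?_)
      refine Fin.cases ?_ (fun j => ?_) j
      · simp only [Fin.cons_zero]
        fun_prop
      · simp only [Fin.cons_succ]
        fun_prop
    have h2 : ∀ v : Fin n → User S K,
        (volume : Measure (Torus S)).map (fun x => ((x, C) : User S K) ::ₘ configOf v) A =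
          volume (Prod.mk v ⁻¹' ((fun w : (Fin n → User S K) × Torus S =>
            ((w.2, C) : User S K) ::ₘ configOf w.1) ⁻¹' A)) := fun v => by
      exact Measure.map_apply (f := fun x : Torus S => ((x, C) : User S K) ::ₘ configOf v)
        (h.comp (f := fun x : Torus S => (v, x)) measurable_prodMk_left) hA
    simp_rw [h2]
    exact measurable_measure_prodMk_left (h hA)

/-- Jump rates of the original dynamics `Φ`. -/
def networkRates (S : ℝ) [Fact (0 < S)] :
    Kernel (Multiset (User S K)) (Multiset (User S K)) :=
  arrivalKernel prm S + departureKernel prm S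

end Dynamics

/-! ### Discretization -/

section Discretization

variable {K : ℕ}

/-- Indices of the `N = n²` cells. -/
abbrev CellIndex (n : ℕ) : Type := Fin n × Fin n

/-- State space of the discretized processes: numbers of users of each class in each cell. -/
abbrev CellState (n K : ℕ) : Type := CellIndex n × UserClass K → ℕ

/-- Side length of the cells. -/
def cellSide (S : ℝ) (n : ℕ) : ℝ := S / n

/-- Center of a cell; the cell `(0, 0)` is centered at the origin. -/
def cellCenter (S : ℝ) {n : ℕ} (i : CellIndex n) : Torus S :=
  (((i.1 : ℝ) * cellSide S n : ℝ), ((i.2 : ℝ) * cellSide S n : ℝ))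

/-- The (half-open) square cell of side `cellSide S n` around its center. -/
def cell (S : ℝ) {n : ℕ} (i : CellIndex n) : Set (Torus S) :=
  {x | ∃ u ∈ Set.Ico (-(cellSide S n / 2)) (cellSide S n / 2),
    ∃ v ∈ Set.Ico (-(cellSide S n / 2)) (cellSide S n / 2),
      x = cellCenter S i + ((u : AddCircle S), (v : AddCircle S))}

open Classical in
/-- Number of users of each class in each cell. -/
def cellCounts (S : ℝ) (n : ℕ) (s : Multiset (User S K)) : CellState n K :=
  fun j => s.countP fun z => z.1 ∈ cell S j.1 ∧ z.2 = j.2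

/-- The discretization `X_ε` of the original dynamics. -/
def discretized (prm : NetworkParams K) (S : ℝ) [Fact (0 < S)] (n : ℕ) (t : ℝ≥0)
    (ω : JumpPath (Multiset (User S K))) : CellState n K :=
  cellCounts S n (jumpProcess (networkRates prm S) t ω)

/-- The center of a cell and the points at distance `ε` of it, `ε` being the side of the cells. -/
def vicinity (S : ℝ) {n : ℕ} (i : CellIndex n) : Set (Torus S) :=
  {b | (torusDist b (cellCenter S i) : ℝ) = 0 ∨
    (torusDist b (cellCenter S i) : ℝ) = cellSide S n}

/-- Path losses `ℓ ‖b - b'‖` between the vicinities of two cells. -/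
def vicinityLosses (prm : NetworkParams K) (S : ℝ) {n : ℕ} (i j : CellIndex n) : Set ℝ :=
  {y | ∃ b ∈ vicinity S i, ∃ b' ∈ vicinity S j, y = prm.pathLoss (torusDist b b')}

/-- Cell-wise maximal path loss `ℓ^ε(a_i, a_j)`. -/
def lossMax (prm : NetworkParams K) (S : ℝ) {n : ℕ} (i j : CellIndex n) : ℝ :=
  sSup (vicinityLosses prm S i j)

/-- Cell-wise minimal path loss `ℓ_ε(a_i, a_j)`. -/
def lossMin (prm : NetworkParams K) (S : ℝ) {n : ℕ} (i j : CellIndex n) : ℝ :=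
  sInf (vicinityLosses prm S i j)

/-- Interference seen by a user of cell `j.1` and class `j.2`, for the cell-wise path loss `l`. -/
def queueInterference {n : ℕ} (l : CellIndex n → CellIndex n → ℝ) (x : CellState n K)
    (j : CellIndex n × UserClass K) : ℝ :=
  ∑ k, overlap j.2 k.2 * l k.1 j.1 * ((x k : ℝ) - if k = j then 1 else 0)

/-- Transmission rate of a user of cell `j.1` and class `j.2`. -/
def queueRate (prm : NetworkParams K) {n : ℕ} (l : CellIndex n → CellIndex n → ℝ)
    (x : CellState n K) (j : CellIndex n × UserClass K) : ℝ :=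
  numChannels j.2 / (prm.N0 + queueInterference l x j)

/-- Jump rates of the interference queueing network with cell-wise path loss `l`: one more user
in cell `i` of class `C` at rate `λ p_C ε²`, one less at rate `x_{i,C} R_{i,C} / L_C`. -/
def queueRates (prm : NetworkParams K) (S : ℝ) {n : ℕ} (l : CellIndex n → CellIndex n → ℝ) :
    Kernel (CellState n K) (CellState n K) where
  toFun x :=
    ∑ j, ENNReal.ofReal (prm.lam * prm.p j.2 * cellSide S n ^ 2) •
        Measure.dirac (x + Pi.single j 1) +
      ∑ j, ENNReal.ofReal ((x j : ℝ) / prm.L j.2 * queueRate prm l x j) •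
        Measure.dirac (x - Pi.single j 1)
  measurable' := measurable_of_countable _

/-- Jump rates of the upper network. -/
def upperRates (prm : NetworkParams K) (S : ℝ) (n : ℕ) : Kernel (CellState n K) (CellState n K) :=
  queueRates prm S (lossMax prm S)

/-- Jump rates of the lower network. -/
def lowerRates (prm : NetworkParams K) (S : ℝ) (n : ℕ) : Kernel (CellState n K) (CellState n K) :=
  queueRates prm S (lossMin prm S)

end Discretization

end InterferenceQueues

end

open InterferenceQueues

/-! The theorem rests on monotonicity: a user leaves more slowly when it sees more interference. The
displacement between two points of two cells also occurs between two suitable points of the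
vicinities of these cells, so the true path loss lies between `lossMin` and `lossMax`
(`pathLoss_mem_vicinityLosses`). Suppose that the cell counts of a configuration lie below a state
of the upper network. An arrival can be given to the same cell and class in both systems. A
departure can break the order only in a coordinate where the two counts agree. There the users are
matched one to one, and each user of the upper network sees at least as much interference as its
partner, hence leaves no faster and can be made to leave only together with it. The lower network is
treated in the same way with the roles exchanged.

No coupled process is constructed. The matching argument enters only through `RatesDominated`, an
inequality between integrals against the two rate kernels (`ratesDominated_upper`,
`ratesDominated_lower`). It is carried to the semigroups by an Euler scheme: for a short time, the
transition kernel agrees with `eulerStep` up to a quadratic error (`eulerStep_le`, `le_eulerStep`),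
and domination of the rates makes Euler steps preserve the order. The rates are unbounded, but they
grow at most linearly in the number of users, whose mean grows at a bounded rate. A small multiple
of this number, added to the larger function, makes the comparison trivial at large states and costs
little at the others (`RatesDominated.transition_le_of_short`). Letting the step tend to zero
compares the semigroups. The Markov property extends the comparison to several times, by integrating
out the last one, and `RatesDominated.processStochLE` adds the order of the initial laws.

The Markov property is proved from the explicit construction. The law of a path is decomposed at its
first jump (`lintegral_pathKernel`); the absence of memory settles the event that no jump has
occurred by time s, and induction on the number of jumps before s gives the rest
(`lintegral_jumpsAt_markov`). Non-explosion holds because the number of departures is at most the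
number of arrivals plus the initial population, while arrivals have bounded rate. Quantitatively,
for some B > 1 the mean of exp(-Tₙ) B ^ size(Yₙ) is at most B⁻ⁿ B ^ size(Y₀), where Tₙ is the time
of the n-th jump, so Tₙ ≤ t has geometrically small probability (`SizedRates.measure_jumpTime_le`).
Irreducibility follows since every state communicates with the empty one. -/

noncomputable section

namespace InterferenceQueues

/-! ### Sequences -/

/-- The sequence `a, u 0, u 1, …`. -/
def consSeq {α : Type*} (a : α) (u : ℕ → α) : ℕ → α
  | 0 => a
  | n + 1 => u n

@[simp] lemma consSeq_zero {α : Type*} (a : α) (u : ℕ → α) : consSeq a u 0 = a := rfl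

@[simp] lemma consSeq_succ {α : Type*} (a : α) (u : ℕ → α) (n : ℕ) :
    consSeq a u (n + 1) = u n := rfl

lemma measurable_consSeq {α : Type*} [MeasurableSpace α] :
    Measurable fun p : α × (ℕ → α) => consSeq p.1 p.2 := by
  refine measurable_pi_iff.2 fun n => ?_
  cases n with
  | zero => exact measurable_fst
  | succ n => exact (measurable_pi_apply n).comp measurable_snd

/-- The sequence that agrees with `u` up to the index `n` and is then constant equal to `a`. -/
def stopSeq {α : Type*} (n : ℕ) (u : ℕ → α) (a : α) : ℕ → α :=
  fun k => if k ≤ n then u k else a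

lemma measurable_stopSeq {α : Type*} [MeasurableSpace α] (n : ℕ) :
    Measurable fun p : (ℕ → α) × α => stopSeq n p.1 p.2 := by
  refine measurable_pi_iff.2 fun k => ?_
  unfold stopSeq
  split_ifs
  · exact (measurable_pi_apply k).comp measurable_fst
  · exact measurable_snd

/-- The finite dimensional marginals determine a measure on sequences, and a finite set of
coordinates does not notice a modification of the sequence after its largest element. Stopped
sequences let functions of finitely many coordinates be written as functions on the whole sequence
space. -/
lemma measure_ext_of_stopSeq {α : Type*} [MeasurableSpace α] {μ ν : Measure (ℕ → α)}
    [IsFiniteMeasure μ]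
    (h : ∀ (n : ℕ) (F : (ℕ → α) → ℝ≥0∞), Measurable F →
      ∫⁻ u, F (stopSeq n u (u (n + 1))) ∂μ = ∫⁻ u, F (stopSeq n u (u (n + 1))) ∂ν) :
    μ = ν := by
  have key : ∀ (I : Finset ℕ), μ.map I.restrict = ν.map I.restrict := by
    intro I
    ext A hA
    rw [Measure.map_apply (Finset.measurable_restrict I) hA,
      Measure.map_apply (Finset.measurable_restrict I) hA]
    have hm : MeasurableSet (I.restrict ⁻¹' A : Set (ℕ → α)) := Finset.measurable_restrict I hA
    have h1 := h (I.sup id) ((I.restrict ⁻¹' A).indicator 1) (measurable_one.indicator hm)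
    have h2 : ∀ u : ℕ → α, ((I.restrict ⁻¹' A).indicator 1
        (stopSeq (I.sup id) u (u (I.sup id + 1))) : ℝ≥0∞) = (I.restrict ⁻¹' A).indicator 1 u := by
      intro u
      have : I.restrict (stopSeq (I.sup id) u (u (I.sup id + 1))) = I.restrict u := by
        funext k
        have : (k : ℕ) ≤ I.sup id := Finset.le_sup (f := id) k.2
        simp [stopSeq, this]
      by_cases hu : u ∈ I.restrict ⁻¹' A
      · rw [Set.indicator_of_mem hu, Set.indicator_of_mem (by rwa [Set.mem_preimage, this]),
          Pi.one_apply, Pi.one_apply]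
      · rw [Set.indicator_of_notMem hu,
          Set.indicator_of_notMem (by rwa [Set.mem_preimage, this])]
    simp_rw [h2] at h1
    rwa [lintegral_indicator_one hm, lintegral_indicator_one hm] at h1
  have hμ : IsProjectiveLimit μ fun I : Finset ℕ => μ.map I.restrict := fun I => rfl
  have hν : IsProjectiveLimit ν fun I : Finset ℕ => μ.map I.restrict := fun I => (key I).symm
  exact hμ.unique hν

/-! ### The jump chain -/

section Chain

variable {E : Type*} [MeasurableSpace E] (q : Kernel E E)

/-- The law of the jump chain as a function of its starting point. -/
def chainKernel : Kernel E (ℕ → E) :=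
  (Kernel.traj (X := fun _ => E)
    (fun n => (jumpKernel q).comap (fun h : (Π _ : Finset.Iic n, E) => h ⟨n, by simp⟩)
      (measurable_pi_apply _)) 0).comap (fun x _ => x) (by fun_prop)

instance : IsMarkovKernel (chainKernel q) := by
  unfold chainKernel
  infer_instance

lemma chainLaw_eq (ν : Measure E) : chainLaw q ν = (chainKernel q) ∘ₘ ν := by
  rw [chainLaw, Kernel.trajMeasure, chainKernel]
  ext A hA
  rw [Measure.bind_apply hA (Kernel.aemeasurable _), Measure.bind_apply hA (Kernel.aemeasurable _),
    lintegral_map (Kernel.measurable_coe _ hA) (by fun_prop)]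
  rfl

lemma chainLaw_dirac (x : E) : chainLaw q (Measure.dirac x) = chainKernel q x := by
  rw [chainLaw_eq, Measure.dirac_bind (Kernel.measurable _)]

lemma chainKernel_map_zero (x : E) : (chainKernel q x).map (fun u => u 0) = Measure.dirac x := by
  rw [chainKernel, Kernel.comap_apply]
  have h := Kernel.traj_map_frestrictLe_apply (X := fun _ => E)
    (κ := fun n => (jumpKernel q).comap (fun h : (Π _ : Finset.Iic n, E) => h ⟨n, by simp⟩)
      (measurable_pi_apply _)) 0 0 (fun _ => x)
  rw [Kernel.partialTraj_self, Kernel.id_apply] at h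
  have hm : Measurable fun v : (Π _ : Finset.Iic 0, E) => v ⟨0, by simp⟩ := measurable_pi_apply _
  have h3 := congrArg (fun μ => μ.map fun v : (Π _ : Finset.Iic 0, E) => v ⟨0, by simp⟩) h
  rw [Measure.map_map hm (by fun_prop)] at h3
  refine h3.trans ?_
  ext A hA
  rw [Measure.map_apply hm hA, Measure.dirac_apply' _ (hm hA), Measure.dirac_apply' _ hA]
  rfl

/-- The one-step Markov property of the chain, read off the composition-product that defines the
trajectory measure. Together with `measure_ext_of_stopSeq` it characterizes the law of the chain. -/
lemma lintegral_chainLaw_step (ν : Measure E) [IsProbabilityMeasure ν] (n : ℕ)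
    (F : (ℕ → E) → ℝ≥0∞) (hF : Measurable F) :
    ∫⁻ u, F (stopSeq n u (u (n + 1))) ∂(chainLaw q ν) =
      ∫⁻ u, ∫⁻ z, F (stopSeq n u z) ∂(jumpKernel q (u n)) ∂(chainLaw q ν) := by
  have h := Kernel.map_frestrictLe_trajMeasure_compProd_eq_map_trajMeasure (X := fun _ => E)
    (κ := fun n => (jumpKernel q).comap (fun h : (Π _ : Finset.Iic n, E) => h ⟨n, by simp⟩)
      (measurable_pi_apply _)) (μ₀ := ν) (a := n)
  let ext : (Π _ : Finset.Iic n, E) × E → (ℕ → E) := fun p k =>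
    if hk : k ≤ n then p.1 ⟨k, by simpa using hk⟩ else p.2
  have hext : Measurable ext := by
    refine measurable_pi_iff.2 fun k => ?_
    simp only [ext]
    split_ifs
    · exact (measurable_pi_apply _).comp measurable_fst
    · exact measurable_snd
  have e1 : ∀ (u : ℕ → E) z, ext (Preorder.frestrictLe n u, z) = stopSeq n u z := by
    intro u z
    funext k
    simp only [ext, stopSeq]
    split_ifs <;> rfl
  have h3 := congrArg (fun μ => ∫⁻ p, F (ext p) ∂μ) h
  rw [Measure.lintegral_compProd (hF.fun_comp hext), lintegral_map (hF.fun_comp hext) (by fun_prop),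
    lintegral_map] at h3
  · simp only [e1] at h3
    exact h3.symm
  · exact Measurable.lintegral_kernel_prod_right (f := fun a b => F (ext (a, b))) (hF.comp hext)
  · fun_prop

lemma measurable_lintegral_stopSeq (n : ℕ) {F : (ℕ → E) → ℝ≥0∞} (hF : Measurable F) :
    Measurable fun u : ℕ → E => ∫⁻ z, F (stopSeq n u z) ∂(jumpKernel q (u n)) := by
  have := Measurable.lintegral_kernel_prod_right
    (κ := (jumpKernel q).comap (fun u : ℕ → E => u n) (measurable_pi_apply n))
    (f := fun u z => F (stopSeq n u z)) (hF.comp (measurable_stopSeq n))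
  exact this

lemma lintegral_chainKernel_zero (x : E) {f : E → ℝ≥0∞} (hf : Measurable f) :
    ∫⁻ u, f (u 0) ∂(chainKernel q x) = f x := by
  rw [← lintegral_map hf (measurable_pi_apply 0), chainKernel_map_zero, lintegral_dirac' _ hf]

lemma lintegral_chainLaw_zero (ν : Measure E) {f : E → ℝ≥0∞} (hf : Measurable f) :
    ∫⁻ u, f (u 0) ∂(chainLaw q ν) = ∫⁻ x, f x ∂ν := by
  rw [chainLaw_eq, Measure.lintegral_bind (Kernel.aemeasurable _)
    (hf.fun_comp (measurable_pi_apply 0)).aemeasurable]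
  exact lintegral_congr fun x => lintegral_chainKernel_zero q x hf

instance (ν : Measure E) [IsProbabilityMeasure ν] : IsProbabilityMeasure (chainLaw q ν) := by
  rw [chainLaw_eq]
  infer_instance

/-- The jump chain after its first step is the jump chain started from its first jump. -/
lemma chainKernel_eq_map_consSeq (x : E) :
    chainKernel q x = (chainLaw q (jumpKernel q x)).map (consSeq x) := by
  have hc : Measurable (consSeq x : (ℕ → E) → ℕ → E) :=
    measurable_consSeq.comp measurable_prodMk_left
  have hs (n : ℕ) : Measurable fun u : ℕ → E => stopSeq n u (u (n + 1)) :=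
    (measurable_stopSeq n).comp (measurable_id.prodMk (measurable_pi_apply (n + 1)))
  refine measure_ext_of_stopSeq fun n => ?_
  induction n with
  | zero =>
    intro F hF
    have e0 (u : ℕ → E) (z : E) : stopSeq 0 u z = consSeq (u 0) fun _ => z := by
      funext k
      cases k <;> simp [stopSeq]
    have hm : Measurable fun p : E × E => F (consSeq p.1 fun _ => p.2) :=
      hF.comp (measurable_consSeq.comp (measurable_fst.prodMk
        (measurable_pi_iff.2 fun _ => measurable_snd)))
    rw [lintegral_map (hF.fun_comp (hs 0)) hc, ← chainLaw_dirac, lintegral_chainLaw_step q _ 0 F hF]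
    simp only [e0, consSeq_zero, consSeq_succ, zero_add]
    rw [lintegral_chainLaw_zero q _ (f := fun z => F (consSeq x fun _ => z))
        (hm.comp measurable_prodMk_left), chainLaw_dirac,
      lintegral_chainKernel_zero q x (f := fun y => ∫⁻ z, F (consSeq y fun _ => z)
        ∂(jumpKernel q y)) (Measurable.lintegral_kernel_prod_right
          (f := fun y z => F (consSeq y fun _ => z)) hm)]
  | succ n ih =>
    intro F hF
    have e0 (u : ℕ → E) (z : E) :
        stopSeq (n + 1) (consSeq x u) z = consSeq x (stopSeq n u z) := by
      funext k
      cases k with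
      | zero => simp [stopSeq]
      | succ k => simp [stopSeq]
    have e1 (u : ℕ → E) (z : E) : stopSeq (n + 1) (stopSeq n u (u (n + 1))) z =
        stopSeq (n + 1) u z := by
      funext k
      simp only [stopSeq]
      split_ifs with h h'
      · rfl
      · rw [show k = n + 1 by omega]
      · rfl
    have e2 (u : ℕ → E) : stopSeq n u (u (n + 1)) (n + 1) = u (n + 1) := by simp [stopSeq]
    -- By the one-step property, both laws integrate out the last coordinate through the same
    -- kernel. What remains depends only on the first n + 2 coordinates (`e1`, `e2`), where the
    -- induction hypothesis applies.
    have h := ih _ (measurable_lintegral_stopSeq q (n + 1) hF)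
    simp only [e1, e2] at h
    rw [← chainLaw_dirac] at h ⊢
    rw [lintegral_chainLaw_step q _ (n + 1) F hF, h,
      lintegral_map (measurable_lintegral_stopSeq q (n + 1) hF) hc,
      lintegral_map (hF.fun_comp (hs (n + 1))) hc]
    simp only [e0, consSeq_succ]
    exact (lintegral_chainLaw_step q _ n (fun u => F (consSeq x u)) (hF.comp hc)).symm

end Chain

/-! ### Sequences of independent exponential variables -/

instance isProbabilityMeasure_expMeasure_one : IsProbabilityMeasure (expMeasure 1) :=
  isProbabilityMeasure_expMeasure one_pos

lemma expMeasure_eq_withDensity (r : ℝ) :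
    expMeasure r = volume.withDensity (exponentialPDF r) := rfl

lemma measurable_exponentialPDF (r : ℝ) : Measurable (exponentialPDF r) :=
  (measurable_exponentialPDFReal r).ennreal_ofReal

lemma lintegral_expMeasure (r : ℝ) {f : ℝ → ℝ≥0∞} (hf : Measurable f) :
    ∫⁻ e, f e ∂(expMeasure r) = ∫⁻ e, exponentialPDF r e * f e := by
  rw [expMeasure_eq_withDensity,
    lintegral_withDensity_eq_lintegral_mul _ (measurable_exponentialPDF r) hf]
  rfl

lemma ae_pos_expMeasure : ∀ᵐ e ∂(expMeasure 1), 0 < e := by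
  rw [expMeasure_eq_withDensity, ae_withDensity_iff (measurable_exponentialPDF 1)]
  have : ∀ᵐ e : ℝ, e ≠ 0 := by simp [ae_iff]
  filter_upwards [this] with e he h
  by_contra hneg
  exact h (exponentialPDF_of_neg (lt_of_le_of_ne (not_lt.1 hneg) he))

/-- The exponential distribution has no memory. -/
lemma lintegral_expMeasure_memoryless {f : ℝ → ℝ≥0∞} (hf : Measurable f) {s : ℝ} (hs : 0 ≤ s) :
    ∫⁻ e in Set.Ioi s, f (e - s) ∂(expMeasure 1) =
      ENNReal.ofReal (Real.exp (-s)) * ∫⁻ e, f e ∂(expMeasure 1) := by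
  have hfs : Measurable fun e => f (e - s) := hf.comp (measurable_id.sub_const s)
  rw [← lintegral_indicator measurableSet_Ioi,
    lintegral_expMeasure 1 (hfs.indicator measurableSet_Ioi),
    lintegral_expMeasure 1 hf, ← lintegral_add_right_eq_self _ s,
    ← lintegral_const_mul _ ((measurable_exponentialPDF 1).fun_mul hf)]
  -- At e = 0 the two sides may differ: the density is positive there, while s does not belong to
  -- the open half-line.
  have h0 : ∀ᵐ e : ℝ, e ≠ 0 := by simp [ae_iff]
  refine lintegral_congr_ae ?_
  filter_upwards [h0] with e he
  rcases lt_or_gt_of_ne he with h | h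
  · have h1 : e + s ∉ Set.Ioi s := by simp [h.le]
    rw [Set.indicator_of_notMem h1, exponentialPDF_of_neg h, mul_zero, zero_mul, mul_zero]
  · have h1 : e + s ∈ Set.Ioi s := by simp [h]
    rw [Set.indicator_of_mem h1, exponentialPDF_of_nonneg (by positivity),
      exponentialPDF_of_nonneg h.le, ← mul_assoc, add_sub_cancel_right,
      ← ENNReal.ofReal_mul (Real.exp_nonneg _)]
    congr 2
    rw [one_mul, one_mul, one_mul, one_mul, ← Real.exp_add]
    congr 1
    ring

lemma expMeasure_Ioi {s : ℝ} (hs : 0 ≤ s) :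
    expMeasure 1 (Set.Ioi s) = ENNReal.ofReal (Real.exp (-s)) := by
  have h := lintegral_expMeasure_memoryless (f := fun _ => 1) measurable_const hs
  simpa using h

/-- The integrand times the unit exponential density is a multiple of the exponential density of
rate 1 + c. With c the inverse of a jump rate, this is the mean discount accumulated during a
holding time. -/
lemma lintegral_expMeasure_exp_neg {c : ℝ} (hc : 0 ≤ c) :
    ∫⁻ e, ENNReal.ofReal (Real.exp (-(c * e))) ∂(expMeasure 1) = ENNReal.ofReal (1 + c)⁻¹ := by
  have hk : 0 < 1 + c := by positivity
  rw [lintegral_expMeasure 1 (by fun_prop)]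
  have : ∀ e : ℝ, exponentialPDF 1 e * ENNReal.ofReal (Real.exp (-(c * e))) =
      ENNReal.ofReal (1 + c)⁻¹ * exponentialPDF (1 + c) e := by
    intro e
    rcases lt_or_ge e 0 with h | h
    · rw [exponentialPDF_of_neg h, exponentialPDF_of_neg h, zero_mul, mul_zero]
    · rw [exponentialPDF_of_nonneg h, exponentialPDF_of_nonneg h,
        ← ENNReal.ofReal_mul (by positivity), ← ENNReal.ofReal_mul (by positivity)]
      congr 1
      rw [← mul_assoc, inv_mul_cancel₀ hk.ne', one_mul, one_mul, one_mul, ← Real.exp_add]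
      congr 1
      ring
  simp_rw [this]
  rw [lintegral_const_mul _ (measurable_exponentialPDF _), lintegral_exponentialPDF_eq_one hk,
    mul_one]

/-- Detaches the first holding variable from the others. It suffices to compare both measures on
finite boxes, padded by the whole space to an initial segment of indices. -/
lemma infinitePi_eq_map_consSeq {α : Type*} [MeasurableSpace α] (μ : Measure α)
    [IsProbabilityMeasure μ] :
    Measure.infinitePi (fun _ : ℕ => μ) =
      (μ.prod (Measure.infinitePi fun _ : ℕ => μ)).map fun p => consSeq p.1 p.2 := by
  classical
  refine (Measure.eq_infinitePi (fun _ : ℕ => μ) fun s t ht => ?_).symm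
  obtain ⟨n, hn⟩ : ∃ n, s ⊆ Finset.range (n + 1) :=
    ⟨s.sup id, fun i hi => Finset.mem_range.2 (Nat.lt_succ_of_le (Finset.le_sup (f := id) hi))⟩
  let t' : ℕ → Set α := fun i => if i ∈ s then t i else Set.univ
  have ht' : ∀ i, MeasurableSet (t' i) := fun i => by
    simp only [t']
    split_ifs
    exacts [ht i, MeasurableSet.univ]
  have h1 : (fun p : α × (ℕ → α) => consSeq p.1 p.2) ⁻¹' Set.pi s t =
      t' 0 ×ˢ Set.pi (Finset.range n) fun i => t' (i + 1) := by
    ext p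
    simp only [Set.mem_preimage, Set.mem_pi, Finset.mem_coe, Set.mem_prod, Finset.mem_range]
    constructor
    · intro h
      refine ⟨?_, fun i _ => ?_⟩
      · simp only [t']
        split_ifs with h0
        exacts [h 0 h0, trivial]
      · simp only [t']
        split_ifs with h0
        exacts [h (i + 1) h0, trivial]
    · rintro ⟨h0, h1⟩ i hi
      cases i with
      | zero => simpa [t', hi] using h0
      | succ i =>
        have := h1 i (by simpa using hn hi)
        simpa [t', hi] using this
  rw [Measure.map_apply measurable_consSeq (MeasurableSet.pi s.countable_toSet fun i _ => ht i), h1,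
    Measure.prod_prod, Measure.infinitePi_pi _ fun i _ => ht' (i + 1)]
  have h2 : ∏ i ∈ s, μ (t i) = ∏ i ∈ Finset.range (n + 1), μ (t' i) := by
    rw [← Finset.prod_subset hn fun i _ hi => by simp [t', hi]]
    exact Finset.prod_congr rfl fun i hi => by simp [t', hi]
  rw [h2, Finset.prod_range_succ', mul_comm]

/-! ### The first jump -/

section FirstJump

variable {E : Type*} [MeasurableSpace E] (q : Kernel E E)

/-- The law of the jump path as a function of its starting point. -/
def pathKernel : Kernel E (JumpPath E) :=
  (chainKernel q).prod (Kernel.const E (Measure.infinitePi fun _ : ℕ => expMeasure 1))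

instance : IsMarkovKernel (pathKernel q) := by
  unfold pathKernel
  infer_instance

lemma pathKernel_apply (x : E) : pathKernel q x =
    (chainKernel q x).prod (Measure.infinitePi fun _ : ℕ => expMeasure 1) := by
  rw [pathKernel, Kernel.prod_apply, Kernel.const_apply]

lemma lintegral_jumpLaw (ν : Measure E) [IsProbabilityMeasure ν] {F : JumpPath E → ℝ≥0∞}
    (hF : Measurable F) :
    ∫⁻ ω, F ω ∂(jumpLaw q ν) = ∫⁻ x, ∫⁻ ω, F ω ∂(pathKernel q x) ∂ν := by
  rw [jumpLaw, lintegral_prod _ hF.aemeasurable, chainLaw_eq,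
    Measure.lintegral_bind (Kernel.aemeasurable _) hF.lintegral_prod_right'.aemeasurable]
  refine lintegral_congr fun x => ?_
  rw [pathKernel_apply, lintegral_prod _ hF.aemeasurable]

lemma jumpLaw_eq_bind (ν : Measure E) [IsProbabilityMeasure ν] :
    jumpLaw q ν = (pathKernel q) ∘ₘ ν := by
  ext A hA
  rw [← lintegral_indicator_one hA, lintegral_jumpLaw q ν (measurable_one.indicator hA),
    Measure.bind_apply hA (Kernel.aemeasurable _)]
  simp_rw [lintegral_indicator_one hA]

lemma jumpLaw_dirac (x : E) : jumpLaw q (Measure.dirac x) = pathKernel q x := by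
  rw [jumpLaw_eq_bind, Measure.dirac_bind (Kernel.measurable _)]

instance (ν : Measure E) [IsProbabilityMeasure ν] : IsProbabilityMeasure (jumpLaw q ν) := by
  rw [jumpLaw_eq_bind]
  infer_instance

/-- The path that starts in `x`, waits for the time determined by `e`, and then follows `ω`. -/
def consPath (x : E) (e : ℝ) (ω : JumpPath E) : JumpPath E := (consSeq x ω.1, consSeq e ω.2)

lemma measurable_consPath : Measurable fun p : E × ℝ × JumpPath E => consPath p.1 p.2.1 p.2.2 :=
  (measurable_consSeq.comp (measurable_fst.prodMk measurable_snd.snd.fst)).prodMk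
    (measurable_consSeq.comp (measurable_snd.fst.prodMk measurable_snd.snd.snd))

/-- Decomposition of the law of the jump path at the first jump. -/
lemma lintegral_pathKernel (x : E) {F : JumpPath E → ℝ≥0∞} (hF : Measurable F) :
    ∫⁻ ω, F ω ∂(pathKernel q x) =
      ∫⁻ e, ∫⁻ y, ∫⁻ ω, F (consPath x e ω) ∂(pathKernel q y) ∂(jumpKernel q x)
        ∂(expMeasure 1) := by
  have hc : Measurable (consSeq x : (ℕ → E) → ℕ → E) :=
    measurable_consSeq.comp measurable_prodMk_left
  have h1 : Measurable fun p : (ℕ → E) × (ℝ × (ℕ → ℝ)) => F (consSeq x p.1, consSeq p.2.1 p.2.2) :=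
    hF.comp ((hc.comp measurable_fst).prodMk (measurable_consSeq.comp measurable_snd))
  rw [pathKernel_apply, lintegral_prod _ hF.aemeasurable, chainKernel_eq_map_consSeq,
    lintegral_map hF.lintegral_prod_right' hc]
  have h2 : ∀ u : ℕ → E, ∫⁻ v, F (consSeq x u, v) ∂(Measure.infinitePi fun _ : ℕ => expMeasure 1) =
      ∫⁻ e, ∫⁻ v, F (consSeq x u, consSeq e v) ∂(Measure.infinitePi fun _ : ℕ => expMeasure 1)
        ∂(expMeasure 1) := by
    intro u
    conv_lhs => rw [infinitePi_eq_map_consSeq]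
    rw [lintegral_map (hF.fun_comp measurable_prodMk_left) measurable_consSeq,
      lintegral_prod _ (h1.fun_comp measurable_prodMk_left).aemeasurable]
  simp_rw [h2]
  have h3 : Measurable fun p : (ℕ → E) × ℝ => ∫⁻ v, F (consSeq x p.1, consSeq p.2 v)
      ∂(Measure.infinitePi fun _ : ℕ => expMeasure 1) := by
    refine Measurable.lintegral_prod_right (f := fun (p : (ℕ → E) × ℝ) (v : ℕ → ℝ) =>
      F (consSeq x p.1, consSeq p.2 v)) ?_
    exact h1.comp ((measurable_fst.fst).prodMk (measurable_fst.snd.prodMk measurable_snd))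
  rw [lintegral_lintegral_swap h3.aemeasurable]
  refine lintegral_congr fun e => ?_
  rw [chainLaw_eq, Measure.lintegral_bind (Kernel.aemeasurable _)
    (h3.fun_comp measurable_prodMk_right).aemeasurable]
  refine lintegral_congr fun y => ?_
  rw [pathKernel_apply, lintegral_prod]
  · rfl
  · exact (h1.fun_comp (measurable_fst.prodMk
      (measurable_const.prodMk measurable_snd))).aemeasurable

end FirstJump

section Paths

variable {E : Type*} [MeasurableSpace E] (q : Kernel E E)

/-! ### Jump times and states of a path -/

lemma jumpTime_zero (ω : JumpPath E) : jumpTime q 0 ω = 0 := by simp [jumpTime]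

lemma jumpTime_mono (ω : JumpPath E) : Monotone fun n => jumpTime q n ω :=
  fun _ _ h => Finset.sum_le_sum_of_subset (Finset.range_mono h)

lemma measurable_jumpTime (n : ℕ) : Measurable (jumpTime q n) := by
  unfold jumpTime
  refine Finset.measurable_sum _ fun k _ => Measurable.div ?_ ?_
  · exact ((measurable_pi_apply k).comp measurable_snd).ennreal_ofReal
  · exact (measurable_totalRate q).comp ((measurable_pi_apply k).comp measurable_fst)

lemma jumpTime_succ_consPath (x : E) (e : ℝ) (ω : JumpPath E) (n : ℕ) :
    jumpTime q (n + 1) (consPath x e ω) =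
      ENNReal.ofReal e / q x Set.univ + jumpTime q n ω := by
  rw [jumpTime, Finset.sum_range_succ', add_comm]
  rfl

/-- The path makes finitely many jumps in bounded time. -/
def NonExplosivePath (ω : JumpPath E) : Prop := ∀ t : ℝ≥0, ∃ n, (t : ℝ≥0∞) < jumpTime q n ω

/-- The path has made exactly `n` jumps at time `t`. -/
def JumpsAt (n : ℕ) (t : ℝ≥0) (ω : JumpPath E) : Prop :=
  jumpTime q n ω ≤ t ∧ (t : ℝ≥0∞) < jumpTime q (n + 1) ω

variable {q}

lemma NonExplosivePath.exists_jumpsAt {ω : JumpPath E} (h : NonExplosivePath q ω) (t : ℝ≥0) :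
    ∃ n, JumpsAt q n t ω := by
  classical
  have h' : ∃ n, (t : ℝ≥0∞) < jumpTime q (n + 1) ω := by
    obtain ⟨n, hn⟩ := h t
    exact ⟨n, hn.trans_le (jumpTime_mono q ω n.le_succ)⟩
  refine ⟨Nat.find h', ?_, Nat.find_spec h'⟩
  rcases Nat.eq_zero_or_pos (Nat.find h') with h0 | h0
  · rw [h0, jumpTime_zero]
    exact zero_le
  · have := Nat.find_min h' (show Nat.find h' - 1 < Nat.find h' by omega)
    rw [show Nat.find h' - 1 + 1 = Nat.find h' by omega] at this
    exact not_lt.1 this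

lemma JumpsAt.unique {ω : JumpPath E} {n m : ℕ} {t : ℝ≥0} (hn : JumpsAt q n t ω)
    (hm : JumpsAt q m t ω) : n = m := by
  by_contra hne
  rcases lt_or_gt_of_ne hne with h | h
  · exact absurd (hn.2.trans_le (jumpTime_mono q ω h)) (not_lt.2 hm.1)
  · exact absurd (hm.2.trans_le (jumpTime_mono q ω h)) (not_lt.2 hn.1)

lemma JumpsAt.jumpProcess_eq {ω : JumpPath E} {n : ℕ} {t : ℝ≥0} (hn : JumpsAt q n t ω) :
    jumpProcess q t ω = ω.1 n := by
  classical
  have h' : ∃ n, (t : ℝ≥0∞) < jumpTime q (n + 1) ω := ⟨n, hn.2⟩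
  rw [jumpProcess, dif_pos h']
  refine congrArg ω.1 ((Nat.find_eq_iff h').2 ?_)
  exact ⟨hn.2, fun m hm => not_lt.2 ((jumpTime_mono q ω hm).trans hn.1)⟩

lemma measurableSet_jumpsAt (n : ℕ) :
    MeasurableSet {p : ℝ≥0 × JumpPath E | JumpsAt q n p.1 p.2} :=
  (measurableSet_le ((measurable_jumpTime q n).comp measurable_snd)
      (measurable_coe_nnreal_ennreal.comp measurable_fst)).inter
    (measurableSet_lt (measurable_coe_nnreal_ennreal.comp measurable_fst)
      ((measurable_jumpTime q (n + 1)).comp measurable_snd))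

/-- The states of the jump process are jointly measurable in time and path. -/
lemma measurable_jumpProcess_prod :
    Measurable fun p : ℝ≥0 × JumpPath E => jumpProcess q p.1 p.2 := by
  classical
  have hS (n : ℕ) : MeasurableSet
      {p : ℝ≥0 × JumpPath E | (p.1 : ℝ≥0∞) < jumpTime q (n + 1) p.2} :=
    measurableSet_lt (measurable_coe_nnreal_ennreal.comp measurable_fst)
      ((measurable_jumpTime q (n + 1)).comp measurable_snd)
  -- The process is the jump chain evaluated at the random index N, so measurability reduces to that
  -- of N, which has countably many values. The value 0 past an explosion matches the convention of
  -- `jumpProcess`.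
  let N : ℝ≥0 × JumpPath E → ℕ := fun p =>
    if h : ∃ n, (p.1 : ℝ≥0∞) < jumpTime q (n + 1) p.2 then Nat.find h else 0
  have hN : Measurable N := by
    refine measurable_to_countable' fun n => ?_
    have : N ⁻¹' {n} = ({p | (p.1 : ℝ≥0∞) < jumpTime q (n + 1) p.2} ∩
        ⋂ m ∈ Finset.range n, {p | (p.1 : ℝ≥0∞) < jumpTime q (m + 1) p.2}ᶜ) ∪
        if n = 0 then ⋂ m : ℕ, {p | (p.1 : ℝ≥0∞) < jumpTime q (m + 1) p.2}ᶜ else ∅ := by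
      ext p
      by_cases h : ∃ n, (p.1 : ℝ≥0∞) < jumpTime q (n + 1) p.2
      · have h2 : p ∉ (if n = 0 then
            ⋂ m : ℕ, {p : ℝ≥0 × JumpPath E | (p.1 : ℝ≥0∞) < jumpTime q (m + 1) p.2}ᶜ else ∅) := by
          split_ifs
          · simpa using h
          · simp
        simp only [Set.mem_union, h2, or_false, Set.mem_preimage, Set.mem_singleton_iff, N,
          dif_pos h, Nat.find_eq_iff]
        simp
      · have h1 : p ∉ {p : ℝ≥0 × JumpPath E | (p.1 : ℝ≥0∞) < jumpTime q (n + 1) p.2} ∩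
            ⋂ m ∈ Finset.range n, {p | (p.1 : ℝ≥0∞) < jumpTime q (m + 1) p.2}ᶜ :=
          fun h' => h ⟨n, h'.1⟩
        simp only [Set.mem_union, h1, false_or, Set.mem_preimage, Set.mem_singleton_iff, N,
          dif_neg h]
        split_ifs with h0
        · push Not at h
          simpa [h0] using h
        · simpa [eq_comm] using h0
    rw [this]
    refine ((hS n).inter (Finset.measurableSet_biInter _ fun m _ => (hS m).compl)).union ?_
    split_ifs
    · exact MeasurableSet.iInter fun m => (hS m).compl
    · exact MeasurableSet.empty
  have h1 : (fun p : ℝ≥0 × JumpPath E => jumpProcess q p.1 p.2) =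
      (fun r : (ℕ → E) × ℕ => r.1 r.2) ∘ fun p => (p.2.1, N p) := by
    funext p
    simp only [Function.comp, jumpProcess, N]
    split_ifs <;> rfl
  have h2 : Measurable fun r : (ℕ → E) × ℕ => r.1 r.2 :=
    measurable_from_prod_countable_left fun n => measurable_pi_apply n
  have h3 : Measurable fun p : ℝ≥0 × JumpPath E => (p.2.1, N p) := measurable_snd.fst.prodMk hN
  rw [h1]
  exact h2.comp h3

lemma measurable_jumpProcess (t : ℝ≥0) : Measurable (jumpProcess q t) :=
  Measurable.comp (g := fun p : ℝ≥0 × JumpPath E => jumpProcess q p.1 p.2)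
    (f := fun ω => (t, ω)) measurable_jumpProcess_prod measurable_prodMk_left

/-! ### Holding times, and paths with a first jump put in front -/

variable (q)

/-- The time spent in `x` when the exponential variable takes the value `e`. -/
def holdTime (x : E) (e : ℝ) : ℝ≥0 := e.toNNReal / (q x Set.univ).toNNReal

/-- Every state is left at a positive and finite rate and there is no explosion. -/
structure RegularRates : Prop where
  ne_zero : ∀ x, q x Set.univ ≠ 0
  ne_top : ∀ x, q x Set.univ ≠ ∞
  nonExplosive : ∀ x, ∀ᵐ ω ∂(pathKernel q x), NonExplosivePath q ω

variable {q}

lemma coe_holdTime (h0 : ∀ x, q x Set.univ ≠ 0) (h1 : ∀ x, q x Set.univ ≠ ∞) (x : E) (e : ℝ) :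
    (holdTime q x e : ℝ≥0∞) = ENNReal.ofReal e / q x Set.univ := by
  have h2 : (q x Set.univ).toNNReal ≠ 0 := by simp [ENNReal.toNNReal_eq_zero_iff, h0 x, h1 x]
  rw [holdTime, ENNReal.coe_div h2, ENNReal.coe_toNNReal (h1 x)]
  rfl

section Cons

variable (h0 : ∀ x, q x Set.univ ≠ 0) (h1 : ∀ x, q x Set.univ ≠ ∞) {x : E} {e : ℝ}
  {ω : JumpPath E} {t : ℝ≥0}
include h0 h1

lemma jumpsAt_zero_consPath : JumpsAt q 0 t (consPath x e ω) ↔ t < holdTime q x e := by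
  rw [JumpsAt, jumpTime_zero, jumpTime_succ_consPath, jumpTime_zero, add_zero,
    ← coe_holdTime h0 h1, ENNReal.coe_lt_coe]
  simp

lemma jumpsAt_succ_consPath {n : ℕ} :
    JumpsAt q (n + 1) t (consPath x e ω) ↔
      holdTime q x e ≤ t ∧ JumpsAt q n (t - holdTime q x e) ω := by
  rw [JumpsAt, JumpsAt, jumpTime_succ_consPath, jumpTime_succ_consPath, ← coe_holdTime h0 h1,
    ENNReal.coe_sub]
  constructor
  · rintro ⟨ha, hb⟩
    have hle : (holdTime q x e : ℝ≥0∞) ≤ t := le_self_add.trans ha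
    refine ⟨by exact_mod_cast hle, ?_, ?_⟩
    · exact ENNReal.le_sub_of_add_le_left ENNReal.coe_ne_top ha
    · exact ENNReal.sub_lt_of_lt_add hle (by rwa [add_comm] at hb)
  · rintro ⟨hle, ha, hb⟩
    have hle : (holdTime q x e : ℝ≥0∞) ≤ t := by exact_mod_cast hle
    have h2 : (t : ℝ≥0∞) = holdTime q x e + (t - holdTime q x e) := (add_tsub_cancel_of_le hle).symm
    refine ⟨?_, ?_⟩
    · rw [h2]
      gcongr
    · rw [h2]
      exact (ENNReal.add_lt_add_iff_left ENNReal.coe_ne_top).2 hb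

lemma jumpProcess_consPath_of_lt (ht : t < holdTime q x e) :
    jumpProcess q t (consPath x e ω) = x :=
  ((jumpsAt_zero_consPath h0 h1).2 ht).jumpProcess_eq

/-- After its first jump the path follows ω with the clock reset. Past an explosion the default
value is the initial state, which differs in general between the two paths; this is where
non-explosion enters. -/
lemma jumpProcess_consPath_of_le (hω : NonExplosivePath q ω) (ht : holdTime q x e ≤ t) :
    jumpProcess q t (consPath x e ω) = jumpProcess q (t - holdTime q x e) ω := by
  obtain ⟨n, hn⟩ := hω.exists_jumpsAt (t - holdTime q x e)
  rw [((jumpsAt_succ_consPath h0 h1).2 ⟨ht, hn⟩).jumpProcess_eq, hn.jumpProcess_eq]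
  rfl

end Cons

lemma lt_holdTime_iff (h0 : ∀ x, q x Set.univ ≠ 0) (h1 : ∀ x, q x Set.univ ≠ ∞) (x : E) (e : ℝ)
    (t : ℝ≥0) : t < holdTime q x e ↔ (t * (q x Set.univ).toNNReal : ℝ≥0) < e := by
  have h2 : 0 < (q x Set.univ).toNNReal := by
    rw [pos_iff_ne_zero]
    simp [ENNReal.toNNReal_eq_zero_iff, h0 x, h1 x]
  rw [holdTime, lt_div_iff₀ h2, Real.lt_toNNReal_iff_coe_lt]

end Paths

section Markov

variable {E : Type*} [MeasurableSpace E] {q : Kernel E E}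

/-! ### The Markov property of the jump process -/

variable (q) in
/-- The transition kernels of the jump process. -/
def transition (t : ℝ≥0) : Kernel E E := (pathKernel q).map (jumpProcess q t)

instance (t : ℝ≥0) : IsMarkovKernel (transition q t) :=
  Kernel.IsMarkovKernel.map _ (measurable_jumpProcess t)

lemma lintegral_transition (t : ℝ≥0) (x : E) {g : E → ℝ≥0∞} (hg : Measurable g) :
    ∫⁻ y, g y ∂(transition q t x) = ∫⁻ ω, g (jumpProcess q t ω) ∂(pathKernel q x) := by
  rw [transition, Kernel.lintegral_map _ (measurable_jumpProcess t) _ hg]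

lemma lintegral_pathKernel' (x : E) {F : JumpPath E → ℝ≥0∞} (hF : Measurable F) :
    ∫⁻ ω, F ω ∂(pathKernel q x) =
      ∫⁻ e, ∫⁻ ω, F (consPath x e ω) ∂(jumpLaw q (jumpKernel q x)) ∂(expMeasure 1) := by
  rw [lintegral_pathKernel q x hF]
  refine lintegral_congr fun e => ?_
  rw [lintegral_jumpLaw q _ (F := fun ω => F (consPath x e ω))]
  exact hF.comp (measurable_consPath.comp (measurable_const.prodMk
    (measurable_const.prodMk measurable_id)))

lemma ae_jumpLaw {p : JumpPath E → Prop} (hp : MeasurableSet {ω | p ω}) (ν : Measure E)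
    [IsProbabilityMeasure ν] (h : ∀ x, ∀ᵐ ω ∂(pathKernel q x), p ω) : ∀ᵐ ω ∂(jumpLaw q ν), p ω := by
  rw [jumpLaw_eq_bind]
  exact Measure.ae_comp_of_ae_ae hp (ae_of_all _ h)

lemma nonExplosivePath_iff {ω : JumpPath E} :
    NonExplosivePath q ω ↔ ∀ k : ℕ, ∃ n, (k : ℝ≥0∞) < jumpTime q n ω := by
  refine ⟨fun h k => ?_, fun h t => ?_⟩
  · simpa using h k
  · obtain ⟨k, hk⟩ := exists_nat_ge t
    obtain ⟨n, hn⟩ := h k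
    exact ⟨n, lt_of_le_of_lt (by exact_mod_cast hk) hn⟩

lemma measurableSet_nonExplosivePath : MeasurableSet {ω : JumpPath E | NonExplosivePath q ω} := by
  simp_rw [nonExplosivePath_iff, Set.ofPred_forall, Set.ofPred_exists]
  exact MeasurableSet.iInter fun k => MeasurableSet.iUnion fun n =>
    measurableSet_lt measurable_const (measurable_jumpTime q n)

lemma measurableSet_jumpsAt_fixed (n : ℕ) (t : ℝ≥0) :
    MeasurableSet {ω : JumpPath E | JumpsAt q n t ω} :=
  measurable_prodMk_left (measurableSet_jumpsAt (q := q) n)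

/-- Without explosion, the events of having made exactly n jumps at time s partition the path space
up to a null set. This reduces the Markov property to an induction on n. -/
lemma lintegral_eq_tsum_jumpsAt {μ : Measure (JumpPath E)}
    (hμ : ∀ᵐ ω ∂μ, NonExplosivePath q ω) (s : ℝ≥0) {F : JumpPath E → ℝ≥0∞} (hF : Measurable F) :
    ∫⁻ ω, F ω ∂μ = ∑' n, ∫⁻ ω, {ω | JumpsAt q n s ω}.indicator F ω ∂μ := by
  rw [← lintegral_tsum fun n => (hF.indicator (measurableSet_jumpsAt_fixed n s)).aemeasurable]
  refine lintegral_congr_ae ?_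
  filter_upwards [hμ] with ω hω
  obtain ⟨n, hn⟩ := hω.exists_jumpsAt s
  rw [tsum_eq_single n]
  · exact (Set.indicator_of_mem (s := {ω | JumpsAt q n s ω}) hn F).symm
  · intro m hm
    exact Set.indicator_of_notMem (s := {ω | JumpsAt q m s ω}) (fun h => hm (h.unique hn)) F

lemma measurable_lintegral_transition {ι : Type*} (u : ι → ℝ≥0) (s t : ℝ≥0)
    {H : (ι → E) × E → ℝ≥0∞} (hH : Measurable H) :
    Measurable fun ω : JumpPath E =>
      ∫⁻ y, H (fun i => jumpProcess q (u i) ω, y) ∂(transition q t (jumpProcess q s ω)) := by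
  have hX : Measurable fun ω : JumpPath E => fun i => jumpProcess q (u i) ω :=
    measurable_pi_iff.2 fun i => measurable_jumpProcess (u i)
  have h1 := Measurable.lintegral_kernel_prod_right
    (κ := (transition q t).comap (jumpProcess q s) (measurable_jumpProcess s))
    (f := fun ω y => H (fun i => jumpProcess q (u i) ω, y))
    (hH.comp ((hX.comp measurable_fst).prodMk measurable_snd))
  exact h1

lemma measurable_joint_jumpProcess {ι : Type*} (u : ι → ℝ≥0) (s : ℝ≥0)
    {H : (ι → E) × E → ℝ≥0∞} (hH : Measurable H) :
    Measurable fun ω : JumpPath E => H (fun i => jumpProcess q (u i) ω, jumpProcess q s ω) :=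
  hH.comp ((measurable_pi_iff.2 fun i => measurable_jumpProcess (u i)).prodMk
    (measurable_jumpProcess s))

lemma RegularRates.ae_jumpLaw_nonExplosive (hq : RegularRates q) (ν : Measure E)
    [IsProbabilityMeasure ν] : ∀ᵐ ω ∂(jumpLaw q ν), NonExplosivePath q ω :=
  ae_jumpLaw measurableSet_nonExplosivePath ν hq.nonExplosive

lemma RegularRates.rate_toReal (hq : RegularRates q) (x : E) :
    0 < (q x Set.univ).toNNReal := by
  rw [pos_iff_ne_zero]
  simp [ENNReal.toNNReal_eq_zero_iff, hq.ne_zero x, hq.ne_top x]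

/-- Translates the shift of the exponential variable in the memoryless property into a shift of the
holding time by s. Both sides are truncated at zero, so no condition on e is required. -/
lemma holdTime_sub (hq : RegularRates q) (x : E) (e : ℝ) (s : ℝ≥0) :
    holdTime q x (e - (s * (q x Set.univ).toNNReal : ℝ≥0)) = holdTime q x e - s := by
  have h := hq.rate_toReal x
  rw [holdTime, holdTime]
  have h1 : (e - (s * (q x Set.univ).toNNReal : ℝ≥0) : ℝ).toNNReal =
      e.toNNReal - s * (q x Set.univ).toNNReal := by
    rw [sub_eq_add_neg, ← NNReal.coe_inj, NNReal.coe_sub_def, Real.coe_toNNReal']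
    rcases le_total e 0 with he | he
    · rw [Real.toNNReal_of_nonpos he, NNReal.coe_zero, max_eq_right, max_eq_right] <;>
      linarith [NNReal.coe_nonneg (s * (q x Set.univ).toNNReal)]
    · rw [Real.coe_toNNReal _ he, sub_eq_add_neg]
  rw [h1, NNReal.sub_div, mul_div_cancel_right₀ _ h.ne']

/-- The process restarts after a time `s` during which the starting point was not left. -/
lemma lintegral_jumpsAt_zero (hq : RegularRates q) (x : E) (s t : ℝ≥0) {g : E → ℝ≥0∞}
    (hg : Measurable g) :
    ∫⁻ ω, {ω | JumpsAt q 0 s ω}.indicator (fun ω => g (jumpProcess q (s + t) ω)) ω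
        ∂(pathKernel q x) =
      ENNReal.ofReal (Real.exp (-(s * (q x Set.univ).toNNReal : ℝ≥0))) *
        ∫⁻ y, g y ∂(transition q t x) := by
  have hm (r : ℝ≥0) : Measurable fun ω : JumpPath E => g (jumpProcess q r ω) :=
    hg.comp (measurable_jumpProcess r)
  have hcons : Measurable fun p : ℝ × JumpPath E => consPath x p.1 p.2 :=
    measurable_consPath.comp (measurable_const.prodMk measurable_id)
  rw [lintegral_transition t x hg, lintegral_pathKernel' x (hm t),
    lintegral_pathKernel' x ((hm (s + t)).indicator (measurableSet_jumpsAt_fixed 0 s)),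
    ← lintegral_expMeasure_memoryless ?_ (NNReal.coe_nonneg _), ← lintegral_indicator
      measurableSet_Ioi]
  · refine lintegral_congr fun e => ?_
    by_cases he : e ∈ Set.Ioi ((s * (q x Set.univ).toNNReal : ℝ≥0) : ℝ)
    · rw [Set.indicator_of_mem he]
      have hs : s < holdTime q x e := (lt_holdTime_iff hq.ne_zero hq.ne_top x e s).2 he
      refine lintegral_congr_ae ?_
      filter_upwards [hq.ae_jumpLaw_nonExplosive (jumpKernel q x)] with ω hω
      have hmem : JumpsAt q 0 s (consPath x e ω) :=
        (jumpsAt_zero_consPath hq.ne_zero hq.ne_top).2 hs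
      rw [Set.indicator_of_mem (s := {ω | JumpsAt q 0 s ω}) hmem]
      congr 1
      have h2 := holdTime_sub hq x e s
      by_cases ht : t < holdTime q x e - s
      · have ht' : s + t < holdTime q x e := by
          rw [add_comm]
          exact lt_tsub_iff_right.1 ht
        rw [← h2] at ht
        rw [jumpProcess_consPath_of_lt hq.ne_zero hq.ne_top ht',
          jumpProcess_consPath_of_lt hq.ne_zero hq.ne_top ht]
      · have ht' : holdTime q x e ≤ s + t := by
          rw [add_comm]
          exact tsub_le_iff_right.1 (not_lt.1 ht)
        rw [← h2] at ht
        rw [jumpProcess_consPath_of_le hq.ne_zero hq.ne_top hω ht',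
          jumpProcess_consPath_of_le hq.ne_zero hq.ne_top hω (not_lt.1 ht), h2]
        congr 1
        rw [tsub_tsub_eq_add_tsub_of_le hs.le, add_comm]
    · rw [Set.indicator_of_notMem he]
      have hs : ¬ s < holdTime q x e := fun h =>
        he ((lt_holdTime_iff hq.ne_zero hq.ne_top x e s).1 h)
      have hmem (ω) : ¬ JumpsAt q 0 s (consPath x e ω) := fun h =>
        hs ((jumpsAt_zero_consPath hq.ne_zero hq.ne_top).1 h)
      simp [Set.indicator, hmem]
  · exact Measurable.lintegral_prod_right (f := fun (e : ℝ) (ω : JumpPath E) =>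
      g (jumpProcess q t (consPath x e ω))) ((hm t).comp hcons)

lemma jumpProcess_consPath_of_jumpsAt_zero (hq : RegularRates q) {x : E} {e : ℝ}
    {ω : JumpPath E} {s r : ℝ≥0} (h : JumpsAt q 0 s (consPath x e ω)) (hr : r ≤ s) :
    jumpProcess q r (consPath x e ω) = x :=
  jumpProcess_consPath_of_lt hq.ne_zero hq.ne_top
    (hr.trans_lt ((jumpsAt_zero_consPath hq.ne_zero hq.ne_top).1 h))

/-- If no jump has occurred by time s, the past is constant and the absence of memory restarts the
process. Otherwise the first jump is removed and the claim is applied to the remaining path at time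
s minus the holding time. The index set of past times is arbitrary, so that the whole past can be
used in the conditional expectation. -/
lemma lintegral_jumpsAt_markov (hq : RegularRates q) {ι : Type*} (n : ℕ) :
    ∀ (x : E) (u : ι → ℝ≥0) (s t : ℝ≥0), (∀ i, u i ≤ s) → ∀ H : (ι → E) × E → ℝ≥0∞,
      Measurable H →
      ∫⁻ ω, {ω | JumpsAt q n s ω}.indicator
          (fun ω => H (fun i => jumpProcess q (u i) ω, jumpProcess q (s + t) ω)) ω
          ∂(pathKernel q x) =
        ∫⁻ ω, {ω | JumpsAt q n s ω}.indicator (fun ω =>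
          ∫⁻ y, H (fun i => jumpProcess q (u i) ω, y) ∂(transition q t (jumpProcess q s ω))) ω
          ∂(pathKernel q x) := by
  induction n with
  | zero =>
    intro x u s t hu H hH
    have hH' : Measurable fun y => H (fun _ => x, y) := hH.comp measurable_prodMk_left
    have key := lintegral_jumpsAt_zero hq x s t hH'
    -- For a constant function, the same formula gives the probability that no jump occurs by time s
    -- times the constant. This evaluates the right-hand side.
    have key2 := lintegral_jumpsAt_zero hq x s 0
      (g := fun _ => ∫⁻ y, H (fun _ => x, y) ∂(transition q t x)) measurable_const
    rw [lintegral_const, measure_univ (μ := transition q 0 x), mul_one] at key2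
    rw [← key2] at key
    rw [lintegral_pathKernel' x ((measurable_joint_jumpProcess u (s + t) hH).indicator
        (measurableSet_jumpsAt_fixed 0 s)),
      lintegral_pathKernel' x ((measurable_lintegral_transition u s t hH).indicator
        (measurableSet_jumpsAt_fixed 0 s))]
    rw [lintegral_pathKernel' x ((hH'.fun_comp (measurable_jumpProcess (s + t))).indicator
        (measurableSet_jumpsAt_fixed 0 s)),
      lintegral_pathKernel' x (measurable_const.indicator
        (measurableSet_jumpsAt_fixed 0 s))] at key
    refine Eq.trans ?_ (key.trans ?_)
    · refine lintegral_congr fun e => lintegral_congr fun ω => ?_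
      by_cases h : JumpsAt q 0 s (consPath x e ω)
      · rw [Set.indicator_of_mem (s := {ω | JumpsAt q 0 s ω}) h,
          Set.indicator_of_mem (s := {ω | JumpsAt q 0 s ω}) h]
        congr 2
        funext i
        exact jumpProcess_consPath_of_jumpsAt_zero hq h (hu i)
      · rw [Set.indicator_of_notMem (s := {ω | JumpsAt q 0 s ω}) h,
          Set.indicator_of_notMem (s := {ω | JumpsAt q 0 s ω}) h]
    · refine lintegral_congr fun e => lintegral_congr fun ω => ?_
      by_cases h : JumpsAt q 0 s (consPath x e ω)
      · rw [Set.indicator_of_mem (s := {ω | JumpsAt q 0 s ω}) h,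
          Set.indicator_of_mem (s := {ω | JumpsAt q 0 s ω}) h,
          jumpProcess_consPath_of_jumpsAt_zero hq h le_rfl]
        refine lintegral_congr fun y => ?_
        congr 2
        funext i
        exact (jumpProcess_consPath_of_jumpsAt_zero hq h (hu i)).symm
      · rw [Set.indicator_of_notMem (s := {ω | JumpsAt q 0 s ω}) h,
          Set.indicator_of_notMem (s := {ω | JumpsAt q 0 s ω}) h]
  | succ n ih =>
    intro x u s t hu H hH
    rw [lintegral_pathKernel' x ((measurable_joint_jumpProcess u (s + t) hH).indicator
        (measurableSet_jumpsAt_fixed (n + 1) s)),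
      lintegral_pathKernel' x ((measurable_lintegral_transition u s t hH).indicator
        (measurableSet_jumpsAt_fixed (n + 1) s))]
    refine lintegral_congr fun e => ?_
    by_cases he : holdTime q x e ≤ s
    swap
    · have hmem (ω) : ¬ JumpsAt q (n + 1) s (consPath x e ω) := fun h =>
        he ((jumpsAt_succ_consPath hq.ne_zero hq.ne_top).1 h).1
      simp [Set.indicator, hmem]
    set h := holdTime q x e with hh
    -- Past times before the first jump see x; the others are seen by the remaining path at the
    -- shifted time. The truncated value of `u i - h` is irrelevant for the former.
    let H' : (ι → E) × E → ℝ≥0∞ := fun p => H (fun i => if u i < h then x else p.1 i, p.2)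
    have hH' : Measurable H' := by
      refine hH.comp (Measurable.prodMk (measurable_pi_iff.2 fun i => ?_) measurable_snd)
      split_ifs
      · exact measurable_const
      · exact (measurable_pi_apply i).comp measurable_fst
    have hu' : ∀ i, u i - h ≤ s - h := fun i => tsub_le_tsub_right (hu i) h
    have hX : ∀ ω, NonExplosivePath q ω → (fun i => jumpProcess q (u i) (consPath x e ω)) =
        fun i => if u i < h then x else jumpProcess q (u i - h) ω := by
      intro ω hω
      funext i
      split_ifs with hi
      · exact jumpProcess_consPath_of_lt hq.ne_zero hq.ne_top hi
      · exact jumpProcess_consPath_of_le hq.ne_zero hq.ne_top hω (not_lt.1 hi)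
    have hmem (ω) : JumpsAt q (n + 1) s (consPath x e ω) ↔ JumpsAt q n (s - h) ω := by
      rw [jumpsAt_succ_consPath hq.ne_zero hq.ne_top]
      exact and_iff_right he
    have e1 := lintegral_congr (μ := jumpKernel q x)
      fun y => ih y (fun i => u i - h) (s - h) t hu' H' hH'
    rw [← lintegral_jumpLaw q _ ((measurable_joint_jumpProcess _ _ hH').indicator
        (measurableSet_jumpsAt_fixed n _)),
      ← lintegral_jumpLaw q _ ((measurable_lintegral_transition _ _ t hH').indicator
        (measurableSet_jumpsAt_fixed n _))] at e1
    refine Eq.trans ?_ (e1.trans ?_)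
    · refine lintegral_congr_ae ?_
      filter_upwards [hq.ae_jumpLaw_nonExplosive (jumpKernel q x)] with ω hω
      by_cases hj : JumpsAt q n (s - h) ω
      · rw [Set.indicator_of_mem (s := {ω | JumpsAt q (n + 1) s ω}) ((hmem ω).2 hj),
          Set.indicator_of_mem (s := {ω | JumpsAt q n (s - h) ω}) hj, hX ω hω,
          jumpProcess_consPath_of_le hq.ne_zero hq.ne_top hω (he.trans le_self_add),
          ← hh, tsub_add_eq_add_tsub he]
      · rw [Set.indicator_of_notMem (s := {ω | JumpsAt q (n + 1) s ω}) (mt (hmem ω).1 hj),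
          Set.indicator_of_notMem (s := {ω | JumpsAt q n (s - h) ω}) hj]
    · refine lintegral_congr_ae ?_
      filter_upwards [hq.ae_jumpLaw_nonExplosive (jumpKernel q x)] with ω hω
      by_cases hj : JumpsAt q n (s - h) ω
      · rw [Set.indicator_of_mem (s := {ω | JumpsAt q (n + 1) s ω}) ((hmem ω).2 hj),
          Set.indicator_of_mem (s := {ω | JumpsAt q n (s - h) ω}) hj, hX ω hω,
          jumpProcess_consPath_of_le hq.ne_zero hq.ne_top hω he]
      · rw [Set.indicator_of_notMem (s := {ω | JumpsAt q (n + 1) s ω}) (mt (hmem ω).1 hj),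
          Set.indicator_of_notMem (s := {ω | JumpsAt q n (s - h) ω}) hj]

/-- The Markov property at a fixed time. -/
theorem lintegral_jumpProcess_markov (hq : RegularRates q) {ι : Type*} (ν : Measure E)
    [IsProbabilityMeasure ν] (u : ι → ℝ≥0) (s t : ℝ≥0) (hu : ∀ i, u i ≤ s)
    {H : (ι → E) × E → ℝ≥0∞} (hH : Measurable H) :
    ∫⁻ ω, H (fun i => jumpProcess q (u i) ω, jumpProcess q (s + t) ω) ∂(jumpLaw q ν) =
      ∫⁻ ω, ∫⁻ y, H (fun i => jumpProcess q (u i) ω, y) ∂(transition q t (jumpProcess q s ω))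
        ∂(jumpLaw q ν) := by
  rw [lintegral_jumpLaw q ν (measurable_joint_jumpProcess u (s + t) hH),
    lintegral_jumpLaw q ν (measurable_lintegral_transition u s t hH)]
  refine lintegral_congr fun x => ?_
  rw [lintegral_eq_tsum_jumpsAt (hq.nonExplosive x) s (measurable_joint_jumpProcess u (s + t) hH),
    lintegral_eq_tsum_jumpsAt (hq.nonExplosive x) s (measurable_lintegral_transition u s t hH)]
  exact tsum_congr fun n => lintegral_jumpsAt_markov hq n x u s t hu H hH

end Markov

section Semigroup

variable {E : Type*} [MeasurableSpace E] {q : Kernel E E}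

/-! ### The transition semigroup -/

/-- The exponential variable is almost surely positive, so the starting point is still occupied at
time 0. -/
lemma lintegral_transition_zero (hq : RegularRates q) (x : E) {g : E → ℝ≥0∞}
    (hg : Measurable g) : ∫⁻ y, g y ∂(transition q 0 x) = g x := by
  rw [lintegral_transition 0 x hg,
    lintegral_pathKernel' x (hg.fun_comp (measurable_jumpProcess 0))]
  have : ∀ᵐ e ∂(expMeasure 1), ∫⁻ ω, g (jumpProcess q 0 (consPath x e ω))
      ∂(jumpLaw q (jumpKernel q x)) = g x := by
    filter_upwards [ae_pos_expMeasure] with e he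
    have h0 : 0 < holdTime q x e := by
      rw [lt_holdTime_iff hq.ne_zero hq.ne_top]
      simpa using he
    simp_rw [jumpProcess_consPath_of_lt hq.ne_zero hq.ne_top h0]
    rw [lintegral_const, measure_univ, mul_one]
  rw [lintegral_congr_ae this, lintegral_const, measure_univ, mul_one]

lemma transition_zero (hq : RegularRates q) : transition q 0 = Kernel.id := by
  ext x A hA
  rw [← lintegral_indicator_one hA, lintegral_transition_zero hq x (measurable_one.indicator hA),
    Kernel.id_apply, Measure.dirac_apply' _ hA]

lemma lintegral_transition_add (hq : RegularRates q) (s t : ℝ≥0) (x : E) {g : E → ℝ≥0∞}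
    (hg : Measurable g) : ∫⁻ y, g y ∂(transition q (s + t) x) =
      ∫⁻ y, ∫⁻ z, g z ∂(transition q t y) ∂(transition q s x) := by
  rw [lintegral_transition (s + t) x hg, lintegral_transition s x hg.lintegral_kernel,
    ← jumpLaw_dirac]
  exact lintegral_jumpProcess_markov hq (ι := Empty) (Measure.dirac x) (fun i => i.elim) s t
    (fun i => i.elim) (H := fun p => g p.2) (hg.comp measurable_snd)

lemma transition_add (hq : RegularRates q) (s t : ℝ≥0) :
    transition q (s + t) = (transition q t) ∘ₖ (transition q s) := by
  ext x A hA
  rw [← lintegral_indicator_one hA,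
    lintegral_transition_add hq s t x (measurable_one.indicator hA), Kernel.comp_apply' _ _ _ hA]
  simp_rw [lintegral_indicator_one hA]

lemma lintegral_jumpsAt_zero_self (hq : RegularRates q) (x : E) (t : ℝ≥0) {g : E → ℝ≥0∞}
    (hg : Measurable g) :
    ∫⁻ ω, {ω | JumpsAt q 0 t ω}.indicator (fun ω => g (jumpProcess q t ω)) ω
        ∂(pathKernel q x) =
      ENNReal.ofReal (Real.exp (-(t * (q x Set.univ).toNNReal : ℝ≥0))) * g x := by
  have h := lintegral_jumpsAt_zero hq x t 0 hg
  rwa [add_zero, lintegral_transition_zero hq x hg] at h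

/-- Lower bound for the transition kernel: no jump, or one jump from a state to another that is
then not left. -/
lemma le_lintegral_transition (hq : RegularRates q) (x : E) (t : ℝ≥0) {g : E → ℝ≥0∞}
    (hg : Measurable g) :
    ENNReal.ofReal (Real.exp (-(t * (q x Set.univ).toNNReal : ℝ≥0))) * g x +
        ENNReal.ofReal (1 - Real.exp (-(t * (q x Set.univ).toNNReal : ℝ≥0))) *
          ∫⁻ y, ENNReal.ofReal (Real.exp (-(t * (q y Set.univ).toNNReal : ℝ≥0))) * g y
            ∂(jumpKernel q x) ≤
      ∫⁻ y, g y ∂(transition q t x) := by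
  rw [lintegral_transition t x hg,
    lintegral_pathKernel' x (hg.fun_comp (measurable_jumpProcess t))]
  simp_rw [← lintegral_jumpsAt_zero_self hq _ t hg]
  rw [← lintegral_jumpLaw q _ ((hg.fun_comp (measurable_jumpProcess t)).indicator
    (measurableSet_jumpsAt_fixed 0 t)), lintegral_jumpsAt_zero_self hq _ t hg]
  set c : ℝ := ((t * (q x Set.univ).toNNReal : ℝ≥0) : ℝ) with hc
  have hc0 : 0 ≤ c := NNReal.coe_nonneg _
  set B : ℝ≥0∞ := ∫⁻ ω, {ω | JumpsAt q 0 t ω}.indicator (fun ω => g (jumpProcess q t ω)) ω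
    ∂(jumpLaw q (jumpKernel q x)) with hB
  have h1 : expMeasure 1 (Set.Ioi c)ᶜ = ENNReal.ofReal (1 - Real.exp (-c)) := by
    rw [prob_compl_eq_one_sub measurableSet_Ioi, expMeasure_Ioi hc0,
      ENNReal.ofReal_sub _ (Real.exp_nonneg _), ENNReal.ofReal_one]
  rw [← expMeasure_Ioi hc0, ← h1, ← lintegral_add_compl _ (measurableSet_Ioi (a := c)),
    mul_comm, mul_comm _ B]
  refine add_le_add ?_ ?_
  · rw [← setLIntegral_const]
    refine setLIntegral_mono' measurableSet_Ioi fun e he => ?_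
    have he' : t < holdTime q x e := (lt_holdTime_iff hq.ne_zero hq.ne_top x e t).2 he
    simp_rw [jumpProcess_consPath_of_lt hq.ne_zero hq.ne_top he']
    rw [lintegral_const, measure_univ, mul_one]
  · rw [← setLIntegral_const]
    refine setLIntegral_mono' measurableSet_Ioi.compl fun e he => ?_
    have he' : holdTime q x e ≤ t := by
      by_contra hcon
      exact he ((lt_holdTime_iff hq.ne_zero hq.ne_top x e t).1 (not_le.1 hcon))
    refine lintegral_mono_ae ?_
    -- The second state only has to be kept for the remaining time. Requiring it to be kept for the
    -- full time t costs probability, but makes the bound a product, since the first holding time no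
    -- longer appears in it.
    filter_upwards [hq.ae_jumpLaw_nonExplosive (jumpKernel q x)] with ω hω
    by_cases hj : JumpsAt q 0 t ω
    · rw [Set.indicator_of_mem (s := {ω | JumpsAt q 0 t ω}) hj,
        jumpProcess_consPath_of_le hq.ne_zero hq.ne_top hω he']
      have hj' : JumpsAt q 0 (t - holdTime q x e) ω := by
        refine ⟨by simp [jumpTime_zero], lt_of_le_of_lt ?_ hj.2⟩
        exact_mod_cast tsub_le_self
      rw [hj.jumpProcess_eq, hj'.jumpProcess_eq]
    · rw [Set.indicator_of_notMem (s := {ω | JumpsAt q 0 t ω}) hj]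
      exact zero_le

lemma lintegral_jumpKernel {x : E} (h0 : q x Set.univ ≠ 0) (h1 : q x Set.univ ≠ ∞)
    (g : E → ℝ≥0∞) :
    ∫⁻ y, g y ∂(jumpKernel q x) = (q x Set.univ)⁻¹ * ∫⁻ y, g y ∂(q x) := by
  classical
  have hx : x ∈ activeStates q := ⟨h0, h1⟩
  rw [jumpKernel, Kernel.piecewise_apply, if_pos hx]
  change ∫⁻ y, g y ∂((q x Set.univ)⁻¹ • q x) = _
  rw [lintegral_smul_measure, smul_eq_mul]

/-! ### The jump process is a Markov jump process -/

lemma RegularRates.nonExplosive_law (hq : RegularRates q) (ν : Measure E)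
    [IsProbabilityMeasure ν] : NonExplosive q ν :=
  hq.ae_jumpLaw_nonExplosive ν

lemma map_jumpProcess_zero (hq : RegularRates q) (ν : Measure E) [IsProbabilityMeasure ν] :
    (jumpLaw q ν).map (jumpProcess q 0) = ν := by
  ext A hA
  have hm : Measurable fun ω : JumpPath E => A.indicator (1 : E → ℝ≥0∞) (jumpProcess q 0 ω) :=
    (measurable_one.indicator hA).comp (measurable_jumpProcess 0)
  rw [← lintegral_indicator_one hA, lintegral_map (measurable_one.indicator hA)
    (measurable_jumpProcess 0), lintegral_jumpLaw q ν hm]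
  simp_rw [← lintegral_transition 0 _ (measurable_one.indicator hA),
    lintegral_transition_zero hq _ (measurable_one.indicator hA)]
  rw [lintegral_indicator_one hA]

lemma isStepPath_jumpProcess (h0 : ∀ x, q x Set.univ ≠ 0) {ω : JumpPath E}
    (hω : NonExplosivePath q ω) : IsStepPath fun t => jumpProcess q t ω := by
  have hfin : ∀ n, jumpTime q n ω ≠ ∞ := fun n =>
    ENNReal.sum_ne_top.2 fun k _ => (ENNReal.div_lt_top ENNReal.ofReal_ne_top (h0 _)).ne
  refine ⟨fun n => (jumpTime q n ω).toNNReal, by simp [jumpTime_zero], ?_, ?_, ?_⟩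
  · intro m n hmn
    exact ENNReal.toNNReal_mono (hfin n) (jumpTime_mono q ω hmn)
  · refine tendsto_atTop_mono' atTop (f₁ := fun n => (jumpTime q n ω).toNNReal)
      (Eventually.of_forall fun n => le_rfl) ?_
    refine tendsto_atTop_atTop_of_monotone
      (fun m n hmn => ENNReal.toNNReal_mono (hfin n) (jumpTime_mono q ω hmn)) fun b => ?_
    obtain ⟨n, hn⟩ := hω b
    refine ⟨n, ?_⟩
    rw [← ENNReal.coe_le_coe, ENNReal.coe_toNNReal (hfin n)]
    exact hn.le
  · intro n t ht
    have h1 (s : ℝ≥0) (hs : s ∈ Set.Ico (jumpTime q n ω).toNNReal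
        (jumpTime q (n + 1) ω).toNNReal) : JumpsAt q n s ω := by
      refine ⟨?_, ?_⟩
      · rw [← ENNReal.coe_toNNReal (hfin n)]
        exact_mod_cast hs.1
      · rw [← ENNReal.coe_toNNReal (hfin (n + 1))]
        exact_mod_cast hs.2
    simp only
    rw [(h1 t ht).jumpProcess_eq, (h1 _ ⟨le_rfl, ht.1.trans_lt ht.2⟩).jumpProcess_eq]

lemma iSup_comap_jumpProcess_eq (s : ℝ≥0) :
    (⨆ u : Set.Iic s, MeasurableSpace.comap (jumpProcess q (u : ℝ≥0)) inferInstance) =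
      MeasurableSpace.comap (fun (ω : JumpPath E) (u : Set.Iic s) => jumpProcess q (u : ℝ≥0) ω)
        inferInstance := by
  rw [MeasurableSpace.pi, MeasurableSpace.comap_iSup]
  simp_rw [MeasurableSpace.comap_comp]
  rfl

/-- The past σ-algebra is generated by the single map sending a path to all its states up to time s.
The Markov property is therefore used with all times up to s as index set and with a product of two
indicators. -/
theorem condExp_jumpProcess (hq : RegularRates q) (ν : Measure E) [IsProbabilityMeasure ν]
    (s t : ℝ≥0) {A : Set E} (hA : MeasurableSet A) :
    (jumpLaw q ν)[fun ω => A.indicator (fun _ => (1 : ℝ)) (jumpProcess q (s + t) ω) |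
        ⨆ u : Set.Iic s, MeasurableSpace.comap (jumpProcess q (u : ℝ≥0)) inferInstance]
      =ᵐ[jumpLaw q ν] fun ω => (transition q t (jumpProcess q s ω)).real A := by
  have hX : Measurable fun (ω : JumpPath E) (u : Set.Iic s) => jumpProcess q (u : ℝ≥0) ω :=
    measurable_pi_iff.2 fun u => measurable_jumpProcess _
  have hle : (⨆ u : Set.Iic s, MeasurableSpace.comap (jumpProcess q (u : ℝ≥0)) inferInstance) ≤
      (inferInstance : MeasurableSpace (JumpPath E)) := by
    rw [iSup_comap_jumpProcess_eq]
    exact hX.comap_le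
  have hm : Measurable fun y => (transition q t y).real A :=
    (Kernel.measurable_coe _ hA).ennreal_toReal
  have hms : Measurable[⨆ u : Set.Iic s, MeasurableSpace.comap (jumpProcess q (u : ℝ≥0))
      inferInstance] fun ω : JumpPath E => (transition q t (jumpProcess q s ω)).real A := by
    have h1 : MeasurableSpace.comap (jumpProcess q s) inferInstance ≤
        ⨆ u : Set.Iic s, MeasurableSpace.comap (jumpProcess q (u : ℝ≥0)) inferInstance :=
      le_iSup (fun u : Set.Iic s => MeasurableSpace.comap (jumpProcess q (u : ℝ≥0)) inferInstance)
        ⟨s, Set.mem_Iic.2 le_rfl⟩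
    exact (hm.comp (comap_measurable (jumpProcess q s))).mono h1 le_rfl
  have hA' : Measurable fun y : E => A.indicator (fun _ => (1 : ℝ)) y :=
    measurable_const.indicator hA
  have hb : ∀ y : E, ‖A.indicator (fun _ => (1 : ℝ)) y‖ ≤ 1 := fun y => by
    by_cases h : y ∈ A <;> simp [h]
  have hint1 : Integrable (fun ω => A.indicator (fun _ => (1 : ℝ)) (jumpProcess q (s + t) ω))
      (jumpLaw q ν) :=
    Integrable.of_bound (hA'.comp (measurable_jumpProcess (s + t))).aestronglyMeasurable 1
      (ae_of_all _ fun ω => hb _)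
  have hint2 : Integrable (fun ω => (transition q t (jumpProcess q s ω)).real A)
      (jumpLaw q ν) :=
    Integrable.of_bound (hm.comp (measurable_jumpProcess s)).aestronglyMeasurable 1
      (ae_of_all _ fun ω => by
        rw [Real.norm_of_nonneg measureReal_nonneg]
        exact measureReal_le_one)
  refine (ae_eq_condExp_of_forall_setIntegral_eq hle hint1
    (fun _ _ _ => hint2.integrableOn) ?_ hms.stronglyMeasurable.aestronglyMeasurable).symm
  intro B hB _
  have hB0 : MeasurableSet B := hle B hB
  rw [iSup_comap_jumpProcess_eq] at hB
  obtain ⟨B', hB', rfl⟩ := hB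
  have key := lintegral_jumpProcess_markov hq ν (fun u : Set.Iic s => (u : ℝ≥0)) s t
    (fun u => u.2) (H := fun p => B'.indicator 1 p.1 * A.indicator 1 p.2)
    (((measurable_one.indicator hB').comp measurable_fst).mul
      ((measurable_one.indicator hA).comp measurable_snd))
  simp only at key
  simp_rw [lintegral_const_mul _ (measurable_one.indicator hA), lintegral_indicator_one hA] at key
  rw [integral_eq_lintegral_of_nonneg_ae (ae_of_all _ fun ω => measureReal_nonneg)
      hint2.integrableOn.aestronglyMeasurable,
    integral_eq_lintegral_of_nonneg_ae (ae_of_all _ fun ω =>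
      Set.indicator_nonneg (fun _ _ => zero_le_one) _) hint1.integrableOn.aestronglyMeasurable]
  congr 1
  rw [← lintegral_indicator hB0, ← lintegral_indicator hB0]
  refine Eq.trans (lintegral_congr fun ω => ?_) (key.symm.trans (lintegral_congr fun ω => ?_))
  · by_cases h : (fun u : Set.Iic s => jumpProcess q (u : ℝ≥0) ω) ∈ B'
    · rw [Set.indicator_of_mem (a := ω) (s := (fun (ω : JumpPath E) (u : Set.Iic s) =>
        jumpProcess q (u : ℝ≥0) ω) ⁻¹' B') h, Set.indicator_of_mem h, Pi.one_apply, one_mul,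
        ofReal_measureReal]
    · rw [Set.indicator_of_notMem (a := ω) (s := (fun (ω : JumpPath E) (u : Set.Iic s) =>
        jumpProcess q (u : ℝ≥0) ω) ⁻¹' B') h, Set.indicator_of_notMem h, zero_mul]
  · by_cases h : (fun u : Set.Iic s => jumpProcess q (u : ℝ≥0) ω) ∈ B'
    · rw [Set.indicator_of_mem (a := ω) (s := (fun (ω : JumpPath E) (u : Set.Iic s) =>
        jumpProcess q (u : ℝ≥0) ω) ⁻¹' B') h, Set.indicator_of_mem h, Pi.one_apply, one_mul]
      by_cases h2 : jumpProcess q (s + t) ω ∈ A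
      · rw [Set.indicator_of_mem h2, Set.indicator_of_mem h2]
        simp
      · rw [Set.indicator_of_notMem h2, Set.indicator_of_notMem h2]
        simp
    · rw [Set.indicator_of_notMem (a := ω) (s := (fun (ω : JumpPath E) (u : Set.Iic s) =>
        jumpProcess q (u : ℝ≥0) ω) ⁻¹' B') h, Set.indicator_of_notMem h, zero_mul]

theorem isMarkovJumpProcess_jumpProcess (hq : RegularRates q) (ν : Measure E)
    [IsProbabilityMeasure ν] :
    IsMarkovJumpProcess (transition q) ν (jumpProcess q) (jumpLaw q ν) where
  measurable := measurable_jumpProcess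
  initial := map_jumpProcess_zero hq ν
  step := by
    filter_upwards [hq.ae_jumpLaw_nonExplosive ν] with ω hω
    exact isStepPath_jumpProcess hq.ne_zero hω
  markov s t A hA := condExp_jumpProcess hq ν s t hA

end Semigroup

section Sized

variable {E : Type*} [MeasurableSpace E]

/-! ### Birth and death type rates -/

/-- Rates of a process with a size: the size increases (by one) at a total rate of at most `a`,
otherwise it decreases, and the total rate grows at most linearly in the size. -/
structure SizedRates (q : Kernel E E) (size : E → ℕ) (a b : ℝ≥0) : Prop where
  measurable_size : Measurable size
  ne_zero : ∀ x, q x Set.univ ≠ 0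
  le : ∀ x, q x Set.univ ≤ ((a + b * size x : ℝ≥0) : ℝ≥0∞)
  decomp : ∀ x, ∃ U D : Measure E, q x = U + D ∧ U Set.univ ≤ a ∧
    (∀ᵐ y ∂U, size y ≤ size x + 1) ∧ ∀ᵐ y ∂D, size y + 1 ≤ size x

variable {q : Kernel E E} {size : E → ℕ} {a b : ℝ≥0}

lemma SizedRates.ne_top (hs : SizedRates q size a b) (x : E) : q x Set.univ ≠ ∞ :=
  ((hs.le x).trans_lt ENNReal.coe_lt_top).ne

lemma SizedRates.ae_size_le (hs : SizedRates q size a b) (x : E) :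
    ∀ᵐ y ∂(q x), size y ≤ size x + 1 := by
  obtain ⟨U, D, h, -, hU, hD⟩ := hs.decomp x
  rw [h, ae_add_measure_iff]
  exact ⟨hU, hD.mono fun y hy => by omega⟩

/-- A geometric function of the size shrinks by a fixed factor in each jump, in mean over the
discounted holding time. -/
lemma SizedRates.lintegral_pow_le (hs : SizedRates q size a b) {B d : ℝ≥0} (hB : 1 < B)
    (hBd : B ^ 2 = 1 + d) (had : a * d ≤ 1) (x : E) :
    ∫⁻ y, (B : ℝ≥0∞) ^ size y ∂(q x) ≤
      (B : ℝ≥0∞)⁻¹ * (B : ℝ≥0∞) ^ size x * (1 + q x Set.univ) := by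
  obtain ⟨U, D, h, hUa, hU, hD⟩ := hs.decomp x
  have hB0 : (B : ℝ≥0∞) ≠ 0 := by
    simpa using (zero_lt_one.trans hB).ne'
  have hB1 : (1 : ℝ≥0∞) ≤ B := by exact_mod_cast hB.le
  have hBd' : (B : ℝ≥0∞) ^ 2 = 1 + d := by exact_mod_cast hBd
  have h1 : ∫⁻ y, (B : ℝ≥0∞) ^ size y ∂U ≤ (B : ℝ≥0∞) ^ (size x + 1) * U Set.univ := by
    rw [← lintegral_const]
    exact lintegral_mono_ae (hU.mono fun y hy => pow_le_pow_right₀ hB1 hy)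
  have h2 : ∫⁻ y, (B : ℝ≥0∞) ^ size y ∂D ≤
      (B : ℝ≥0∞)⁻¹ * (B : ℝ≥0∞) ^ size x * D Set.univ := by
    rw [← lintegral_const]
    refine lintegral_mono_ae (hD.mono fun y hy => ?_)
    calc (B : ℝ≥0∞) ^ size y = (B : ℝ≥0∞)⁻¹ * (B : ℝ≥0∞) ^ (size y + 1) := by
          rw [pow_succ, mul_comm, mul_assoc, ENNReal.mul_inv_cancel hB0 ENNReal.coe_ne_top,
            mul_one]
      _ ≤ _ := by gcongr
  -- The target factor is the one of a departure. An arrival exceeds it by the factor B² = 1 + d,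
  -- and the total excess, at most a d ≤ 1, is absorbed by the discount rate 1.
  have h3 : (B : ℝ≥0∞) ^ (size x + 1) =
      (B : ℝ≥0∞)⁻¹ * (B : ℝ≥0∞) ^ size x * (1 + d) := by
    rw [← hBd', mul_assoc, ← pow_add, show size x + 2 = (size x + 1) + 1 by rfl, pow_succ _ (size x + 1),
      mul_comm, mul_assoc, ENNReal.mul_inv_cancel hB0 ENNReal.coe_ne_top, mul_one]
  have h4 : U Set.univ * d ≤ 1 := by
    calc U Set.univ * d ≤ (a : ℝ≥0∞) * d := by gcongr
      _ ≤ 1 := by exact_mod_cast had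
  rw [h, lintegral_add_measure, Measure.add_apply]
  refine (add_le_add h1 h2).trans ?_
  rw [h3, mul_assoc (_ * _), ← mul_add]
  refine mul_le_mul_right ?_ _
  calc (1 + (d : ℝ≥0∞)) * U Set.univ + D Set.univ
      = U Set.univ * d + (U Set.univ + D Set.univ) := by ring
    _ ≤ _ := add_le_add h4 le_rfl

/-- An exponential Chebyshev bound, proved by induction at the first jump: each jump, with the
discount of its holding time, multiplies the mean of B ^ size by at most B⁻¹. -/
lemma SizedRates.measure_jumpTime_le (hs : SizedRates q size a b) {B d : ℝ≥0} (hB : 1 < B)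
    (hBd : B ^ 2 = 1 + d) (had : a * d ≤ 1) (n : ℕ) : ∀ (x : E) (t : ℝ≥0),
    pathKernel q x {ω | jumpTime q n ω ≤ t} ≤
      ENNReal.ofReal (Real.exp t) * ((B : ℝ≥0∞)⁻¹ ^ n * (B : ℝ≥0∞) ^ size x) := by
  have hB1 : (1 : ℝ≥0∞) ≤ B := by exact_mod_cast hB.le
  induction n with
  | zero =>
    intro x t
    refine prob_le_one.trans ?_
    rw [pow_zero, one_mul]
    refine one_le_mul ?_ (one_le_pow₀ hB1)
    rw [ENNReal.one_le_ofReal]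
    exact Real.one_le_exp t.2
  | succ n ih =>
    intro x t
    have hm : MeasurableSet {ω : JumpPath E | jumpTime q (n + 1) ω ≤ t} :=
      measurableSet_le (measurable_jumpTime q _) measurable_const
    have hpow : Measurable fun y => (B : ℝ≥0∞) ^ size y :=
      (Measurable.of_discrete (f := fun k : ℕ => (B : ℝ≥0∞) ^ k)).comp hs.measurable_size
    set c : ℝ≥0 := (q x Set.univ).toNNReal with hc
    have hc0 : 0 < c := by
      rw [pos_iff_ne_zero, hc]
      simp [ENNReal.toNNReal_eq_zero_iff, hs.ne_zero x, hs.ne_top x]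
    have hcq : (c : ℝ≥0∞) = q x Set.univ := ENNReal.coe_toNNReal (hs.ne_top x)
    have key : ∀ᵐ e ∂(expMeasure 1),
        ∫⁻ y, ∫⁻ ω, {ω | jumpTime q (n + 1) ω ≤ t}.indicator 1 (consPath x e ω)
          ∂(pathKernel q y) ∂(jumpKernel q x) ≤
        ENNReal.ofReal (Real.exp (-((c : ℝ)⁻¹ * e))) * (ENNReal.ofReal (Real.exp t) *
          ((B : ℝ≥0∞)⁻¹ ^ n * ∫⁻ y, (B : ℝ≥0∞) ^ size y ∂(jumpKernel q x))) := by
      filter_upwards [ae_pos_expMeasure] with e he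
      have hh : (holdTime q x e : ℝ) = (c : ℝ)⁻¹ * e := by
        rw [holdTime, NNReal.coe_div, Real.coe_toNNReal _ he.le, div_eq_inv_mul]
      rw [← lintegral_const_mul _ hpow, ← lintegral_const_mul _ (hpow.const_mul _),
        ← lintegral_const_mul _ ((hpow.const_mul _).const_mul _)]
      refine lintegral_mono fun y => ?_
      by_cases hle : holdTime q x e ≤ t
      · have hsub : ∀ ω, ({ω | jumpTime q (n + 1) ω ≤ t}.indicator 1 (consPath x e ω) : ℝ≥0∞) =
            {ω | jumpTime q n ω ≤ ((t - holdTime q x e : ℝ≥0) : ℝ≥0∞)}.indicator 1 ω := by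
          intro ω
          have : jumpTime q (n + 1) (consPath x e ω) ≤ t ↔
              jumpTime q n ω ≤ ((t - holdTime q x e : ℝ≥0) : ℝ≥0∞) := by
            rw [jumpTime_succ_consPath, ← coe_holdTime hs.ne_zero hs.ne_top, ENNReal.coe_sub,
              ENNReal.le_sub_iff_add_le_left ENNReal.coe_ne_top (by exact_mod_cast hle)]
          by_cases hω : jumpTime q (n + 1) (consPath x e ω) ≤ t
          · rw [Set.indicator_of_mem (s := {ω | jumpTime q (n + 1) ω ≤ t}) hω,
              Set.indicator_of_mem (a := ω)
                (s := {ω | jumpTime q n ω ≤ ((t - holdTime q x e : ℝ≥0) : ℝ≥0∞)}) (this.1 hω)]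
            rfl
          · rw [Set.indicator_of_notMem (s := {ω | jumpTime q (n + 1) ω ≤ t}) hω,
              Set.indicator_of_notMem (a := ω)
                (s := {ω | jumpTime q n ω ≤ ((t - holdTime q x e : ℝ≥0) : ℝ≥0∞)})
                (mt this.2 hω)]
        simp_rw [hsub]
        rw [lintegral_indicator_one (measurableSet_le (measurable_jumpTime q _) measurable_const)]
        refine (ih y _).trans_eq ?_
        rw [← mul_assoc (ENNReal.ofReal (Real.exp (-_))), ← ENNReal.ofReal_mul (Real.exp_nonneg _),
          ← Real.exp_add, NNReal.coe_sub hle, hh]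
        congr 3
        ring
      · have hz : ∀ ω, ({ω | jumpTime q (n + 1) ω ≤ t}.indicator 1 (consPath x e ω) : ℝ≥0∞) =
            0 := by
          intro ω
          refine Set.indicator_of_notMem (fun h => hle ?_) _
          have h2 : jumpTime q (n + 1) (consPath x e ω) ≤ t := h
          rw [jumpTime_succ_consPath, ← coe_holdTime hs.ne_zero hs.ne_top] at h2
          exact_mod_cast le_self_add.trans h2
        simp_rw [hz]
        simp
    rw [← lintegral_indicator_one hm, lintegral_pathKernel q x (measurable_one.indicator hm)]
    refine (lintegral_mono_ae key).trans ?_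
    rw [lintegral_mul_const _ (by fun_prop), lintegral_expMeasure_exp_neg (by positivity),
      lintegral_jumpKernel (hs.ne_zero x) (hs.ne_top x)]
    -- The mean discount c / (1 + c) of the holding time cancels the factor 1 + c of
    -- `SizedRates.lintegral_pow_le` and the normalization of the jump kernel.
    have h5 : ENNReal.ofReal (1 + (c : ℝ)⁻¹)⁻¹ * ((q x Set.univ)⁻¹ * (1 + q x Set.univ)) = 1 := by
      rw [← hcq, ← ENNReal.coe_inv hc0.ne', ← ENNReal.coe_one, ← ENNReal.coe_add,
        ← ENNReal.coe_mul, ← ENNReal.ofReal_coe_nnreal, ← ENNReal.ofReal_mul (by positivity)]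
      have hc0' : (0 : ℝ) < c := hc0
      rw [show (1 + (c : ℝ)⁻¹)⁻¹ * ((c⁻¹ * (1 + c) : ℝ≥0) : ℝ) = 1 by
        push_cast
        field_simp
        ring, ENNReal.ofReal_one, ENNReal.coe_one]
    calc _ ≤ ENNReal.ofReal (1 + (c : ℝ)⁻¹)⁻¹ * (ENNReal.ofReal (Real.exp t) *
          ((B : ℝ≥0∞)⁻¹ ^ n * ((q x Set.univ)⁻¹ * ((B : ℝ≥0∞)⁻¹ * (B : ℝ≥0∞) ^ size x *
            (1 + q x Set.univ))))) := by
          gcongr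
          exact hs.lintegral_pow_le hB hBd had x
      _ = (ENNReal.ofReal (1 + (c : ℝ)⁻¹)⁻¹ * ((q x Set.univ)⁻¹ * (1 + q x Set.univ))) *
          (ENNReal.ofReal (Real.exp t) * (((B : ℝ≥0∞)⁻¹ ^ n * (B : ℝ≥0∞)⁻¹) *
            (B : ℝ≥0∞) ^ size x)) := by ring
      _ = _ := by rw [h5, one_mul, pow_succ]

theorem SizedRates.regularRates (hs : SizedRates q size a b) : RegularRates q := by
  refine ⟨hs.ne_zero, hs.ne_top, fun x => ?_⟩
  obtain ⟨B, d, hB, hBd, had⟩ : ∃ B d : ℝ≥0, 1 < B ∧ B ^ 2 = 1 + d ∧ a * d ≤ 1 := by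
    have ha : 0 < 3 * (a + 1) := by positivity
    -- Writing B = 1 + r gives d = 2r + r². With r = 1 / (3(a + 1)), the first term contributes at
    -- most 2/3 to a d and the second at most 1/3.
    refine ⟨1 + 1 / (3 * (a + 1)), 2 / (3 * (a + 1)) + (1 / (3 * (a + 1))) ^ 2, ?_, ?_, ?_⟩
    · exact lt_add_of_pos_right _ (by positivity)
    · ring
    · rw [← NNReal.coe_le_coe]
      push_cast
      have : (0 : ℝ) ≤ a := a.2
      rw [div_pow, div_add_div _ _ (by positivity) (by positivity), ← mul_div_assoc,
        div_le_one (by positivity)]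
      nlinarith [mul_nonneg this this, mul_nonneg this (mul_nonneg this this)]
  simp_rw [nonExplosivePath_iff]
  rw [ae_all_iff]
  intro k
  rw [ae_iff]
  have hle : ∀ n : ℕ, pathKernel q x {ω | ¬∃ n, (k : ℝ≥0∞) < jumpTime q n ω} ≤
      ENNReal.ofReal (Real.exp (k : ℝ≥0)) * ((B : ℝ≥0∞)⁻¹ ^ n * (B : ℝ≥0∞) ^ size x) := by
    intro n
    refine le_trans (measure_mono fun ω hω => ?_) (hs.measure_jumpTime_le hB hBd had n x k)
    rw [Set.mem_ofPred_eq] at hω ⊢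
    push Not at hω
    simpa using hω n
  have hB' : (B : ℝ≥0∞)⁻¹ < 1 := by
    rw [ENNReal.inv_lt_one]
    exact_mod_cast hB
  have hlim : Tendsto (fun n : ℕ => ENNReal.ofReal (Real.exp (k : ℝ≥0)) *
      ((B : ℝ≥0∞)⁻¹ ^ n * (B : ℝ≥0∞) ^ size x)) atTop (𝓝 0) := by
    have h1 := ENNReal.tendsto_pow_atTop_nhds_zero_of_lt_one hB'
    have h2 := ENNReal.Tendsto.mul_const (b := (B : ℝ≥0∞) ^ size x) h1
      (Or.inr (ENNReal.pow_ne_top ENNReal.coe_ne_top))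
    have h3 := ENNReal.Tendsto.const_mul (a := ENNReal.ofReal (Real.exp (k : ℝ≥0))) h2
      (Or.inr ENNReal.ofReal_ne_top)
    simpa using h3
  exact le_antisymm (ge_of_tendsto' hlim hle) zero_le

end Sized

section OneStep

variable {E : Type*} [MeasurableSpace E]

/-! ### Short time expansion of the transition kernels -/

/-- The first order approximation of the transition kernel for a short time `δ`. -/
def eulerStep (q : Kernel E E) (δ : ℝ≥0) (g : E → ℝ≥0∞) (x : E) : ℝ≥0∞ :=
  δ * ∫⁻ y, g y ∂(q x) + (1 - δ * q x Set.univ) * g x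

variable {q : Kernel E E}

lemma eulerStep_add {δ : ℝ≥0} {g h : E → ℝ≥0∞} (hg : Measurable g) (x : E) :
    eulerStep q δ (fun y => g y + h y) x = eulerStep q δ g x + eulerStep q δ h x := by
  unfold eulerStep
  rw [lintegral_add_left hg]
  ring

lemma eulerStep_const {δ : ℝ≥0} {x : E} (hδ : δ * q x Set.univ ≤ 1) (c : ℝ≥0∞) :
    eulerStep q δ (fun _ => c) x = c := by
  unfold eulerStep
  rw [lintegral_const, mul_left_comm, mul_comm _ c, ← mul_add, add_tsub_cancel_of_le hδ, mul_one]

lemma one_sub_le_exp_ennreal (c : ℝ≥0) : (1 : ℝ≥0∞) - c ≤ ENNReal.ofReal (Real.exp (-c)) := by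
  rw [tsub_le_iff_right, ← ENNReal.ofReal_coe_nnreal (p := c),
    ← ENNReal.ofReal_add (Real.exp_nonneg _) (NNReal.coe_nonneg c), ENNReal.one_le_ofReal]
  have := Real.add_one_le_exp (-(c : ℝ))
  linarith

/-- The paths with at most one jump in time δ already account for the Euler step up to second order.
The bound Q is needed at x and after one jump only, which suits unbounded rates. -/
lemma eulerStep_le (hq : RegularRates q) {x : E} {Q δ : ℝ≥0} (hx : q x Set.univ ≤ Q)
    (hy : ∀ᵐ y ∂(q x), q y Set.univ ≤ Q) {g : E → ℝ≥0∞} (hg : Measurable g) (hg1 : ∀ y, g y ≤ 1) :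
    eulerStep q δ g x ≤ ∫⁻ y, g y ∂(transition q δ x) + ((2 * (Q * δ) ^ 2 : ℝ≥0) : ℝ≥0∞) := by
  have hb := le_lintegral_transition hq x δ hg
  set c : ℝ≥0 := (q x Set.univ).toNNReal with hc
  have hc0 : 0 < c := hq.rate_toReal x
  have hcq : q x Set.univ = c := (ENNReal.coe_toNNReal (hq.ne_top x)).symm
  have hcQ : c ≤ Q := by
    rw [hcq] at hx
    exact_mod_cast hx
  set I := ∫⁻ y, g y ∂(q x) with hI
  have hIQ : I ≤ Q := by
    calc I ≤ ∫⁻ _, 1 ∂(q x) := lintegral_mono fun y => hg1 y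
      _ = q x Set.univ := by rw [lintegral_const, one_mul]
      _ ≤ Q := hx
  have h1 : (1 - δ * q x Set.univ) * g x ≤ ENNReal.ofReal (Real.exp (-(δ * c : ℝ≥0))) * g x := by
    gcongr
    have := one_sub_le_exp_ennreal (δ * c)
    rwa [ENNReal.coe_mul, ← hcq] at this
  have h2 : (q x Set.univ)⁻¹ * (ENNReal.ofReal (Real.exp (-(δ * Q : ℝ≥0))) * I) ≤
      ∫⁻ y, ENNReal.ofReal (Real.exp (-(δ * (q y Set.univ).toNNReal : ℝ≥0))) * g y
            ∂(jumpKernel q x) := by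
    rw [lintegral_jumpKernel (hq.ne_zero x) (hq.ne_top x), hI, ← lintegral_const_mul _ hg]
    refine mul_le_mul_right ?_ _
    refine lintegral_mono_ae (hy.mono fun y hyQ => ?_)
    gcongr
    exact ENNReal.toNNReal_mono ENNReal.coe_ne_top hyQ
  have h3 : (δ : ℝ≥0∞) * I ≤ ENNReal.ofReal (1 - Real.exp (-(δ * c : ℝ≥0))) *
      ((q x Set.univ)⁻¹ * (ENNReal.ofReal (Real.exp (-(δ * Q : ℝ≥0))) * I)) +
        ((2 * (Q * δ) ^ 2 : ℝ≥0) : ℝ≥0∞) := by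
    -- From 1 - exp(-u) ≥ u exp(-u) and exp(-2u) ≥ 1 - 2u, with c ≤ Q. The integral I is at most Q,
    -- which turns the error 2Qδ² into 2(Qδ)².
    have h4 : (δ : ℝ≥0∞) ≤ ENNReal.ofReal (1 - Real.exp (-(δ * c : ℝ≥0))) *
        ((q x Set.univ)⁻¹ * ENNReal.ofReal (Real.exp (-(δ * Q : ℝ≥0)))) +
        ((2 * Q * δ ^ 2 : ℝ≥0) : ℝ≥0∞) := by
      have hnn : 0 ≤ 1 - Real.exp (-(δ * c : ℝ≥0)) := by
        rw [sub_nonneg, Real.exp_le_one_iff, neg_nonpos]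
        exact NNReal.coe_nonneg _
      rw [hcq, ← ENNReal.coe_inv hc0.ne', ← ENNReal.ofReal_coe_nnreal, ← ENNReal.ofReal_coe_nnreal,
        ← ENNReal.ofReal_coe_nnreal, ← ENNReal.ofReal_mul (by positivity),
        ← ENNReal.ofReal_mul hnn, ← ENNReal.ofReal_add (by positivity) (by positivity)]
      refine ENNReal.ofReal_le_ofReal ?_
      push_cast
      have hcp : (0 : ℝ) < c := hc0
      have hδ0 : (0 : ℝ) ≤ δ := δ.2
      have hQ0 : (0 : ℝ) ≤ Q := Q.2
      have hcQ' : (c : ℝ) ≤ Q := hcQ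
      have e1 : (δ : ℝ) * c * Real.exp (-(δ * c)) ≤ 1 - Real.exp (-(δ * c)) := by
        have := Real.add_one_le_exp ((δ : ℝ) * c)
        have h5 : Real.exp (δ * c) * Real.exp (-(δ * c)) = 1 := by
          rw [← Real.exp_add]
          simp
        nlinarith [Real.exp_pos (-((δ : ℝ) * c))]
      have e2 : Real.exp (-((δ : ℝ) * Q)) ≤ Real.exp (-(δ * c)) := by
        rw [Real.exp_le_exp]
        nlinarith
      have e3 : (1 : ℝ) - 2 * (δ * Q) ≤ Real.exp (-(δ * Q)) * Real.exp (-(δ * Q)) := by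
        rw [← Real.exp_add]
        have := Real.add_one_le_exp (-((δ : ℝ) * Q) + -(δ * Q))
        linarith
      have hE := Real.exp_pos (-((δ : ℝ) * Q))
      calc (δ : ℝ) = δ * (1 - 2 * (δ * Q)) + 2 * Q * δ ^ 2 := by ring
        _ ≤ δ * (Real.exp (-(δ * Q)) * Real.exp (-(δ * Q))) + 2 * Q * δ ^ 2 := by gcongr
        _ = (δ * c * Real.exp (-(δ * Q))) * ((c : ℝ)⁻¹ * Real.exp (-(δ * Q))) +
            2 * Q * δ ^ 2 := by
          field_simp
        _ ≤ (δ * c * Real.exp (-(δ * c))) * ((c : ℝ)⁻¹ * Real.exp (-(δ * Q))) +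
            2 * Q * δ ^ 2 := by gcongr
        _ ≤ _ := by gcongr
    calc (δ : ℝ≥0∞) * I ≤ (ENNReal.ofReal (1 - Real.exp (-(δ * c : ℝ≥0))) *
        ((q x Set.univ)⁻¹ * ENNReal.ofReal (Real.exp (-(δ * Q : ℝ≥0)))) +
        ((2 * Q * δ ^ 2 : ℝ≥0) : ℝ≥0∞)) * I := by gcongr
      _ = ENNReal.ofReal (1 - Real.exp (-(δ * c : ℝ≥0))) *
          ((q x Set.univ)⁻¹ * (ENNReal.ofReal (Real.exp (-(δ * Q : ℝ≥0))) * I)) +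
          ((2 * Q * δ ^ 2 : ℝ≥0) : ℝ≥0∞) * I := by ring
      _ ≤ ENNReal.ofReal (1 - Real.exp (-(δ * c : ℝ≥0))) *
          ((q x Set.univ)⁻¹ * (ENNReal.ofReal (Real.exp (-(δ * Q : ℝ≥0))) * I)) +
          ((2 * Q * δ ^ 2 : ℝ≥0) : ℝ≥0∞) * Q := by gcongr
      _ = _ := by
        rw [← ENNReal.coe_mul]
        congr 2
        ring
  unfold eulerStep
  calc _ ≤ (ENNReal.ofReal (1 - Real.exp (-(δ * c : ℝ≥0))) *
      ((q x Set.univ)⁻¹ * (ENNReal.ofReal (Real.exp (-(δ * Q : ℝ≥0))) * I)) +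
        ((2 * (Q * δ) ^ 2 : ℝ≥0) : ℝ≥0∞)) +
        ENNReal.ofReal (Real.exp (-(δ * c : ℝ≥0))) * g x := add_le_add h3 h1
    _ = (ENNReal.ofReal (Real.exp (-(δ * c : ℝ≥0))) * g x +
        ENNReal.ofReal (1 - Real.exp (-(δ * c : ℝ≥0))) *
      ((q x Set.univ)⁻¹ * (ENNReal.ofReal (Real.exp (-(δ * Q : ℝ≥0))) * I))) +
        ((2 * (Q * δ) ^ 2 : ℝ≥0) : ℝ≥0∞) := by ring
    _ ≤ _ := by
      gcongr
      refine le_trans ?_ hb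
      gcongr

/-- The lower bound applied to 1 - g becomes an upper bound for g, because the transition kernel and
the Euler step both preserve constants. For the latter this uses δ q(x) ≤ 1, so that the subtraction
is not truncated. -/
lemma le_eulerStep (hq : RegularRates q) {x : E} {Q δ : ℝ≥0} (hx : q x Set.univ ≤ Q)
    (hy : ∀ᵐ y ∂(q x), q y Set.univ ≤ Q) (hδ : δ * q x Set.univ ≤ 1) {g : E → ℝ≥0∞}
    (hg : Measurable g) (hg1 : ∀ y, g y ≤ 1) :
    ∫⁻ y, g y ∂(transition q δ x) ≤ eulerStep q δ g x + ((2 * (Q * δ) ^ 2 : ℝ≥0) : ℝ≥0∞) := by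
  have h1 := eulerStep_le hq (δ := δ) hx hy (g := fun y => 1 - g y) (measurable_const.sub hg)
    fun y => tsub_le_self
  have hsum : ∀ y, g y + (1 - g y) = 1 := fun y => add_tsub_cancel_of_le (hg1 y)
  have h2 : eulerStep q δ g x + eulerStep q δ (fun y => 1 - g y) x = 1 := by
    rw [← eulerStep_add hg]
    simp_rw [hsum]
    exact eulerStep_const hδ 1
  have h3 : ∫⁻ y, g y ∂(transition q δ x) + ∫⁻ y, (1 - g y) ∂(transition q δ x) = 1 := by
    rw [← lintegral_add_left hg]
    simp_rw [hsum]
    simp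
  have hfin : eulerStep q δ (fun y => 1 - g y) x ≠ ∞ := by
    refine ne_top_of_le_ne_top ENNReal.one_ne_top ?_
    exact le_of_le_of_eq le_add_self h2
  refine (ENNReal.add_le_add_iff_right hfin).1 ?_
  calc _ ≤ ∫⁻ y, g y ∂(transition q δ x) + (∫⁻ y, (1 - g y) ∂(transition q δ x) +
        ((2 * (Q * δ) ^ 2 : ℝ≥0) : ℝ≥0∞)) := by gcongr
    _ = 1 + ((2 * (Q * δ) ^ 2 : ℝ≥0) : ℝ≥0∞) := by rw [← add_assoc, h3]
    _ = (eulerStep q δ g x + eulerStep q δ (fun y => 1 - g y) x) +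
        ((2 * (Q * δ) ^ 2 : ℝ≥0) : ℝ≥0∞) := by rw [h2]
    _ = _ := by ring

/-! ### Transition intensities -/

variable {size : E → ℕ} {a b : ℝ≥0}

lemma SizedRates.rate_le (hs : SizedRates q size a b) {x : E} {M : ℕ} (hx : size x ≤ M) :
    q x Set.univ ≤ ((a + b * M : ℝ≥0) : ℝ≥0∞) := by
  refine (hs.le x).trans ?_
  gcongr

lemma SizedRates.ae_rate_le (hs : SizedRates q size a b) {x : E} {M : ℕ} (hx : size x < M) :
    ∀ᵐ y ∂(q x), q y Set.univ ≤ ((a + b * M : ℝ≥0) : ℝ≥0∞) :=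
  (hs.ae_size_le x).mono fun _ hy => hs.rate_le (hy.trans hx)

/-- The two Euler bounds for the indicator of A put the difference quotient within 2Q²t of its
limit. One jump raises the size by at most one, so a single Q bounds the rates at x and at almost
every successor. -/
theorem SizedRates.tendsto_intensity (hs : SizedRates q size a b) (x : E) {A : Set E}
    (hA : MeasurableSet A) :
    Tendsto (fun t : ℝ≥0 => ((transition q t x).real A -
        A.indicator (fun _ => (1 : ℝ)) x) / t) (𝓝[>] 0)
      (𝓝 ((q x).real A - (q x).real Set.univ * A.indicator (fun _ => (1 : ℝ)) x)) := by
  have hq := hs.regularRates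
  set Q : ℝ≥0 := a + b * (size x + 1 : ℕ) with hQ
  have hx : q x Set.univ ≤ Q := hs.rate_le (Nat.le_succ _)
  have hy : ∀ᵐ y ∂(q x), q y Set.univ ≤ Q := hs.ae_rate_le (Nat.lt_succ_self _)
  have hfin := hs.ne_top x
  have : IsFiniteMeasure (q x) := ⟨hfin.lt_top⟩
  have hg : Measurable (A.indicator (1 : E → ℝ≥0∞)) := measurable_one.indicator hA
  have hg1 : ∀ y, A.indicator (1 : E → ℝ≥0∞) y ≤ 1 := fun y =>
    Set.indicator_le_self' (fun _ _ => zero_le) y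
  have hind : (A.indicator (1 : E → ℝ≥0∞) x).toReal = A.indicator (fun _ => (1 : ℝ)) x := by
    by_cases h : x ∈ A <;> simp [h]
  set L : ℝ := (q x).real A - (q x).real Set.univ * A.indicator (fun _ => (1 : ℝ)) x with hL
  have key : ∀ t : ℝ≥0, 0 < t → t * (Q + 1) ≤ 1 →
      |((transition q t x).real A - A.indicator (fun _ => (1 : ℝ)) x) / t - L| ≤
        2 * Q ^ 2 * t := by
    intro t ht htQ
    have hδ : t * q x Set.univ ≤ 1 := by
      calc (t : ℝ≥0∞) * q x Set.univ ≤ t * Q := by gcongr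
        _ ≤ 1 := by
          rw [← ENNReal.coe_mul]
          exact_mod_cast le_trans (by gcongr; exact le_self_add) htQ
    have h1 := eulerStep_le hq (δ := t) hx hy hg hg1
    have h2 := le_eulerStep hq (δ := t) hx hy hδ hg hg1
    rw [lintegral_indicator_one hA] at h1 h2
    have hE : eulerStep q t (A.indicator 1) x = ENNReal.ofReal (t * L +
        A.indicator (fun _ => (1 : ℝ)) x) := by
      rw [eulerStep, lintegral_indicator_one hA, ← ENNReal.ofReal_toReal (a := _ + _)]
      · congr 1
        have hne : (t : ℝ≥0∞) * q x A ≠ ∞ := ENNReal.mul_ne_top ENNReal.coe_ne_top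
          (measure_ne_top _ _)
        have hne2 : (1 - t * q x Set.univ) * A.indicator (1 : E → ℝ≥0∞) x ≠ ∞ :=
          ENNReal.mul_ne_top (ne_top_of_le_ne_top ENNReal.one_ne_top tsub_le_self)
            (ne_top_of_le_ne_top ENNReal.one_ne_top (hg1 x))
        rw [ENNReal.toReal_add hne hne2, ENNReal.toReal_mul, ENNReal.toReal_mul,
          ENNReal.toReal_sub_of_le hδ ENNReal.one_ne_top, ENNReal.toReal_mul, hind, hL,
          Measure.real, Measure.real]
        simp only [ENNReal.coe_toReal, ENNReal.toReal_one]
        ring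
      · exact ENNReal.add_ne_top.2 ⟨ENNReal.mul_ne_top ENNReal.coe_ne_top (measure_ne_top _ _),
          ENNReal.mul_ne_top (ne_top_of_le_ne_top ENNReal.one_ne_top tsub_le_self)
            (ne_top_of_le_ne_top ENNReal.one_ne_top (hg1 x))⟩
    have hEnn : 0 ≤ t * L + A.indicator (fun _ => (1 : ℝ)) x := by
      have hL' : t * L + A.indicator (fun _ => (1 : ℝ)) x = t * (q x).real A +
          (1 - t * (q x).real Set.univ) * A.indicator (fun _ => (1 : ℝ)) x := by
        rw [hL]
        ring
      have h4 : (t : ℝ) * (q x).real Set.univ ≤ 1 := by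
        have := ENNReal.toReal_mono ENNReal.one_ne_top hδ
        simpa [Measure.real] using this
      rw [hL']
      have h5 : 0 ≤ A.indicator (fun _ => (1 : ℝ)) x :=
        Set.indicator_nonneg (fun _ _ => zero_le_one) x
      have h6 : 0 ≤ (q x).real A := measureReal_nonneg
      have := mul_nonneg (sub_nonneg.2 h4) h5
      positivity
    rw [hE] at h1 h2
    have hfinP : transition q t x A ≠ ∞ := measure_ne_top _ _
    have h1' := ENNReal.toReal_mono (ENNReal.add_ne_top.2 ⟨hfinP, ENNReal.coe_ne_top⟩) h1
    have h2' := ENNReal.toReal_mono (ENNReal.add_ne_top.2 ⟨ENNReal.ofReal_ne_top,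
      ENNReal.coe_ne_top⟩) h2
    rw [ENNReal.toReal_add hfinP ENNReal.coe_ne_top, ENNReal.toReal_ofReal hEnn] at h1'
    rw [ENNReal.toReal_add ENNReal.ofReal_ne_top ENNReal.coe_ne_top,
      ENNReal.toReal_ofReal hEnn] at h2'
    simp only [ENNReal.coe_toReal, NNReal.coe_mul, NNReal.coe_pow, NNReal.coe_ofNat] at h1' h2'
    have ht' : (0 : ℝ) < t := ht
    have hP : (transition q t x).real A = (transition q t x A).toReal := rfl
    rw [div_sub' ht'.ne', abs_div, abs_of_pos ht', div_le_iff₀ ht', abs_le, hP]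
    constructor <;> nlinarith
  rw [← tendsto_sub_nhds_zero_iff]
  refine squeeze_zero_norm' (a := fun t : ℝ≥0 => 2 * (Q : ℝ) ^ 2 * t) ?_ ?_
  · have hev : ∀ᶠ t : ℝ≥0 in 𝓝[>] 0, t ∈ Set.Ioo 0 (Q + 1)⁻¹ :=
      Ioo_mem_nhdsGT (by positivity)
    filter_upwards [hev] with t ht
    refine key t ht.1 ?_
    rw [← le_div_iff₀ (by positivity), one_div]
    exact ht.2.le
  · have : Tendsto (fun t : ℝ≥0 => 2 * (Q : ℝ) ^ 2 * t) (𝓝 0) (𝓝 (2 * (Q : ℝ) ^ 2 * (0 : ℝ≥0))) :=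
      Continuous.tendsto (by fun_prop) 0
    rw [NNReal.coe_zero, mul_zero] at this
    exact this.mono_left nhdsWithin_le_nhds

theorem SizedRates.isTransitionFunction (hs : SizedRates q size a b) :
    IsTransitionFunction (transition q) q where
  markov _ := inferInstance
  zero := transition_zero hs.regularRates
  chapman_kolmogorov := transition_add hs.regularRates
  intensity x _ hA := hs.tendsto_intensity x hA

end OneStep

section Comparison

variable {E E' : Type*} [MeasurableSpace E] [MeasurableSpace E']

/-! ### Comparison of jump processes -/

/-- The rates `q'` dominate the rates `q` for the relation `R`: a function on `E` that lies below a
function on `E'` along `R` stays below it, to first order in time, under the two dynamics. -/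
def RatesDominated (R : E → E' → Prop) (q : Kernel E E) (q' : Kernel E' E') : Prop :=
  ∀ x y, R x y → ∀ (g : E → ℝ≥0∞) (h : E' → ℝ≥0∞), Measurable g → Measurable h →
    (∀ x y, R x y → g x ≤ h y) →
    ∫⁻ z, g z ∂(q x) + q' y Set.univ * g x ≤ ∫⁻ z, h z ∂(q' y) + q x Set.univ * h y

variable {R : E → E' → Prop} {q : Kernel E E} {q' : Kernel E' E'}

/-- Both Euler steps are brought to the common total rate q(x) + q'(y): each system gets fictitious
jumps to its own state at the rate of the other. This is why the rates cross over in
`RatesDominated`, which involves no subtraction. -/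
lemma RatesDominated.eulerStep_le (hR : RatesDominated R q q') {x : E} {y : E'} (hxy : R x y)
    {δ : ℝ≥0} (hδ : δ * (q x Set.univ + q' y Set.univ) ≤ 1) {g : E → ℝ≥0∞} {h : E' → ℝ≥0∞}
    (hg : Measurable g) (hh : Measurable h) (hgh : ∀ x y, R x y → g x ≤ h y) :
    eulerStep q δ g x ≤ eulerStep q' δ h y := by
  have key := hR x y hxy g h hg hh hgh
  unfold eulerStep
  rw [mul_add] at hδ
  have hfin : δ * q x Set.univ + δ * q' y Set.univ ≠ ∞ := ne_top_of_le_ne_top ENNReal.one_ne_top hδ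
  have e1 : 1 - δ * q x Set.univ =
      (1 - (δ * q x Set.univ + δ * q' y Set.univ)) + δ * q' y Set.univ := by
    refine ENNReal.sub_eq_of_eq_add (ENNReal.add_ne_top.1 hfin).1 ?_
    rw [add_assoc, add_comm (δ * q' y Set.univ), tsub_add_cancel_of_le hδ]
  have e2 : 1 - δ * q' y Set.univ =
      (1 - (δ * q x Set.univ + δ * q' y Set.univ)) + δ * q x Set.univ := by
    refine ENNReal.sub_eq_of_eq_add (ENNReal.add_ne_top.1 hfin).2 ?_
    rw [add_assoc, tsub_add_cancel_of_le hδ]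
  rw [e1, e2]
  calc _ = δ * (∫⁻ z, g z ∂(q x) + q' y Set.univ * g x) +
        (1 - (δ * q x Set.univ + δ * q' y Set.univ)) * g x := by ring
    _ ≤ δ * (∫⁻ z, h z ∂(q' y) + q x Set.univ * h y) +
        (1 - (δ * q x Set.univ + δ * q' y Set.univ)) * h y := by
      gcongr
      exact hgh x y hxy
    _ = _ := by ring

variable {size : E → ℕ} {size' : E' → ℕ} {a b : ℝ≥0}

/-- Only the arrivals increase the size, by one and at rate at most a. This controls how the
auxiliary multiple of the size grows during the Euler scheme. -/
lemma SizedRates.eulerStep_size_le {q : Kernel E E} (hs : SizedRates q size a b) {x : E} {δ : ℝ≥0}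
    (hδ : δ * q x Set.univ ≤ 1) :
    eulerStep q δ (fun z => (size z : ℝ≥0∞)) x ≤ size x + δ * a := by
  obtain ⟨U, D, h, hUa, hU, hD⟩ := hs.decomp x
  have h1 : ∫⁻ z, (size z : ℝ≥0∞) ∂(q x) ≤ size x * q x Set.univ + a := by
    rw [h, lintegral_add_measure, Measure.add_apply]
    calc _ ≤ ∫⁻ _, ((size x : ℝ≥0∞) + 1) ∂U + ∫⁻ _, (size x : ℝ≥0∞) ∂D := by
          refine add_le_add (lintegral_mono_ae (hU.mono fun z hz => by exact_mod_cast hz))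
            (lintegral_mono_ae (hD.mono fun z hz => ?_))
          exact_mod_cast (Nat.le_succ _).trans hz
      _ = size x * (U Set.univ + D Set.univ) + U Set.univ := by
          rw [lintegral_const, lintegral_const]
          ring
      _ ≤ _ := by gcongr
  unfold eulerStep
  calc _ ≤ δ * (size x * q x Set.univ + a) + (1 - δ * q x Set.univ) * size x := by gcongr
    _ = (δ * q x Set.univ + (1 - δ * q x Set.univ)) * size x + δ * a := by ring
    _ = _ := by rw [add_tsub_cancel_of_le hδ, one_mul]

/-- Comparison of the transition kernels at the multiples of a short time `δ`. -/
lemma RatesDominated.transition_le_of_short (hR : RatesDominated R q q')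
    (hs : SizedRates q size a b) (hs' : SizedRates q' size' a b)
    (hsize : ∀ x y, R x y → size x ≤ size' y) {g : E → ℝ≥0∞} {h : E' → ℝ≥0∞}
    (hg : Measurable g) (hh : Measurable h) (hg1 : ∀ x, g x ≤ 1) (hh1 : ∀ y, h y ≤ 1)
    (hgh : ∀ x y, R x y → g x ≤ h y) {η δ Q : ℝ≥0} {M : ℕ} (hM : 1 ≤ η * M)
    (hQ : Q = a + b * M) (hδ : δ * (Q + Q) ≤ 1) (k : ℕ) : ∀ x y, R x y →
    ∫⁻ z, g z ∂(transition q (k * δ) x) ≤ ∫⁻ z, h z ∂(transition q' (k * δ) y) +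
      (η * size' y + ((k * (η * (δ * a) + 4 * (Q * δ) ^ 2) : ℝ≥0) : ℝ≥0∞)) := by
  have hq := hs.regularRates
  have hq' := hs'.regularRates
  have hm' : Measurable fun z => (size' z : ℝ≥0∞) :=
    (Measurable.of_discrete (f := fun k : ℕ => (k : ℝ≥0∞))).comp hs'.measurable_size
  induction k with
  | zero =>
    intro x y hxy
    rw [Nat.cast_zero, zero_mul, lintegral_transition_zero hq x hg,
      lintegral_transition_zero hq' y hh]
    exact (hgh x y hxy).trans le_self_add
  | succ k ih =>
    intro x y hxy
    -- At large states the term η times the size is at least 1 and the claim is trivial. Below M the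
    -- rates, also after one jump, are at most Q.
    by_cases hy : M ≤ size' y
    · calc _ ≤ ∫⁻ _, 1 ∂(transition q ((k + 1 : ℕ) * δ) x) := lintegral_mono fun z => hg1 z
        _ = 1 := by simp
        _ ≤ η * M := by exact_mod_cast hM
        _ ≤ η * size' y := by gcongr
        _ ≤ _ := le_add_left le_self_add
    · push Not at hy
      have hx : size x < M := (hsize x y hxy).trans_lt hy
      have r1 : q x Set.univ ≤ Q := hQ ▸ hs.rate_le hx.le
      have r2 : q' y Set.univ ≤ Q := hQ ▸ hs'.rate_le hy.le
      have r3 : ∀ᵐ z ∂(q x), q z Set.univ ≤ Q := hQ ▸ hs.ae_rate_le hx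
      have r4 : ∀ᵐ z ∂(q' y), q' z Set.univ ≤ Q := hQ ▸ hs'.ae_rate_le hy
      have d0 : (δ : ℝ≥0∞) * (q x Set.univ + q' y Set.univ) ≤ 1 := by
        calc (δ : ℝ≥0∞) * (q x Set.univ + q' y Set.univ) ≤ δ * (Q + Q) := by gcongr
          _ ≤ 1 := by exact_mod_cast hδ
      have d1 : δ * q x Set.univ ≤ 1 := le_trans (by gcongr; exact le_self_add) d0
      have d2 : δ * q' y Set.univ ≤ 1 := le_trans (by gcongr; exact le_add_self) d0
      have hkδ : ((k + 1 : ℕ) : ℝ≥0) * δ = δ + k * δ := by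
        push_cast
        ring
      set u : E → ℝ≥0∞ := fun z => ∫⁻ w, g w ∂(transition q (k * δ) z) with hu
      set v : E' → ℝ≥0∞ := fun z => ∫⁻ w, h w ∂(transition q' (k * δ) z) with hv
      have hum : Measurable u := hg.lintegral_kernel
      have hvm : Measurable v := hh.lintegral_kernel
      have hu1 : ∀ z, u z ≤ 1 := fun z =>
        (lintegral_mono fun w => hg1 w).trans_eq (by simp)
      have hv1 : ∀ z, v z ≤ 1 := fun z =>
        (lintegral_mono fun w => hh1 w).trans_eq (by simp)
      set c : ℝ≥0∞ := ((k * (η * (δ * a) + 4 * (Q * δ) ^ 2) : ℝ≥0) : ℝ≥0∞) with hc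
      have s1 := le_eulerStep hq (δ := δ) r1 r3 d1 hum hu1
      have s2 := InterferenceQueues.eulerStep_le hq' (δ := δ) r2 r4 hvm hv1
      -- The induction hypothesis orders u and v plus the whole error term along R, so the Euler
      -- step is applied with the error included. The cost of a step is ηδa from the growth of the
      -- size and 2(Qδ)² from each of the two Euler approximations.
      have s3 := hR.eulerStep_le hxy d0 hum (h := fun z => v z + (η * size' z + c))
        (hvm.add ((hm'.const_mul _).add_const _)) ih
      have s4 : eulerStep q' δ (fun z => v z + (η * size' z + c)) y ≤
          eulerStep q' δ v y + (η * (size' y + δ * a) + c) := by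
        rw [eulerStep_add hvm, eulerStep_add (hm'.const_mul _), eulerStep_const d2]
        gcongr
        calc eulerStep q' δ (fun z => η * (size' z : ℝ≥0∞)) y
            = η * eulerStep q' δ (fun z => (size' z : ℝ≥0∞)) y := by
              unfold eulerStep
              rw [lintegral_const_mul _ hm']
              ring
          _ ≤ _ := by
              gcongr
              exact hs'.eulerStep_size_le d2
      rw [hkδ, lintegral_transition_add hq δ _ x hg, lintegral_transition_add hq' δ _ y hh]
      calc _ ≤ eulerStep q δ u x + ((2 * (Q * δ) ^ 2 : ℝ≥0) : ℝ≥0∞) := s1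
        _ ≤ (eulerStep q' δ v y + (η * (size' y + δ * a) + c)) +
            ((2 * (Q * δ) ^ 2 : ℝ≥0) : ℝ≥0∞) := by
          gcongr
          exact s3.trans s4
        _ ≤ (∫⁻ z, v z ∂(transition q' δ y) + ((2 * (Q * δ) ^ 2 : ℝ≥0) : ℝ≥0∞) +
            (η * (size' y + δ * a) + c)) + ((2 * (Q * δ) ^ 2 : ℝ≥0) : ℝ≥0∞) := by
          gcongr
        _ = _ := by
          rw [hc]
          push_cast
          ring

/-- Comparison of the transition kernels on functions bounded by one. -/
lemma RatesDominated.transition_le_of_le_one (hR : RatesDominated R q q')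
    (hs : SizedRates q size a b) (hs' : SizedRates q' size' a b)
    (hsize : ∀ x y, R x y → size x ≤ size' y) {g : E → ℝ≥0∞} {h : E' → ℝ≥0∞}
    (hg : Measurable g) (hh : Measurable h) (hg1 : ∀ x, g x ≤ 1) (hh1 : ∀ y, h y ≤ 1)
    (hgh : ∀ x y, R x y → g x ≤ h y) (t : ℝ≥0) {x : E} {y : E'} (hxy : R x y) :
    ∫⁻ z, g z ∂(transition q t x) ≤ ∫⁻ z, h z ∂(transition q' t y) := by
  refine ENNReal.le_of_forall_pos_le_add fun ε hε _ => ?_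
  -- The order of choices matters: η makes the size terms at most ε / 2, then M and Q depend on η,
  -- and n is taken last, so that the Euler errors 4(Qt)² / n are at most ε / 2.
  set η : ℝ≥0 := ε / (2 * (size' y + t * a + 1)) with hη
  have hη0 : 0 < η := by positivity
  obtain ⟨M, hM⟩ : ∃ M : ℕ, 1 ≤ η * M := by
    obtain ⟨M, hM⟩ := exists_nat_ge (1 / η)
    refine ⟨M, ?_⟩
    rwa [div_le_iff₀ hη0, mul_comm] at hM
  set Q : ℝ≥0 := a + b * M with hQ
  obtain ⟨n, hn⟩ := exists_nat_ge (max (t * (Q + Q)) (4 * (Q * t) ^ 2 / (ε / 2)) + 1)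
  have hn0 : (0 : ℝ≥0) < n := lt_of_lt_of_le (by positivity) hn
  have hn1 : t * (Q + Q) ≤ n := (le_max_left _ _).trans (le_self_add.trans hn)
  have hn2 : 4 * (Q * t) ^ 2 / (ε / 2) ≤ n := (le_max_right _ _).trans (le_self_add.trans hn)
  have hnt : (n : ℝ≥0) * (t / n) = t := mul_div_cancel₀ _ hn0.ne'
  have key := hR.transition_le_of_short hs hs' hsize hg hh hg1 hh1 hgh (δ := t / n) hM hQ
    (by rw [div_mul_eq_mul_div, div_le_one hn0]; exact hn1) n x y hxy
  rw [hnt] at key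
  refine key.trans ?_
  gcongr
  have hbound : η * size' y + n * (η * (t / n * a) + 4 * (Q * (t / n)) ^ 2) ≤ ε := by
    have e1 : n * (η * (t / n * a) + 4 * (Q * (t / n)) ^ 2) =
        η * (t * a) + 4 * (Q * t) ^ 2 / n := by
      field_simp
    have e2 : 4 * (Q * t) ^ 2 / n ≤ ε / 2 := by
      rw [div_le_iff₀ (by positivity)] at hn2 ⊢
      rwa [mul_comm (ε / 2)]
    have e3 : η * (size' y + t * a) ≤ ε / 2 := by
      calc η * (size' y + t * a) ≤ η * (size' y + t * a + 1) := by
            exact mul_le_mul_right le_self_add _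
        _ = ε / 2 := by
          rw [hη]
          field_simp
    calc _ = η * (size' y + t * a) + 4 * (Q * t) ^ 2 / n := by
          rw [e1]
          ring
      _ ≤ ε / 2 + ε / 2 := add_le_add e3 e2
      _ = ε := add_halves ε
  exact_mod_cast hbound

/-- Truncation at N and division by N preserve the order along R and reduce to functions bounded by
one; monotone convergence removes the truncation. -/
theorem RatesDominated.lintegral_transition_le (hR : RatesDominated R q q')
    (hs : SizedRates q size a b) (hs' : SizedRates q' size' a b)
    (hsize : ∀ x y, R x y → size x ≤ size' y) {g : E → ℝ≥0∞} {h : E' → ℝ≥0∞}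
    (hg : Measurable g) (hh : Measurable h)
    (hgh : ∀ x y, R x y → g x ≤ h y) (t : ℝ≥0) {x : E} {y : E'} (hxy : R x y) :
    ∫⁻ z, g z ∂(transition q t x) ≤ ∫⁻ z, h z ∂(transition q' t y) := by
  have hmin : ∀ N : ℕ, ∫⁻ z, min (g z) N ∂(transition q t x) ≤
      ∫⁻ z, h z ∂(transition q' t y) := by
    intro N
    rcases Nat.eq_zero_or_pos N with rfl | hN
    · simp
    have hN0 : (N : ℝ≥0∞) ≠ 0 := by exact_mod_cast hN.ne'
    have hNt : (N : ℝ≥0∞) ≠ ∞ := ENNReal.natCast_ne_top N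
    have hc (w : ℝ≥0∞) : (N : ℝ≥0∞) * ((N : ℝ≥0∞)⁻¹ * w) = w := by
      rw [← mul_assoc, ENNReal.mul_inv_cancel hN0 hNt, one_mul]
    have hb (w : ℝ≥0∞) : (N : ℝ≥0∞)⁻¹ * min w N ≤ 1 := by
      calc (N : ℝ≥0∞)⁻¹ * min w N ≤ (N : ℝ≥0∞)⁻¹ * N := by
            gcongr
            exact min_le_right _ _
        _ = 1 := ENNReal.inv_mul_cancel hN0 hNt
    have hgm : Measurable fun z => min (g z) (N : ℝ≥0∞) := hg.min measurable_const
    have hhm : Measurable fun z => min (h z) (N : ℝ≥0∞) := hh.min measurable_const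
    have key := hR.transition_le_of_le_one hs hs' hsize (hgm.const_mul (N : ℝ≥0∞)⁻¹)
      (hhm.const_mul (N : ℝ≥0∞)⁻¹) (fun z => hb _) (fun z => hb _)
      (fun x y hxy => by
        gcongr
        exact hgh x y hxy) t hxy
    rw [lintegral_const_mul _ hgm, lintegral_const_mul _ hhm] at key
    calc _ = (N : ℝ≥0∞) * ((N : ℝ≥0∞)⁻¹ * ∫⁻ z, min (g z) N ∂(transition q t x)) := (hc _).symm
      _ ≤ (N : ℝ≥0∞) * ((N : ℝ≥0∞)⁻¹ * ∫⁻ z, min (h z) N ∂(transition q' t y)) := by gcongr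
      _ = ∫⁻ z, min (h z) N ∂(transition q' t y) := hc _
      _ ≤ _ := lintegral_mono fun z => min_le_left _ _
  have hsup : ∀ z, g z = ⨆ N : ℕ, min (g z) (N : ℝ≥0∞) := by
    intro z
    rw [← inf_iSup_eq, ENNReal.iSup_natCast]
    simp
  rw [lintegral_congr hsup, lintegral_iSup (fun N => hg.min measurable_const)]
  · exact iSup_le hmin
  · intro N N' hNN' z
    exact min_le_min_left _ (by exact_mod_cast hNN')

/-! ### Comparison of the finite dimensional laws -/

lemma measurable_snoc {m : ℕ} :
    Measurable fun p : (Fin m → E) × E => (Fin.snoc p.1 p.2 : Fin (m + 1) → E) := by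
  refine measurable_pi_iff.2 fun i => ?_
  refine Fin.lastCases ?_ (fun i => ?_) i
  · simp only [Fin.snoc_last]
    exact measurable_snd
  · simp only [Fin.snoc_castSucc]
    exact (measurable_pi_apply i).comp measurable_fst

lemma measurable_lintegral_snoc {m : ℕ} (t : ℝ≥0) {f : (Fin (m + 2) → E) → ℝ≥0∞}
    (hf : Measurable f) : Measurable fun z : Fin (m + 1) → E =>
      ∫⁻ y, f (Fin.snoc z y : Fin (m + 2) → E) ∂(transition q t (z (Fin.last m))) := by
  have h := Measurable.lintegral_kernel_prod_right
    (κ := (transition q t).comap (fun z : Fin (m + 1) → E => z (Fin.last m))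
      (measurable_pi_apply _)) (f := fun z y => f (Fin.snoc z y : Fin (m + 2) → E))
      (hf.comp measurable_snoc)
  exact h

lemma lintegral_jumpProcess_snoc (hq : RegularRates q) (x : E) {m : ℕ} {t : Fin (m + 2) → ℝ≥0}
    (ht : Monotone t) {f : (Fin (m + 2) → E) → ℝ≥0∞} (hf : Measurable f) :
    ∫⁻ ω, f (fun i => jumpProcess q (t i) ω) ∂(pathKernel q x) =
      ∫⁻ ω, (fun z : Fin (m + 1) → E => ∫⁻ y, f (Fin.snoc z y : Fin (m + 2) → E)
        ∂(transition q (t (Fin.last _) - t (Fin.last m).castSucc) (z (Fin.last m))))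
        (fun i => jumpProcess q (t i.castSucc) ω) ∂(pathKernel q x) := by
  have h := lintegral_jumpProcess_markov hq (Measure.dirac x)
    (fun i : Fin (m + 1) => t i.castSucc) (t (Fin.last m).castSucc)
    (t (Fin.last _) - t (Fin.last m).castSucc)
    (fun i => ht (Fin.castSucc_le_castSucc_iff.2 (Fin.le_last i)))
    (H := fun p => f (Fin.snoc p.1 p.2 : Fin (m + 2) → E)) (hf.comp measurable_snoc)
  rw [add_tsub_cancel_of_le (ht (Fin.le_last _)), jumpLaw_dirac] at h
  refine Eq.trans (lintegral_congr fun ω => congrArg f ?_) h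
  funext i
  refine Fin.lastCases ?_ (fun i => ?_) i
  · simp only [Fin.snoc_last]
  · simp only [Fin.snoc_castSucc]

/-- The Markov property integrates out the last time. The comparison of the kernels says that the
two resulting functions of the earlier states are again ordered along R, which is the hypothesis for
one time fewer. -/
lemma RatesDominated.lintegral_jumpProcess_le_of_monotone (hR : RatesDominated R q q')
    (hs : SizedRates q size a b) (hs' : SizedRates q' size' a b)
    (hsize : ∀ x y, R x y → size x ≤ size' y) {x : E} {y : E'} (hxy : R x y) (m : ℕ) :
    ∀ (t : Fin (m + 1) → ℝ≥0), Monotone t →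
    ∀ (f : (Fin (m + 1) → E) → ℝ≥0∞) (f' : (Fin (m + 1) → E') → ℝ≥0∞),
      Measurable f → Measurable f' →
      (∀ z z', (∀ i, R (z i) (z' i)) → f z ≤ f' z') →
      ∫⁻ ω, f (fun i => jumpProcess q (t i) ω) ∂(pathKernel q x) ≤
        ∫⁻ ω, f' (fun i => jumpProcess q' (t i) ω) ∂(pathKernel q' y) := by
  induction m with
  | zero =>
    intro t _ f f' hf hf' hff'
    have hc : Measurable fun (z : E) (_ : Fin (0 + 1)) => z :=
      measurable_pi_iff.2 fun _ => measurable_id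
    have hc' : Measurable fun (z : E') (_ : Fin (0 + 1)) => z :=
      measurable_pi_iff.2 fun _ => measurable_id
    have h := hR.lintegral_transition_le hs hs' hsize (hf.fun_comp hc) (hf'.fun_comp hc')
      (fun z z' hz => hff' _ _ fun _ => hz) (t 0) hxy
    rw [lintegral_transition _ _ (hf.fun_comp hc), lintegral_transition _ _ (hf'.fun_comp hc')] at h
    have e (i : Fin (0 + 1)) : i = 0 := Fin.fin_one_eq_zero i
    simp_rw [fun i => congrArg t (e i)]
    exact h
  | succ m ih =>
    intro t ht f f' hf hf' hff'
    rw [lintegral_jumpProcess_snoc hs.regularRates x ht hf,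
      lintegral_jumpProcess_snoc hs'.regularRates y ht hf']
    refine ih _ (fun i j hij => ht (Fin.castSucc_le_castSucc_iff.2 hij)) _ _
      (measurable_lintegral_snoc _ hf) (measurable_lintegral_snoc _ hf') fun z z' hz => ?_
    refine hR.lintegral_transition_le hs hs' hsize
      (hf.fun_comp (measurable_snoc.fun_comp measurable_prodMk_left))
      (hf'.fun_comp (measurable_snoc.fun_comp measurable_prodMk_left)) (fun w w' hw => ?_) _ (hz _)
    refine hff' _ _ fun i => ?_
    refine Fin.lastCases ?_ (fun i => ?_) i
    · simpa only [Fin.snoc_last] using hw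
    · simpa only [Fin.snoc_castSucc] using hz i

theorem RatesDominated.lintegral_jumpProcess_le (hR : RatesDominated R q q')
    (hs : SizedRates q size a b) (hs' : SizedRates q' size' a b)
    (hsize : ∀ x y, R x y → size x ≤ size' y) {x : E} {y : E'} (hxy : R x y) {m : ℕ}
    (t : Fin m → ℝ≥0) {f : (Fin m → E) → ℝ≥0∞} {f' : (Fin m → E') → ℝ≥0∞}
    (hf : Measurable f) (hf' : Measurable f')
    (hff' : ∀ z z', (∀ i, R (z i) (z' i)) → f z ≤ f' z') :
    ∫⁻ ω, f (fun i => jumpProcess q (t i) ω) ∂(pathKernel q x) ≤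
      ∫⁻ ω, f' (fun i => jumpProcess q' (t i) ω) ∂(pathKernel q' y) := by
  cases m with
  | zero =>
    have e1 : ∀ ω, f (fun i => jumpProcess q (t i) ω) = f default := fun ω =>
      congrArg f (Subsingleton.elim _ _)
    have e2 : ∀ ω, f' (fun i => jumpProcess q' (t i) ω) = f' default := fun ω =>
      congrArg f' (Subsingleton.elim _ _)
    simp_rw [e1, e2]
    rw [lintegral_const, lintegral_const, measure_univ, measure_univ]
    gcongr
    exact hff' _ _ fun i => i.elim0
  | succ m =>
    let σ := Tuple.sort t
    have h := hR.lintegral_jumpProcess_le_of_monotone hs hs' hsize hxy m (t ∘ σ)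
      (Tuple.monotone_sort t) (fun z => f fun i => z (σ.symm i)) (fun z => f' fun i => z (σ.symm i))
      (hf.comp (measurable_pi_iff.2 fun i => measurable_pi_apply _))
      (hf'.comp (measurable_pi_iff.2 fun i => measurable_pi_apply _))
      fun z z' hz => hff' _ _ fun i => hz _
    simpa using h

/-- Stochastic domination of the images of two jump processes in a countable ordered space. -/
theorem RatesDominated.processStochLE {V : Type*} [Preorder V] [Countable V] [MeasurableSpace V]
    [MeasurableSingletonClass V] {c : E → V} {c' : E' → V} (hc : Measurable c)
    (hc' : Measurable c') (hR : RatesDominated (fun x y => c x ≤ c' y) q q')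
    (hs : SizedRates q size a b) (hs' : SizedRates q' size' a b)
    (hsize : ∀ x y, c x ≤ c' y → size x ≤ size' y) {ν : Measure E} {ν' : Measure E'}
    [IsProbabilityMeasure ν] [IsProbabilityMeasure ν'] (hν : StochLE c ν c' ν') :
    ProcessStochLE (fun t ω => c (jumpProcess q t ω)) (jumpLaw q ν)
      (fun t ω => c' (jumpProcess q' t ω)) (jumpLaw q' ν') := by
  intro m t f hf
  have hfm : Measurable f := measurable_of_countable f
  have hcm : Measurable fun (z : Fin m → E) i => c (z i) :=
    measurable_pi_iff.2 fun i => hc.comp (measurable_pi_apply i)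
  have hcm' : Measurable fun (z : Fin m → E') i => c' (z i) :=
    measurable_pi_iff.2 fun i => hc'.comp (measurable_pi_apply i)
  have hX : Measurable fun (ω : JumpPath E) (i : Fin m) => jumpProcess q (t i) ω :=
    measurable_pi_iff.2 fun i => measurable_jumpProcess (t i)
  have hY : Measurable fun (ω : JumpPath E') (i : Fin m) => jumpProcess q' (t i) ω :=
    measurable_pi_iff.2 fun i => measurable_jumpProcess (t i)
  set F : E → ℝ≥0∞ := fun x =>
    ∫⁻ ω, f (fun i => c (jumpProcess q (t i) ω)) ∂(pathKernel q x) with hF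
  set F' : E' → ℝ≥0∞ := fun y =>
    ∫⁻ ω, f (fun i => c' (jumpProcess q' (t i) ω)) ∂(pathKernel q' y) with hF'
  have hFF' : ∀ x y, c x ≤ c' y → F x ≤ F' y := fun x y hxy =>
    hR.lintegral_jumpProcess_le hs hs' hsize hxy t (hfm.comp hcm) (hfm.comp hcm')
      fun z z' hz => hf hz
  -- The order of the initial laws concerns functions on V, whereas F and F' need not factor through
  -- c and c'. The function k is monotone on V, lies above F along c and below F' along c'.
  let k : V → ℝ≥0∞ := fun v => ⨆ (x : E) (_ : c x ≤ v), F x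
  have hk : Monotone k := fun v w hvw =>
    iSup_le fun x => iSup_le fun hx => le_iSup₂ (f := fun x (_ : c x ≤ w) => F x) x (hx.trans hvw)
  calc _ = ∫⁻ x, F x ∂ν := lintegral_jumpLaw q ν (hfm.comp (hcm.comp hX))
    _ ≤ ∫⁻ x, k (c x) ∂ν := lintegral_mono fun x =>
      le_iSup₂ (f := fun x' (_ : c x' ≤ c x) => F x') x le_rfl
    _ ≤ ∫⁻ y, k (c' y) ∂ν' := hν k hk
    _ ≤ ∫⁻ y, F' y ∂ν' := lintegral_mono fun y =>
      iSup_le fun x => iSup_le fun hx => hFF' x y hx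
    _ = _ := (lintegral_jumpLaw q' ν' (hfm.comp (hcm'.comp hY))).symm

end Comparison

section Irreducible

variable {E : Type*} [MeasurableSpace E] [MeasurableSingletonClass E] {q : Kernel E E}
  {size : E → ℕ} {a b : ℝ≥0}

/-! ### Irreducibility -/

lemma RegularRates.transition_pos_trans (hq : RegularRates q) {x y z : E} {s t : ℝ≥0}
    (hxy : 0 < transition q s x {y}) (hyz : 0 < transition q t y {z}) :
    0 < transition q (s + t) x {z} := by
  rw [transition_add hq, Kernel.comp_apply' _ _ _ (measurableSet_singleton z)]
  refine lt_of_lt_of_le ?_ (setLIntegral_le_lintegral {y} _)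
  rw [lintegral_singleton]
  exact ENNReal.mul_pos hyz.ne' hxy.ne'

/-- For distinct states, the rate is the right derivative at time 0 of the transition probability,
which must therefore be positive at some time. -/
lemma SizedRates.exists_transition_pos_of_rate_pos (hs : SizedRates q size a b) {x y : E}
    (h : 0 < q x {y}) : ∃ t, 0 < transition q t x {y} := by
  by_cases hxy : x = y
  · subst hxy
    refine ⟨0, ?_⟩
    rw [transition_zero hs.regularRates, Kernel.id_apply, Measure.dirac_apply]
    simp
  have hlim := hs.tendsto_intensity x (measurableSet_singleton y)
  have hx : x ∉ ({y} : Set E) := by simpa using hxy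
  rw [Set.indicator_of_notMem hx, mul_zero, sub_zero] at hlim
  have hfin : q x {y} ≠ ∞ := ne_top_of_le_ne_top (hs.ne_top x) (measure_mono (Set.subset_univ _))
  have hpos : 0 < (q x).real {y} := ENNReal.toReal_pos h.ne' hfin
  obtain ⟨t, ht⟩ := (hlim.eventually_const_lt hpos).exists
  refine ⟨t, pos_iff_ne_zero.2 fun h0 => ?_⟩
  simp [Measure.real, h0] at ht

end Irreducible

/-! ### Cells -/

section Cells

variable (S : ℝ) {n : ℕ}

/-- The half-open arc of length `S / n` around the `k`-th of `n` equidistant points. -/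
def arc (k : Fin n) : Set (AddCircle S) :=
  {y | ∃ u ∈ Set.Ico (-(cellSide S n / 2)) (cellSide S n / 2),
    y = (((k : ℝ) * cellSide S n : ℝ) : AddCircle S) + (u : AddCircle S)}

lemma cell_eq_prod (i : CellIndex n) : cell S i = arc S i.1 ×ˢ arc S i.2 := by
  ext x
  constructor
  · rintro ⟨u, hu, v, hv, rfl⟩
    exact ⟨⟨u, hu, rfl⟩, ⟨v, hv, rfl⟩⟩
  · rintro ⟨⟨u, hu, h1⟩, ⟨v, hv, h2⟩⟩
    exact ⟨u, hu, v, hv, Prod.ext h1 h2⟩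

lemma natCast_mul_cellSide (k : Fin n) : (n : ℝ) * cellSide S n = S := by
  have : (n : ℝ) ≠ 0 := by exact_mod_cast k.pos.ne'
  rw [cellSide]
  field_simp

lemma torusDist_eq_of_sub_eq {S : ℝ} {x y x' y' : Torus S} (h : x - y = x' - y') :
    torusDist x y = torusDist x' y' := by
  have h1 := congrArg Prod.fst h
  have h2 := congrArg Prod.snd h
  simp only [Prod.fst_sub, Prod.snd_sub] at h1 h2
  rw [torusDist, torusDist, h1, h2]

lemma center_mem_vicinity (i : CellIndex n) : cellCenter S i ∈ vicinity S i := by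
  left
  simp [torusDist]

lemma vicinityLosses_subset_Icc {K : ℕ} (prm : NetworkParams K) (i k : CellIndex n) :
    vicinityLosses prm S i k ⊆ Set.Icc 0 1 := by
  rintro y ⟨b, -, b', -, rfl⟩
  refine ⟨prm.pathLoss_nonneg _, ?_⟩
  rw [← prm.pathLoss_zero]
  exact prm.pathLoss_antitone zero_le

lemma lossMax_nonneg {K : ℕ} (prm : NetworkParams K) (i k : CellIndex n) :
    0 ≤ lossMax prm S i k :=
  Real.sSup_nonneg fun _ hy => (vicinityLosses_subset_Icc S prm i k hy).1

lemma lossMin_nonneg {K : ℕ} (prm : NetworkParams K) (i k : CellIndex n) :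
    0 ≤ lossMin prm S i k :=
  Real.sInf_nonneg fun _ hy => (vicinityLosses_subset_Icc S prm i k hy).1

variable [hS : Fact (0 < S)]

lemma cellSide_pos (k : Fin n) : 0 < cellSide S n :=
  div_pos hS.out (by exact_mod_cast k.pos)

/-- With the fundamental domain starting at minus half a cell side, none of the n arcs wraps around,
and each one becomes an interval of the real line. -/
lemma mem_arc_iff (k : Fin n) (y : AddCircle S) :
    y ∈ arc S k ↔ (AddCircle.equivIco S (-(cellSide S n / 2)) y : ℝ) ∈
      Set.Ico ((k : ℝ) * cellSide S n - cellSide S n / 2)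
        ((k : ℝ) * cellSide S n + cellSide S n / 2) := by
  have hε := cellSide_pos S k
  have hn := natCast_mul_cellSide S k
  have hk : ((k : ℕ) : ℝ) + 1 ≤ n := by exact_mod_cast k.2
  have hk0 : (0 : ℝ) ≤ ((k : ℕ) : ℝ) := Nat.cast_nonneg _
  have hk' : (((k : ℕ) : ℝ) + 1) * cellSide S n ≤ S := by
    exact (mul_le_mul_of_nonneg_right hk hε.le).trans_eq hn
  have hk1 : 0 ≤ ((k : ℕ) : ℝ) * cellSide S n := by positivity
  constructor
  · rintro ⟨u, hu, rfl⟩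
    rw [← AddCircle.coe_add, AddCircle.equivIco_coe_of_mem]
    · exact ⟨by linarith [hu.1], by linarith [hu.2]⟩
    · exact ⟨by linarith [hu.1], by linarith [hu.2]⟩
  · intro h
    refine ⟨(AddCircle.equivIco S (-(cellSide S n / 2)) y : ℝ) - (k : ℝ) * cellSide S n,
      ⟨by linarith [h.1], by linarith [h.2]⟩, ?_⟩
    rw [← AddCircle.coe_add, add_sub_cancel, AddCircle.coe_equivIco]

lemma measurableSet_arc (k : Fin n) : MeasurableSet (arc S k) := by
  have hm : Measurable fun y : AddCircle S =>
      (AddCircle.equivIco S (-(cellSide S n / 2)) y : ℝ) :=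
    measurable_subtype_coe.comp (AddCircle.measurableEquivIco S (-(cellSide S n / 2))).measurable
  have : arc S k = (fun y : AddCircle S =>
      (AddCircle.equivIco S (-(cellSide S n / 2)) y : ℝ)) ⁻¹'
        Set.Ico ((k : ℝ) * cellSide S n - cellSide S n / 2)
        ((k : ℝ) * cellSide S n + cellSide S n / 2) := by
    ext y
    exact mem_arc_iff S k y
  rw [this]
  exact hm measurableSet_Ico

lemma existsUnique_mem_arc (hn : 0 < n) (y : AddCircle S) : ∃! k : Fin n, y ∈ arc S k := by
  have hε := cellSide_pos S (⟨0, hn⟩ : Fin n)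
  have hnS := natCast_mul_cellSide S (⟨0, hn⟩ : Fin n)
  simp_rw [mem_arc_iff]
  have hr := (AddCircle.equivIco S (-(cellSide S n / 2)) y).2
  set r : ℝ := (AddCircle.equivIco S (-(cellSide S n / 2)) y : ℝ) with hrdef
  set ε := cellSide S n with hεdef
  have h0 : 0 ≤ (r + ε / 2) / ε := div_nonneg (by linarith [hr.1]) hε.le
  -- The index of the arc is a rounding to the nearest multiple of ε; the integer part gives
  -- existence and uniqueness together.
  have hiff : ∀ k : ℕ, r ∈ Set.Ico ((k : ℝ) * ε - ε / 2) ((k : ℝ) * ε + ε / 2) ↔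
      ⌊(r + ε / 2) / ε⌋₊ = k := by
    intro k
    rw [Nat.floor_eq_iff h0, le_div_iff₀ hε, div_lt_iff₀ hε, Set.mem_Ico]
    constructor
    · rintro ⟨h1, h2⟩
      constructor <;> linarith
    · rintro ⟨h1, h2⟩
      constructor <;> linarith
  have hlt : ⌊(r + ε / 2) / ε⌋₊ < n := by
    rw [Nat.floor_lt h0, div_lt_iff₀ hε, hnS]
    linarith [hr.2]
  refine ⟨⟨_, hlt⟩, (hiff _).2 rfl, fun k hk => ?_⟩
  exact Fin.ext ((hiff k).1 hk).symm

/-- The n arcs are translates of each other and partition a circle of length S. -/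
lemma volume_arc (k : Fin n) : volume (arc S k) = ENNReal.ofReal (cellSide S n) := by
  have htr : ∀ j : Fin n, volume (arc S j) = volume (arc S k) := by
    intro j
    have h : arc S j = (fun y => ((((k : ℝ) - j) * cellSide S n : ℝ) : AddCircle S) + y) ⁻¹'
        arc S k := by
      have hkj : (((k : ℝ) * cellSide S n : ℝ) : AddCircle S) =
          ((((k : ℝ) - j) * cellSide S n : ℝ) : AddCircle S) +
            (((j : ℝ) * cellSide S n : ℝ) : AddCircle S) := by
        rw [← AddCircle.coe_add]
        congr 1
        ring
      ext y
      simp only [arc, Set.mem_preimage, Set.mem_ofPred_eq, hkj, add_assoc, add_right_inj]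
    rw [h, measure_preimage_add]
  have hU : (Set.univ : Set (AddCircle S)) = ⋃ j : Fin n, arc S j := by
    ext y
    obtain ⟨j, hj, -⟩ := existsUnique_mem_arc S k.pos y
    simpa using ⟨j, hj⟩
  have hd : Pairwise (Function.onFun Disjoint fun j : Fin n => arc S j) := by
    intro i j hij
    refine Set.disjoint_left.2 fun y hi hj => hij ?_
    exact (existsUnique_mem_arc S k.pos y).unique hi hj
  have h1 := AddCircle.measure_univ S
  rw [hU, measure_iUnion hd (measurableSet_arc S), tsum_fintype] at h1
  simp_rw [htr] at h1
  rw [Finset.sum_const, Finset.card_univ, Fintype.card_fin, nsmul_eq_mul] at h1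
  have h2 := congrArg ENNReal.ofReal (natCast_mul_cellSide S k)
  rw [← h1, ENNReal.ofReal_mul (Nat.cast_nonneg _), ENNReal.ofReal_natCast] at h2
  exact (ENNReal.mul_right_inj (by exact_mod_cast k.pos.ne') (ENNReal.natCast_ne_top n)).1 h2.symm

lemma measurableSet_cell (i : CellIndex n) : MeasurableSet (cell S i) := by
  rw [cell_eq_prod]
  exact (measurableSet_arc S i.1).prod (measurableSet_arc S i.2)

lemma volume_cell (i : CellIndex n) :
    volume (cell S i) = ENNReal.ofReal (cellSide S n ^ 2) := by
  rw [cell_eq_prod, Measure.volume_eq_prod, Measure.prod_prod, volume_arc, volume_arc, pow_two,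
    ENNReal.ofReal_mul (cellSide_pos S i.1).le]

lemma existsUnique_mem_cell (hn : 0 < n) (x : Torus S) : ∃! i : CellIndex n, x ∈ cell S i := by
  obtain ⟨k, hk, hk'⟩ := existsUnique_mem_arc S hn x.1
  obtain ⟨l, hl, hl'⟩ := existsUnique_mem_arc S hn x.2
  simp_rw [cell_eq_prod]
  refine ⟨(k, l), ⟨hk, hl⟩, fun i hi => Prod.ext (hk' _ hi.1) (hl' _ hi.2)⟩

/-! ### Path losses between cells and between their vicinities -/

lemma mem_vicinity_add (hn : 2 ≤ n) (i : CellIndex n) {u v : ℝ}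
    (huv : u ^ 2 + v ^ 2 = cellSide S n ^ 2) :
    cellCenter S i + ((u : AddCircle S), (v : AddCircle S)) ∈ vicinity S i := by
  right
  have hε := cellSide_pos S i.1
  -- Two cells per side suffice for real displacements of absolute value at most ε to keep their
  -- length on the circle.
  have hεS : cellSide S n ≤ S / 2 := by
    rw [cellSide]
    exact div_le_div_of_nonneg_left hS.out.le two_pos (by exact_mod_cast hn)
  have hnorm : ∀ w : ℝ, w ^ 2 ≤ cellSide S n ^ 2 → ‖(w : AddCircle S)‖ = |w| := by
    intro w hw
    rw [AddCircle.norm_coe_eq_abs_iff S hS.out.ne', abs_of_pos hS.out]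
    exact (abs_le_of_sq_le_sq hw hε.le).trans hεS
  rw [torusDist, Real.coe_sqrt]
  push_cast
  simp only [Prod.fst_add, Prod.snd_add, add_sub_cancel_left]
  rw [hnorm u (by nlinarith [sq_nonneg v]), hnorm v (by nlinarith [sq_nonneg u]), sq_abs, sq_abs,
    huv, Real.sqrt_sq hε.le]

/-- The path loss between two points is a path loss between the vicinities of their cells. -/
lemma pathLoss_mem_vicinityLosses {K : ℕ} (prm : NetworkParams K) (hn : 2 ≤ n)
    {i k : CellIndex n} {x y : Torus S} (hx : x ∈ cell S i) (hy : y ∈ cell S k) :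
    prm.pathLoss (torusDist x y) ∈ vicinityLosses prm S i k := by
  have hε := cellSide_pos S i.1
  obtain ⟨u, hu, v, hv, rfl⟩ := hx
  obtain ⟨u', hu', v', hv', rfl⟩ := hy
  set r₁ := u' - u with hr₁
  set r₂ := v' - v with hr₂
  set ε := cellSide S n with hεdef
  -- The vector r is the part of the displacement not accounted for by the two centers. If it
  -- vanishes, the centers themselves serve; this also avoids a division by zero in s.
  by_cases hr : r₁ ^ 2 + r₂ ^ 2 = 0
  · have h1 : r₁ = 0 := by nlinarith [sq_nonneg r₁, sq_nonneg r₂]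
    have h2 : r₂ = 0 := by nlinarith [sq_nonneg r₁, sq_nonneg r₂]
    refine ⟨_, center_mem_vicinity S i, _, center_mem_vicinity S k, ?_⟩
    rw [torusDist_eq_of_sub_eq]
    rw [sub_eq_zero.1 h1, sub_eq_zero.1 h2]
    abel
  · have hρ : 0 < r₁ ^ 2 + r₂ ^ 2 := lt_of_le_of_ne (by positivity) (Ne.symm hr)
    have hr₁' : r₁ ^ 2 ≤ ε ^ 2 :=
      sq_le_sq' (by linarith [hu.2, hu'.1]) (by linarith [hu.1, hu'.2])
    have hr₂' : r₂ ^ 2 ≤ ε ^ 2 :=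
      sq_le_sq' (by linarith [hv.2, hv'.1]) (by linarith [hv.1, hv'.2])
    have hnn : 0 ≤ ε ^ 2 / (r₁ ^ 2 + r₂ ^ 2) - 1 / 4 := by
      rw [sub_nonneg, le_div_iff₀ hρ]
      nlinarith
    -- The offsets from the centers are -r/2 and r/2, both moved by s times r rotated by a right
    -- angle. They differ by r, and the choice of s gives both of them length ε. The radicand is
    -- nonnegative since the squared length of r is at most 2ε².
    set s := Real.sqrt (ε ^ 2 / (r₁ ^ 2 + r₂ ^ 2) - 1 / 4) with hs
    have hs2 : s ^ 2 * (r₁ ^ 2 + r₂ ^ 2) = ε ^ 2 - (r₁ ^ 2 + r₂ ^ 2) / 4 := by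
      rw [hs, Real.sq_sqrt hnn, sub_mul, div_mul_cancel₀ _ hρ.ne']
      ring
    refine ⟨_, mem_vicinity_add S hn i (u := -(r₁ / 2) - s * r₂) (v := -(r₂ / 2) + s * r₁) ?_, _,
      mem_vicinity_add S hn k (u := r₁ / 2 - s * r₂) (v := r₂ / 2 + s * r₁) ?_, ?_⟩
    · linear_combination hs2
    · linear_combination hs2
    · rw [torusDist_eq_of_sub_eq]
      have e1 : ((u : AddCircle S) - u') = ((-(r₁ / 2) - s * r₂ : ℝ) : AddCircle S) -
          ((r₁ / 2 - s * r₂ : ℝ) : AddCircle S) := by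
        rw [← AddCircle.coe_sub, ← AddCircle.coe_sub]
        congr 1
        rw [hr₁]
        ring
      have e2 : ((v : AddCircle S) - v') = ((-(r₂ / 2) + s * r₁ : ℝ) : AddCircle S) -
          ((r₂ / 2 + s * r₁ : ℝ) : AddCircle S) := by
        rw [← AddCircle.coe_sub, ← AddCircle.coe_sub]
        congr 1
        rw [hr₂]
        ring
      rw [add_sub_add_comm, add_sub_add_comm, Prod.mk_sub_mk, Prod.mk_sub_mk, e1, e2,
        Prod.mk_sub_mk]

lemma pathLoss_le_lossMax {K : ℕ} (prm : NetworkParams K) (hn : 2 ≤ n)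
    {i k : CellIndex n} {x y : Torus S} (hx : x ∈ cell S i) (hy : y ∈ cell S k) :
    prm.pathLoss (torusDist x y) ≤ lossMax prm S i k :=
  le_csSup (bddAbove_Icc.mono (vicinityLosses_subset_Icc S prm i k))
    (pathLoss_mem_vicinityLosses S prm hn hx hy)

lemma lossMin_le_pathLoss {K : ℕ} (prm : NetworkParams K) (hn : 2 ≤ n)
    {i k : CellIndex n} {x y : Torus S} (hx : x ∈ cell S i) (hy : y ∈ cell S k) :
    lossMin prm S i k ≤ prm.pathLoss (torusDist x y) :=
  csInf_le (bddBelow_Icc.mono (vicinityLosses_subset_Icc S prm i k))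
    (pathLoss_mem_vicinityLosses S prm hn hx hy)

end Cells

/-! ### Multiset sums of measures -/

lemma exists_configOf_eq {α : Type*} (s : Multiset α) :
    ∃ (n : ℕ) (v : Fin n → α), configOf v = s := by
  induction s using Quotient.inductionOn with
  | _ l =>
    refine ⟨l.length, l.get, ?_⟩
    rw [configOf, Fin.univ_val_map, List.ofFn_get]
    rfl

lemma measurable_cons {α β : Type*} [MeasurableSpace α] [MeasurableSpace β] {f : β → α}
    (hf : Measurable f) (s : Multiset α) : Measurable fun x => f x ::ₘ s := by
  obtain ⟨n, v, rfl⟩ := exists_configOf_eq s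
  simp_rw [cons_configOf]
  refine (measurable_configOf (n + 1)).comp (measurable_pi_iff.2 fun j => ?_)
  refine Fin.cases ?_ (fun j => ?_) j
  · simpa only [Fin.cons_zero] using hf
  · simpa only [Fin.cons_succ] using measurable_const

lemma measurable_card {α : Type*} [MeasurableSpace α] :
    Measurable (Multiset.card : Multiset α → ℕ) := by
  refine measurable_of_config fun n => ?_
  simp [configOf]

lemma lintegral_multiset_sum {α : Type*} [MeasurableSpace α] (M : Multiset (Measure α))
    (f : α → ℝ≥0∞) : ∫⁻ x, f x ∂M.sum = (M.map fun μ => ∫⁻ x, f x ∂μ).sum := by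
  induction M using Multiset.induction with
  | empty => simp
  | cons μ M ih => simp [lintegral_add_measure, ih]

lemma ae_multiset_sum {α : Type*} [MeasurableSpace α] {M : Multiset (Measure α)} {p : α → Prop}
    (h : ∀ μ ∈ M, ∀ᵐ x ∂μ, p x) : ∀ᵐ x ∂M.sum, p x := by
  induction M using Multiset.induction with
  | empty => simp
  | cons μ M ih =>
    rw [Multiset.sum_cons, ae_add_measure_iff]
    exact ⟨h μ (Multiset.mem_cons_self μ M), ih fun μ' hμ' => h μ' (Multiset.mem_cons_of_mem hμ')⟩

lemma ae_smul_dirac {α : Type*} [MeasurableSpace α] {p : α → Prop} (hp : MeasurableSet {x | p x})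
    {c : ℝ≥0∞} {x : α} (h : c ≠ 0 → p x) : ∀ᵐ y ∂(c • Measure.dirac x), p y := by
  by_cases hc : c = 0
  · simp [hc]
  · exact Measure.ae_smul_measure ((ae_dirac_iff hp).2 (h hc)) c

lemma ae_finset_sum {α ι : Type*} [MeasurableSpace α] {s : Finset ι} {μ : ι → Measure α}
    {p : α → Prop} (h : ∀ i ∈ s, ∀ᵐ x ∂(μ i), p x) : ∀ᵐ x ∂(∑ i ∈ s, μ i), p x := by
  refine ae_multiset_sum fun ν hν => ?_
  obtain ⟨i, hi, rfl⟩ := Multiset.mem_map.1 hν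
  exact h i hi

/-! ### Cell counts -/

lemma cellCounts_zero {K n : ℕ} (S : ℝ) : cellCounts S n (0 : Multiset (User S K)) = 0 := by
  funext j
  simp [cellCounts]

section Counts

variable {K : ℕ} (S : ℝ) [hS : Fact (0 < S)] {n : ℕ} (hn : 0 < n)

/-- The cell and the class of a user. -/
def cellOf (z : User S K) : CellIndex n × UserClass K :=
  ((existsUnique_mem_cell S hn z.1).choose, z.2)

lemma cellOf_eq_iff (z : User S K) (j : CellIndex n × UserClass K) :
    z.1 ∈ cell S j.1 ∧ z.2 = j.2 ↔ cellOf S hn z = j := by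
  have h := (existsUnique_mem_cell S hn z.1).choose_spec
  constructor
  · rintro ⟨h1, h2⟩
    exact Prod.ext (h.2 _ h1).symm h2
  · rintro rfl
    exact ⟨h.1, rfl⟩

lemma mem_cell_cellOf (z : User S K) : z.1 ∈ cell S (cellOf S hn z).1 :=
  ((cellOf_eq_iff S hn z _).2 rfl).1

lemma cellCounts_cons (z : User S K) (s : Multiset (User S K)) :
    cellCounts S n (z ::ₘ s) = cellCounts S n s + Pi.single (cellOf S hn z) 1 := by
  funext j
  simp only [cellCounts, Multiset.countP_cons, Pi.add_apply, Pi.single_apply, cellOf_eq_iff S hn]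
  simp only [eq_comm]

open Classical in
lemma cellCounts_erase {z : User S K} {s : Multiset (User S K)} (hz : z ∈ s) :
    cellCounts S n (s.erase z) = cellCounts S n s - Pi.single (cellOf S hn z) 1 := by
  have h := cellCounts_cons S hn z (s.erase z)
  rw [Multiset.cons_erase hz] at h
  rw [h, add_tsub_cancel_right]

lemma measurable_cellCounts :
    Measurable (cellCounts S n : Multiset (User S K) → CellState n K) := by
  classical
  refine measurable_pi_iff.2 fun j => measurable_of_config fun m => ?_
  have h1 : MeasurableSet {z : User S K | z.1 ∈ cell S j.1 ∧ z.2 = j.2} :=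
    (measurable_fst (measurableSet_cell S j.1)).inter
      (measurable_snd (measurableSet_singleton j.2))
  have h2 : (fun v : Fin m → User S K => cellCounts S n (configOf v) j) = fun v =>
      ∑ i, {z : User S K | z.1 ∈ cell S j.1 ∧ z.2 = j.2}.indicator (fun _ => 1) (v i) := by
    funext v
    simp only [cellCounts, configOf, Multiset.countP_map]
    rw [← Finset.filter_val, Finset.card_val, Finset.card_filter]
    refine Finset.sum_congr rfl fun i _ => ?_
    simp [Set.indicator]
  rw [h2]
  exact Finset.measurable_sum _ fun i _ =>
    (measurable_const.indicator h1).comp (measurable_pi_apply i)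

lemma sum_map_cellOf (s : Multiset (User S K)) (f : CellIndex n × UserClass K → ℝ) :
    (s.map fun z => f (cellOf S hn z)).sum = ∑ j, f j * cellCounts S n s j := by
  classical
  induction s using Multiset.induction with
  | empty => simp [cellCounts_zero S]
  | cons z s ih =>
    rw [Multiset.map_cons, Multiset.sum_cons, ih, cellCounts_cons S hn]
    simp [mul_add, Finset.sum_add_distrib, Pi.single_apply, add_comm]

lemma sum_cellCounts (hn : 0 < n) (s : Multiset (User S K)) :
    ∑ j, cellCounts S n s j = s.card := by
  have h := sum_map_cellOf S hn s fun _ => 1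
  simp only [Multiset.map_const', Multiset.sum_replicate, nsmul_eq_mul, mul_one, one_mul] at h
  exact_mod_cast h.symm

open Classical in
lemma sum_map_eq_sum_filter {M : Type*} [AddCommMonoid M] (s : Multiset (User S K))
    (f : User S K → M) : (s.map f).sum =
      ∑ j, ((s.filter fun z => cellOf S hn z = j).map f).sum := by
  induction s using Multiset.induction with
  | empty => simp
  | cons z s ih =>
    rw [Multiset.map_cons, Multiset.sum_cons, ih]
    have : ∀ j, (((z ::ₘ s).filter fun z => cellOf S hn z = j).map f).sum =
        (if cellOf S hn z = j then f z else 0) +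
          ((s.filter fun z => cellOf S hn z = j).map f).sum := by
      intro j
      rw [Multiset.filter_cons]
      split_ifs <;> simp
    simp_rw [this, Finset.sum_add_distrib]
    simp

open Classical in
lemma card_filter_cellOf (s : Multiset (User S K)) (j : CellIndex n × UserClass K) :
    (s.filter fun z => cellOf S hn z = j).card = cellCounts S n s j := by
  rw [← Multiset.countP_eq_card_filter, cellCounts]
  exact Multiset.countP_congr rfl fun z _ => by rw [cellOf_eq_iff S hn]

end Counts

/-! ### Rates of the network -/

section Rates

variable {K : ℕ} (prm : NetworkParams K) (S : ℝ)

/-- Total arrival rate on the torus. -/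
def totalArrivalRate : ℝ≥0 := (prm.lam * S ^ 2).toNNReal

/-- Upper bound for the departure rate of a user. -/
def maxDepartureRate : ℝ≥0 := ∑ C, (numChannels C / (prm.L C * prm.N0)).toNNReal

lemma numChannels_pos (C : UserClass K) : 0 < numChannels C := by
  simpa [numChannels] using C.2

lemma le_maxDepartureRate (C : UserClass K) {I : ℝ} (hI : 0 ≤ I) :
    numChannels C / (prm.N0 + I) / prm.L C ≤ maxDepartureRate prm := by
  have hN := prm.N0_pos
  have hL := prm.L_pos C
  have hC := (numChannels_pos C).le
  calc numChannels C / (prm.N0 + I) / prm.L C ≤ numChannels C / prm.N0 / prm.L C := by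
        gcongr
        linarith
    _ = ((numChannels C / (prm.L C * prm.N0)).toNNReal : ℝ) := by
      rw [Real.coe_toNNReal _ (by positivity), div_div, mul_comm]
    _ ≤ _ := by
      rw [NNReal.coe_le_coe, maxDepartureRate]
      exact Finset.single_le_sum (f := fun C => (numChannels C / (prm.L C * prm.N0)).toNNReal)
        (fun _ _ => zero_le) (Finset.mem_univ C)

lemma overlap_nonneg (C U : UserClass K) : 0 ≤ overlap C U := Nat.cast_nonneg _

lemma interference_nonneg {S : ℝ} (z : User S K) (s : Multiset (User S K)) :
    0 ≤ interference prm z s := by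
  rw [interference]
  refine Multiset.sum_nonneg fun y hy => ?_
  obtain ⟨w, -, rfl⟩ := Multiset.mem_map.1 hy
  exact mul_nonneg (overlap_nonneg _ _) (prm.pathLoss_nonneg _)

lemma departureRate_eq {S : ℝ} (z : User S K) (s : Multiset (User S K)) :
    departureRate prm z s = numChannels z.2 / (prm.N0 + interference prm z s) / prm.L z.2 := by
  rw [departureRate, transmissionRate, prm.pathLoss_zero, mul_one]

/-- The subtracted indicator removes the user itself, so positivity of its term requires such a user
to be present. For an empty coordinate the departure rate vanishes because of its prefactor. -/
lemma queueInterference_nonneg {n : ℕ} {l : CellIndex n → CellIndex n → ℝ}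
    (hl : ∀ i k, 0 ≤ l i k) {x : CellState n K} {j : CellIndex n × UserClass K} (hj : x j ≠ 0) :
    0 ≤ queueInterference l x j := by
  refine Finset.sum_nonneg fun k _ => mul_nonneg (mul_nonneg (overlap_nonneg _ _) (hl _ _)) ?_
  split_ifs with h
  · subst h
    have : (1 : ℝ) ≤ x k := by exact_mod_cast Nat.one_le_iff_ne_zero.2 hj
    linarith
  · simp

/-- Total departure rate of the users of a cell and a class in a queueing network. -/
def queueDepartureRate {n : ℕ} (l : CellIndex n → CellIndex n → ℝ) (x : CellState n K)
    (j : CellIndex n × UserClass K) : ℝ≥0∞ :=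
  ENNReal.ofReal ((x j : ℝ) / prm.L j.2 * queueRate prm l x j)

lemma queueDepartureRate_eq_zero {n : ℕ} {l : CellIndex n → CellIndex n → ℝ} {x : CellState n K}
    {j : CellIndex n × UserClass K} (hj : x j = 0) : queueDepartureRate prm l x j = 0 := by
  simp [queueDepartureRate, hj]

lemma queueDepartureRate_eq {n : ℕ} (l : CellIndex n → CellIndex n → ℝ) (x : CellState n K)
    (j : CellIndex n × UserClass K) : queueDepartureRate prm l x j = x j *
      ENNReal.ofReal (numChannels j.2 / (prm.N0 + queueInterference l x j) / prm.L j.2) := by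
  rw [queueDepartureRate, queueRate, ← ENNReal.ofReal_natCast,
    ← ENNReal.ofReal_mul (Nat.cast_nonneg _)]
  congr 1
  ring

lemma queueDepartureRate_le {n : ℕ} {l : CellIndex n → CellIndex n → ℝ} (hl : ∀ i k, 0 ≤ l i k)
    (x : CellState n K) (j : CellIndex n × UserClass K) :
    queueDepartureRate prm l x j ≤ maxDepartureRate prm * x j := by
  by_cases hj : x j = 0
  · rw [queueDepartureRate_eq_zero prm hj]
    exact zero_le
  · rw [queueDepartureRate_eq, mul_comm]
    gcongr
    exact ENNReal.ofReal_le_of_le_toReal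
      (le_maxDepartureRate prm j.2 (queueInterference_nonneg hl hj))

lemma queueRates_apply {n : ℕ} (l : CellIndex n → CellIndex n → ℝ) (x : CellState n K) :
    queueRates prm S l x = ∑ j, ENNReal.ofReal (prm.lam * prm.p j.2 * cellSide S n ^ 2) •
        Measure.dirac (x + Pi.single j 1) + ∑ j, queueDepartureRate prm l x j •
        Measure.dirac (x - Pi.single j 1) := rfl

lemma lintegral_queueRates {n : ℕ} (l : CellIndex n → CellIndex n → ℝ) (x : CellState n K)
    (f : CellState n K → ℝ≥0∞) : ∫⁻ y, f y ∂(queueRates prm S l x) =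
      ∑ j, ENNReal.ofReal (prm.lam * prm.p j.2 * cellSide S n ^ 2) * f (x + Pi.single j 1) +
        ∑ j, queueDepartureRate prm l x j * f (x - Pi.single j 1) := by
  rw [queueRates_apply]
  simp [lintegral_add_measure, lintegral_finsetSum_measure]

lemma coe_totalArrivalRate : (totalArrivalRate prm S : ℝ≥0∞) = ENNReal.ofReal (prm.lam * S ^ 2) :=
  rfl

lemma sum_ofReal_class (c : ℝ) :
    ∑ C, ENNReal.ofReal (prm.lam * prm.p C) * ENNReal.ofReal c = ENNReal.ofReal (prm.lam * c) := by
  have h0 : ∀ C, 0 ≤ prm.lam * prm.p C := fun C => mul_nonneg prm.lam_pos.le (prm.p_nonneg C)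
  rw [← Finset.sum_mul, ← ENNReal.ofReal_sum_of_nonneg fun C _ => h0 C, ← Finset.mul_sum,
    prm.p_sum, mul_one, ENNReal.ofReal_mul prm.lam_pos.le]

lemma sum_add_single {n : ℕ} (x : CellState n K) (j : CellIndex n × UserClass K) :
    ∑ k, (x + Pi.single j 1 : CellState n K) k = ∑ k, x k + 1 := by
  classical
  simp [Finset.sum_add_distrib, Pi.single_apply]

lemma sum_sub_single {n : ℕ} {x : CellState n K} {j : CellIndex n × UserClass K} (hj : x j ≠ 0) :
    ∑ k, (x - Pi.single j 1 : CellState n K) k + 1 = ∑ k, x k := by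
  classical
  rw [← sum_add_single (x - Pi.single j 1) j, tsub_add_cancel_of_le]
  intro k
  by_cases h : k = j
  · subst h
    simpa using Nat.one_le_iff_ne_zero.2 hj
  · simp [h]

lemma measurable_cons_user (C : UserClass K) (s : Multiset (User S K)) :
    Measurable fun x : Torus S => ((x, C) : User S K) ::ₘ s :=
  measurable_cons (measurable_id.prodMk measurable_const) s

open Classical in
lemma lintegral_departureKernel (s : Multiset (User S K)) {f : Multiset (User S K) → ℝ≥0∞}
    (hf : Measurable f) : ∫⁻ y, f y ∂(departureKernel prm S s) =
      (s.map fun z => ENNReal.ofReal (departureRate prm z s) * f (s.erase z)).sum := by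
  change ∫⁻ y, f y ∂(s.map fun z =>
    ENNReal.ofReal (departureRate prm z s) • Measure.dirac (s.erase z)).sum = _
  rw [lintegral_multiset_sum, Multiset.map_map]
  congr 1
  refine Multiset.map_congr rfl fun z _ => ?_
  simp [lintegral_dirac' _ hf]

lemma sum_arrival_cells {n : ℕ} (hn : 0 < n) :
    ∑ j : CellIndex n × UserClass K, ENNReal.ofReal (prm.lam * prm.p j.2 * cellSide S n ^ 2) =
      totalArrivalRate prm S := by
  have h1 : ∀ j : CellIndex n × UserClass K,
      ENNReal.ofReal (prm.lam * prm.p j.2 * cellSide S n ^ 2) =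
        ENNReal.ofReal (prm.lam * prm.p j.2) * ENNReal.ofReal (cellSide S n ^ 2) := fun j =>
    ENNReal.ofReal_mul (mul_nonneg prm.lam_pos.le (prm.p_nonneg _))
  simp_rw [h1]
  rw [Fintype.sum_prod_type]
  simp only
  rw [sum_ofReal_class prm _, Finset.sum_const, Finset.card_univ,
    Fintype.card_prod, Fintype.card_fin, nsmul_eq_mul, coe_totalArrivalRate,
    ← ENNReal.ofReal_natCast, ← ENNReal.ofReal_mul (Nat.cast_nonneg _)]
  congr 1
  have := natCast_mul_cellSide S (⟨0, hn⟩ : Fin n)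
  push_cast
  calc _ = prm.lam * ((n : ℝ) * cellSide S n) ^ 2 := by ring
    _ = _ := by rw [this]

lemma departureKernel_univ (s : Multiset (User S K)) :
    departureKernel prm S s Set.univ =
      (s.map fun z => ENNReal.ofReal (departureRate prm z s)).sum := by
  rw [← lintegral_one, lintegral_departureKernel prm S s measurable_const]
  simp only [mul_one]

lemma queueRates_univ {n : ℕ} (hn : 0 < n) (l : CellIndex n → CellIndex n → ℝ) (x : CellState n K) :
    queueRates prm S l x Set.univ =
      totalArrivalRate prm S + ∑ j, queueDepartureRate prm l x j := by
  rw [← lintegral_one, lintegral_queueRates]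
  simp only [mul_one]
  rw [sum_arrival_cells prm S hn]

variable [hS : Fact (0 < S)]

lemma totalArrivalRate_pos : 0 < totalArrivalRate prm S :=
  Real.toNNReal_pos.2 (mul_pos prm.lam_pos (pow_pos hS.out 2))

/-- The bounds on arrivals and departures do not depend on the path loss and are those of the
original dynamics, so the comparison theorem applies with common constants. -/
theorem sizedRates_queueRates {n : ℕ} (hn : 0 < n) {l : CellIndex n → CellIndex n → ℝ}
    (hl : ∀ i k, 0 ≤ l i k) : SizedRates (queueRates prm S l) (fun x => ∑ j, x j)
      (totalArrivalRate prm S) (maxDepartureRate prm) where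
  measurable_size := measurable_of_countable _
  ne_zero x := by
    rw [← lintegral_one, lintegral_queueRates]
    simp only [mul_one]
    rw [sum_arrival_cells prm S hn]
    have h := totalArrivalRate_pos prm S
    intro h0
    rw [add_eq_zero] at h0
    exact h.ne' (by exact_mod_cast h0.1)
  le x := by
    rw [← lintegral_one, lintegral_queueRates]
    simp only [mul_one]
    rw [sum_arrival_cells prm S hn]
    push_cast
    rw [Finset.mul_sum]
    gcongr with j
    exact queueDepartureRate_le prm hl x j
  decomp x := by
    refine ⟨_, _, queueRates_apply prm S l x, ?_, ?_, ?_⟩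
    · simp only [Measure.finsetSum_apply, Measure.smul_apply, measure_univ, smul_eq_mul, mul_one]
      exact (sum_arrival_cells prm S hn).le
    · refine ae_finset_sum fun j _ => Measure.ae_smul_measure ?_ _
      rw [ae_dirac_eq]
      exact (sum_add_single x j).le
    · refine ae_finset_sum fun j _ => ?_
      -- Truncated subtraction would leave an empty coordinate unchanged, so the size would not
      -- decrease; such a transition has rate zero.
      by_cases h0 : x j = 0
      · rw [queueDepartureRate_eq_zero prm h0, zero_smul]
        exact ae_zero.symm ▸ trivial
      · refine Measure.ae_smul_measure ?_ _
        rw [ae_dirac_eq]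
        exact (sum_sub_single h0).le

lemma volume_torus : volume (Set.univ : Set (Torus S)) = ENNReal.ofReal (S ^ 2) := by
  rw [← Set.univ_prod_univ, Measure.volume_eq_prod, Measure.prod_prod, AddCircle.measure_univ,
    ← ENNReal.ofReal_mul hS.out.le, pow_two]

lemma lintegral_arrivalKernel (s : Multiset (User S K)) {f : Multiset (User S K) → ℝ≥0∞}
    (hf : Measurable f) : ∫⁻ y, f y ∂(arrivalKernel prm S s) =
      ∑ C, ENNReal.ofReal (prm.lam * prm.p C) * ∫⁻ x : Torus S, f ((x, C) ::ₘ s) := by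
  change ∫⁻ y, f y ∂(∑ C, ENNReal.ofReal (prm.lam * prm.p C) •
    (volume : Measure (Torus S)).map fun x => (x, C) ::ₘ s) = _
  rw [lintegral_finsetSum_measure]
  refine Finset.sum_congr rfl fun C _ => ?_
  rw [lintegral_smul_measure, lintegral_map hf (measurable_cons_user S C s), smul_eq_mul]

lemma networkRates_apply (s : Multiset (User S K)) :
    networkRates prm S s = arrivalKernel prm S s + departureKernel prm S s := rfl

lemma arrivalKernel_univ (s : Multiset (User S K)) :
    arrivalKernel prm S s Set.univ = totalArrivalRate prm S := by
  rw [← lintegral_one, lintegral_arrivalKernel prm S s measurable_const]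
  simp only [lintegral_one, volume_torus]
  exact sum_ofReal_class prm _

theorem sizedRates_networkRates : SizedRates (networkRates (K := K) prm S) Multiset.card
    (totalArrivalRate prm S) (maxDepartureRate prm) where
  measurable_size := measurable_card
  ne_zero s := by
    rw [networkRates_apply, Measure.add_apply, arrivalKernel_univ]
    intro h0
    rw [add_eq_zero] at h0
    exact (totalArrivalRate_pos prm S).ne' (by exact_mod_cast h0.1)
  le s := by
    rw [networkRates_apply, Measure.add_apply, arrivalKernel_univ, departureKernel_univ]
    push_cast
    gcongr
    rw [mul_comm, ← nsmul_eq_mul, ← Multiset.sum_replicate, ← Multiset.map_const']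
    refine Multiset.sum_map_le_sum_map _ _ fun z _ => ?_
    refine ENNReal.ofReal_le_of_le_toReal ?_
    rw [departureRate_eq]
    exact le_maxDepartureRate prm z.2 (interference_nonneg prm z s)
  decomp s := by
    classical
    refine ⟨arrivalKernel prm S s, departureKernel prm S s, rfl,
      (arrivalKernel_univ prm S s).le, ?_, ?_⟩
    · refine ae_finset_sum fun C _ => Measure.ae_smul_measure ?_ _
      exact (ae_map_iff (p := fun y => y.card ≤ s.card + 1)
        (measurable_cons_user S C s).aemeasurable
        (measurable_card (MeasurableSet.of_discrete (s := {k : ℕ | k ≤ s.card + 1})))).2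
        (ae_of_all _ fun x => (Multiset.card_cons _ _).le)
    · refine ae_multiset_sum fun μ hμ => ?_
      obtain ⟨z, hz, rfl⟩ := Multiset.mem_map.1 hμ
      refine ae_smul_dirac
        (measurable_card (MeasurableSet.of_discrete (s := {k : ℕ | k + 1 ≤ s.card}))) fun _ => ?_
      exact (Multiset.card_erase_add_one hz).le

end Rates

/-! ### Comparison of the interferences -/

section Comparison

variable {K : ℕ} (prm : NetworkParams K) (S : ℝ)

lemma torusDist_comm {S : ℝ} (x y : Torus S) : torusDist x y = torusDist y x := by
  simp only [torusDist, ← nndist_eq_nnnorm, nndist_comm]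

variable [hS : Fact (0 < S)] {n : ℕ}

open Classical in
lemma cellCounts_erase_add (hn : 0 < n) {z : User S K} {s : Multiset (User S K)} (hz : z ∈ s)
    (k : CellIndex n × UserClass K) :
    cellCounts S n (s.erase z) k + (if k = cellOf S hn z then 1 else 0) = cellCounts S n s k := by
  conv_rhs => rw [← Multiset.cons_erase hz, cellCounts_cons S hn]
  simp [Pi.single_apply]

/-- Path losses are replaced by their cell-wise maxima, and the other users are then grouped by cell
and class. Removing z from s corresponds to the subtracted indicator. -/
lemma interference_le_queueInterference (hn : 2 ≤ n) {z : User S K} {s : Multiset (User S K)}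
    (hz : z ∈ s) {y : CellState n K} (h : cellCounts S n s ≤ y) :
    interference prm z s ≤
      queueInterference (lossMax prm S) y (cellOf S (zero_lt_two.trans_le hn) z) := by
  classical
  have hn0 : 0 < n := zero_lt_two.trans_le hn
  calc interference prm z s
      ≤ ((s.erase z).map fun w => overlap z.2 (cellOf S hn0 w).2 *
          lossMax prm S (cellOf S hn0 w).1 (cellOf S hn0 z).1).sum := by
        refine Multiset.sum_map_le_sum_map _ _ fun w _ =>
          mul_le_mul_of_nonneg_left ?_ (overlap_nonneg _ _)
        rw [torusDist_comm]
        exact pathLoss_le_lossMax S prm hn (mem_cell_cellOf S hn0 w) (mem_cell_cellOf S hn0 z)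
    _ = _ := sum_map_cellOf S hn0 (s.erase z) fun k =>
        overlap z.2 k.2 * lossMax prm S k.1 (cellOf S hn0 z).1
    _ ≤ _ := by
      refine Finset.sum_le_sum fun k _ => mul_le_mul_of_nonneg_left ?_
        (mul_nonneg (overlap_nonneg _ _) (lossMax_nonneg S prm _ _))
      have h1 := (cellCounts_erase_add S hn0 hz k).le.trans (h k)
      rw [le_sub_iff_add_le]
      exact_mod_cast h1

lemma queueInterference_le_interference (hn : 2 ≤ n) {z : User S K} {s : Multiset (User S K)}
    (hz : z ∈ s) {x : CellState n K} (h : x ≤ cellCounts S n s) :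
    queueInterference (lossMin prm S) x (cellOf S (zero_lt_two.trans_le hn) z) ≤
      interference prm z s := by
  classical
  have hn0 : 0 < n := zero_lt_two.trans_le hn
  calc _ ≤ ∑ k : CellIndex n × UserClass K, overlap z.2 k.2 *
          lossMin prm S k.1 (cellOf S hn0 z).1 * cellCounts S n (s.erase z) k := by
        refine Finset.sum_le_sum fun k _ => mul_le_mul_of_nonneg_left ?_
          (mul_nonneg (overlap_nonneg _ _) (lossMin_nonneg S prm _ _))
        have h1 := (h k).trans (cellCounts_erase_add S hn0 hz k).ge
        rw [sub_le_iff_le_add]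
        exact_mod_cast h1
    _ = ((s.erase z).map fun w => overlap z.2 (cellOf S hn0 w).2 *
          lossMin prm S (cellOf S hn0 w).1 (cellOf S hn0 z).1).sum :=
        (sum_map_cellOf S hn0 (s.erase z) fun k =>
          overlap z.2 k.2 * lossMin prm S k.1 (cellOf S hn0 z).1).symm
    _ ≤ interference prm z s := by
        refine Multiset.sum_map_le_sum_map _ _ fun w _ =>
          mul_le_mul_of_nonneg_left ?_ (overlap_nonneg _ _)
        rw [torusDist_comm]
        exact lossMin_le_pathLoss S prm hn (mem_cell_cellOf S hn0 w) (mem_cell_cellOf S hn0 z)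

/-- Departure rate of each user of a cell and a class in a queueing network. -/
def queueUserRate (l : CellIndex n → CellIndex n → ℝ) (x : CellState n K)
    (j : CellIndex n × UserClass K) : ℝ≥0∞ :=
  ENNReal.ofReal (numChannels j.2 / (prm.N0 + queueInterference l x j) / prm.L j.2)

lemma rate_antitone (C : UserClass K) {I I' : ℝ} (hI : 0 ≤ I) (h : I ≤ I') :
    numChannels C / (prm.N0 + I') / prm.L C ≤ numChannels C / (prm.N0 + I) / prm.L C := by
  have hN := prm.N0_pos
  have hL := prm.L_pos C
  have hC := (numChannels_pos C).le
  gcongr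

lemma queueUserRate_le_departureRate (hn : 2 ≤ n) {z : User S K} {s : Multiset (User S K)}
    (hz : z ∈ s) {y : CellState n K} (h : cellCounts S n s ≤ y) :
    queueUserRate prm (lossMax prm S) y (cellOf S (zero_lt_two.trans_le hn) z) ≤
      ENNReal.ofReal (departureRate prm z s) := by
  rw [departureRate_eq]
  exact ENNReal.ofReal_le_ofReal (rate_antitone prm z.2 (interference_nonneg prm z s)
    (interference_le_queueInterference prm S hn hz h))

lemma departureRate_le_queueUserRate (hn : 2 ≤ n) {z : User S K} {s : Multiset (User S K)}
    (hz : z ∈ s) {x : CellState n K} (h : x ≤ cellCounts S n s)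
    (hx : x (cellOf S (zero_lt_two.trans_le hn) z) ≠ 0) :
    ENNReal.ofReal (departureRate prm z s) ≤
      queueUserRate prm (lossMin prm S) x (cellOf S (zero_lt_two.trans_le hn) z) := by
  rw [departureRate_eq]
  exact ENNReal.ofReal_le_ofReal (rate_antitone prm z.2
    (queueInterference_nonneg (lossMin_nonneg S prm) hx)
    (queueInterference_le_interference prm S hn hz h))

/-! ### Arrivals -/

lemma lintegral_torus_eq_sum (hn : 0 < n) (f : Torus S → ℝ≥0∞) :
    ∫⁻ x, f x = ∑ i : CellIndex n, ∫⁻ x in cell S i, f x := by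
  have hU : (⋃ i : CellIndex n, cell S i) = Set.univ :=
    Set.eq_univ_of_forall fun x =>
      Set.mem_iUnion.2 ⟨_, (existsUnique_mem_cell S hn x).choose_spec.1⟩
  have hd : Pairwise (Function.onFun Disjoint fun i : CellIndex n => cell S i) := fun i k hik =>
    Set.disjoint_left.2 fun x hi hk => hik ((existsUnique_mem_cell S hn x).unique hi hk)
  rw [← setLIntegral_univ, ← hU, lintegral_iUnion (measurableSet_cell S) hd, tsum_fintype]

/-- A cell has area ε², so the Poisson rain and the arrivals of the networks have the same rate in
each cell. Arrivals can then be compared cell by cell. -/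
lemma sum_arrival_eq (b : CellIndex n × UserClass K → ℝ≥0∞) :
    ∑ j, ENNReal.ofReal (prm.lam * prm.p j.2 * cellSide S n ^ 2) * b j =
      ∑ C, ENNReal.ofReal (prm.lam * prm.p C) *
        ∑ i : CellIndex n, ∫⁻ _ in cell S i, b (i, C) := by
  rw [Fintype.sum_prod_type, Finset.sum_comm]
  refine Finset.sum_congr rfl fun C _ => ?_
  rw [Finset.mul_sum]
  refine Finset.sum_congr rfl fun i _ => ?_
  rw [setLIntegral_const, volume_cell,
    ENNReal.ofReal_mul (mul_nonneg prm.lam_pos.le (prm.p_nonneg _)), mul_assoc,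
    mul_comm (b (i, C))]

lemma lintegral_arrivalKernel_le (hn : 0 < n) (s : Multiset (User S K))
    {f : Multiset (User S K) → ℝ≥0∞} (hf : Measurable f) {b : CellIndex n × UserClass K → ℝ≥0∞}
    (h : ∀ z, f (z ::ₘ s) ≤ b (cellOf S hn z)) : ∫⁻ y, f y ∂(arrivalKernel prm S s) ≤
      ∑ j, ENNReal.ofReal (prm.lam * prm.p j.2 * cellSide S n ^ 2) * b j := by
  rw [lintegral_arrivalKernel prm S s hf, sum_arrival_eq]
  simp_rw [lintegral_torus_eq_sum S hn]
  refine Finset.sum_le_sum fun C _ => mul_le_mul_right (Finset.sum_le_sum fun i _ => ?_) _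
  refine setLIntegral_mono' (measurableSet_cell S i) fun x hx => (h (x, C)).trans_eq ?_
  rw [(cellOf_eq_iff S hn (x, C) (i, C)).1 ⟨hx, rfl⟩]

lemma le_lintegral_arrivalKernel (hn : 0 < n) (s : Multiset (User S K))
    {f : Multiset (User S K) → ℝ≥0∞} (hf : Measurable f) {b : CellIndex n × UserClass K → ℝ≥0∞}
    (h : ∀ z, b (cellOf S hn z) ≤ f (z ::ₘ s)) :
    ∑ j, ENNReal.ofReal (prm.lam * prm.p j.2 * cellSide S n ^ 2) * b j ≤
      ∫⁻ y, f y ∂(arrivalKernel prm S s) := by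
  rw [lintegral_arrivalKernel prm S s hf, sum_arrival_eq]
  simp_rw [lintegral_torus_eq_sum S hn]
  refine Finset.sum_le_sum fun C _ => mul_le_mul_right (Finset.sum_le_sum fun i _ => ?_) _
  refine setLIntegral_mono' (measurableSet_cell S i) fun x hx => (h (x, C)).trans_eq' ?_
  rw [(cellOf_eq_iff S hn (x, C) (i, C)).1 ⟨hx, rfl⟩]

/-! ### Departures -/

/-- The coupling of two matched users: they leave together at rate d, and the user of the smaller
system leaves alone at rate r - d. The four hypotheses on the rates and values express that these
moves keep the order. -/
lemma swap_mul_add_mul_le {r d g c a b : ℝ≥0∞} (hdr : d ≤ r) (hgb : g ≤ b) (hga : g ≤ a)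
    (hcb : c ≤ b) : r * g + d * c ≤ d * a + r * b := by
  obtain ⟨e, rfl⟩ := exists_add_of_le hdr
  calc (d + e) * g + d * c = d * g + (d * c + e * g) := by ring
    _ ≤ d * a + (d * b + e * b) := by gcongr
    _ = _ := by ring

open Classical in
/-- Balance of the departures from a cell when the network has at least as many users in it. -/
lemma departures_upper (hn : 2 ≤ n) {s : Multiset (User S K)} {y : CellState n K}
    (h : cellCounts S n s ≤ y) {g : Multiset (User S K) → ℝ≥0∞} {f : CellState n K → ℝ≥0∞}
    (hgf : ∀ s y, cellCounts S n s ≤ y → g s ≤ f y) (j : CellIndex n × UserClass K) :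
    ((s.filter fun z => cellOf S (zero_lt_two.trans_le hn) z = j).map fun z =>
        ENNReal.ofReal (departureRate prm z s) * g (s.erase z)).sum +
        queueDepartureRate prm (lossMax prm S) y j * g s ≤
      queueDepartureRate prm (lossMax prm S) y j * f (y - Pi.single j 1) +
        ((s.filter fun z => cellOf S (zero_lt_two.trans_le hn) z = j).map fun z =>
          ENNReal.ofReal (departureRate prm z s)).sum * f y := by
  have hn0 : 0 < n := zero_lt_two.trans_le hn
  rw [← Multiset.sum_map_mul_right]
  have herase : ∀ z ∈ s, cellCounts S n (s.erase z) ≤ y := fun z hz k =>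
    (Nat.le_add_right _ _).trans ((cellCounts_erase_add S hn0 hz k).le.trans (h k))
  -- With strict inequality, one departure on either side keeps the order, so no comparison of rates
  -- is needed. With equality, the users are matched one to one.
  rcases (h j).lt_or_eq with hlt | heq
  · rw [add_comm]
    refine add_le_add (mul_le_mul_right ?_ _) (Multiset.sum_map_le_sum_map _ _ fun z hz =>
      mul_le_mul_right (hgf _ _ (herase z (Multiset.mem_filter.1 hz).1)) _)
    refine hgf _ _ fun k => ?_
    by_cases hk : k = j
    · subst hk
      simpa using Nat.le_sub_one_of_lt hlt
    · simpa [hk] using h k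
  · have hd : queueDepartureRate prm (lossMax prm S) y j =
        (s.filter fun z => cellOf S hn0 z = j).card * queueUserRate prm (lossMax prm S) y j := by
      rw [card_filter_cellOf, heq, queueDepartureRate_eq, queueUserRate]
    simp_rw [hd, mul_assoc, ← nsmul_eq_mul, ← Multiset.sum_replicate, ← Multiset.map_const']
    rw [← Multiset.sum_map_add, ← Multiset.sum_map_add]
    refine Multiset.sum_map_le_sum_map _ _ fun z hz => ?_
    obtain ⟨hzs, rfl⟩ := Multiset.mem_filter.1 hz
    refine swap_mul_add_mul_le (queueUserRate_le_departureRate prm S hn hzs h)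
      (hgf _ _ (herase z hzs)) (hgf _ _ ?_) (hgf _ _ h)
    rw [cellCounts_erase S hn0 hzs]
    exact tsub_le_tsub_right h _

open Classical in
/-- Balance of the departures from a cell when the network has at most as many users in it. -/
lemma departures_lower (hn : 2 ≤ n) {s : Multiset (User S K)} {x : CellState n K}
    (h : x ≤ cellCounts S n s) {g : CellState n K → ℝ≥0∞} {f : Multiset (User S K) → ℝ≥0∞}
    (hgf : ∀ x s, x ≤ cellCounts S n s → g x ≤ f s) (j : CellIndex n × UserClass K) :
    queueDepartureRate prm (lossMin prm S) x j * g (x - Pi.single j 1) +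
        ((s.filter fun z => cellOf S (zero_lt_two.trans_le hn) z = j).map fun z =>
          ENNReal.ofReal (departureRate prm z s)).sum * g x ≤
      ((s.filter fun z => cellOf S (zero_lt_two.trans_le hn) z = j).map fun z =>
        ENNReal.ofReal (departureRate prm z s) * f (s.erase z)).sum +
        queueDepartureRate prm (lossMin prm S) x j * f s := by
  have hn0 : 0 < n := zero_lt_two.trans_le hn
  rw [← Multiset.sum_map_mul_right]
  have hsub : x - Pi.single j 1 ≤ x := tsub_le_self
  -- The same dichotomy with exchanged roles: in the case of equality, it is the users of the lower
  -- network that leave faster.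
  rcases (h j).lt_or_eq with hlt | heq
  · rw [add_comm]
    refine add_le_add (Multiset.sum_map_le_sum_map _ _ fun z hz => mul_le_mul_right ?_ _)
      (mul_le_mul_right (hgf _ _ (hsub.trans h)) _)
    obtain ⟨hzs, rfl⟩ := Multiset.mem_filter.1 hz
    refine hgf _ _ fun k => ?_
    rw [cellCounts_erase S hn0 hzs]
    by_cases hk : k = cellOf S hn0 z
    · subst hk
      simpa using Nat.le_sub_one_of_lt hlt
    · simpa [hk] using h k
  · have hd : queueDepartureRate prm (lossMin prm S) x j =
        (s.filter fun z => cellOf S hn0 z = j).card * queueUserRate prm (lossMin prm S) x j := by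
      rw [card_filter_cellOf, ← heq, queueDepartureRate_eq, queueUserRate]
    simp_rw [hd, mul_assoc, ← nsmul_eq_mul, ← Multiset.sum_replicate, ← Multiset.map_const']
    rw [← Multiset.sum_map_add, ← Multiset.sum_map_add]
    refine Multiset.sum_map_le_sum_map _ _ fun z hz => ?_
    obtain ⟨hzs, rfl⟩ := Multiset.mem_filter.1 hz
    have hx : x (cellOf S hn0 z) ≠ 0 := by
      rw [heq, ← cellCounts_erase_add S hn0 hzs]
      simp
    refine swap_mul_add_mul_le (departureRate_le_queueUserRate prm S hn hzs h hx)
      (hgf _ _ (hsub.trans h)) (hgf _ _ ?_) (hgf _ _ h)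
    rw [cellCounts_erase S hn0 hzs]
    exact tsub_le_tsub_right h _

/-! ### Domination of the rates -/

/-- The inequality splits into three: the arrivals, cell by cell; the holding terms of the equal
total arrival rates; and the departures, summed over cells and classes. -/
theorem ratesDominated_upper (hn : 2 ≤ n) :
    RatesDominated (fun (s : Multiset (User S K)) (y : CellState n K) => cellCounts S n s ≤ id y)
      (networkRates prm S) (upperRates prm S n) := by
  classical
  have hn0 : 0 < n := zero_lt_two.trans_le hn
  intro s y h g f hg hf hgf
  change cellCounts S n s ≤ y at h
  replace hgf : ∀ s y, cellCounts S n s ≤ y → g s ≤ f y := hgf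
  rw [upperRates, queueRates_univ prm S hn0, lintegral_queueRates, networkRates_apply,
    lintegral_add_measure, Measure.add_apply, arrivalKernel_univ, departureKernel_univ,
    lintegral_departureKernel prm S s hg, sum_map_eq_sum_filter S hn0 s,
    sum_map_eq_sum_filter S hn0 s]
  have h1 : ∫⁻ y, g y ∂(arrivalKernel prm S s) ≤
      ∑ j, ENNReal.ofReal (prm.lam * prm.p j.2 * cellSide S n ^ 2) * f (y + Pi.single j 1) := by
    refine lintegral_arrivalKernel_le prm S hn0 s hg fun z => hgf _ _ ?_
    rw [cellCounts_cons S hn0]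
    exact add_le_add_left h _
  have h2 := Finset.sum_le_sum fun j (_ : j ∈ Finset.univ) => departures_upper prm S hn h hgf j
  rw [Finset.sum_add_distrib, Finset.sum_add_distrib, ← Finset.sum_mul, ← Finset.sum_mul] at h2
  have h3 := mul_le_mul_right (hgf s y h) (totalArrivalRate prm S : ℝ≥0∞)
  calc _ = _ := by rw [add_mul, add_add_add_comm, ← add_assoc]
    _ ≤ _ := add_le_add (add_le_add h1 h3) h2
    _ = _ := by ring

theorem ratesDominated_lower (hn : 2 ≤ n) :
    RatesDominated (fun (x : CellState n K) (s : Multiset (User S K)) => id x ≤ cellCounts S n s)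
      (lowerRates prm S n) (networkRates prm S) := by
  classical
  have hn0 : 0 < n := zero_lt_two.trans_le hn
  intro x s h g f hg hf hgf
  change x ≤ cellCounts S n s at h
  replace hgf : ∀ x s, x ≤ cellCounts S n s → g x ≤ f s := hgf
  rw [lowerRates, queueRates_univ prm S hn0, lintegral_queueRates, networkRates_apply,
    lintegral_add_measure, Measure.add_apply, arrivalKernel_univ, departureKernel_univ,
    lintegral_departureKernel prm S s hf, sum_map_eq_sum_filter S hn0 s,
    sum_map_eq_sum_filter S hn0 s]
  have h1 : ∑ j, ENNReal.ofReal (prm.lam * prm.p j.2 * cellSide S n ^ 2) *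
      g (x + Pi.single j 1) ≤ ∫⁻ y, f y ∂(arrivalKernel prm S s) := by
    refine le_lintegral_arrivalKernel prm S hn0 s hf fun z => hgf _ _ ?_
    rw [cellCounts_cons S hn0]
    exact add_le_add_left h _
  have h2 := Finset.sum_le_sum fun j (_ : j ∈ Finset.univ) => departures_lower prm S hn h hgf j
  rw [Finset.sum_add_distrib, Finset.sum_add_distrib, ← Finset.sum_mul, ← Finset.sum_mul] at h2
  have h3 := mul_le_mul_right (hgf x s h) (totalArrivalRate prm S : ℝ≥0∞)
  calc _ = _ := by rw [add_mul, add_add_add_comm, ← add_assoc]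
    _ ≤ _ := add_le_add (add_le_add h1 h3) h2
    _ = _ := by ring

/-! ### Irreducibility of the queueing networks -/

/-- Every state is connected with the empty one in both directions, by induction on the number of
users. Single arrivals have positive rate since every class does, and so do departures from nonempty
coordinates. -/
theorem isIrreducibleSemigroup_queueRates (hn : 0 < n) {l : CellIndex n → CellIndex n → ℝ}
    (hl : ∀ i k, 0 ≤ l i k) (hp : ∀ C, 0 < prm.p C) :
    IsIrreducibleSemigroup (transition (queueRates prm S l)) := by
  set q := queueRates (K := K) prm S l with hq
  have hs : SizedRates q _ _ _ := sizedRates_queueRates prm S hn hl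
  have hrefl : ∀ x, ∃ t, 0 < transition q t x {x} := fun x =>
    ⟨0, by rw [transition_zero hs.regularRates, Kernel.id_apply]; simp⟩
  have htrans : ∀ x y z, (∃ t, 0 < transition q t x {y}) → (∃ t, 0 < transition q t y {z}) →
      ∃ t, 0 < transition q t x {z} := fun x y z ⟨s, h1⟩ ⟨t, h2⟩ =>
    ⟨s + t, hs.regularRates.transition_pos_trans h1 h2⟩
  have hrate : ∀ x y : CellState n K, q x {y} =
      ∑ j, ENNReal.ofReal (prm.lam * prm.p j.2 * cellSide S n ^ 2) *
        ({y} : Set (CellState n K)).indicator 1 (x + Pi.single j 1) +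
      ∑ j, queueDepartureRate prm l x j *
        ({y} : Set (CellState n K)).indicator 1 (x - Pi.single j 1) := fun x y => by
    rw [← lintegral_indicator_one (measurableSet_singleton y), hq, lintegral_queueRates]
  have hup : ∀ x j, ∃ t, 0 < transition q t x {x + Pi.single j 1} := fun x j => by
    refine hs.exists_transition_pos_of_rate_pos ?_
    rw [hrate]
    refine lt_of_lt_of_le ?_ (le_self_add.trans' (Finset.single_le_sum
      (fun _ _ => zero_le) (Finset.mem_univ j)))
    have hε := cellSide_pos S j.1.1
    have h0 : 0 < prm.lam * prm.p j.2 * cellSide S n ^ 2 :=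
      mul_pos (mul_pos prm.lam_pos (hp _)) (by positivity)
    simpa using h0
  have hdown : ∀ (x : CellState n K) j, x j ≠ 0 →
      ∃ t, 0 < transition q t x {x - Pi.single j 1} := fun x j hj => by
    refine hs.exists_transition_pos_of_rate_pos ?_
    rw [hrate]
    refine lt_of_lt_of_le ?_ (le_add_self.trans' (Finset.single_le_sum
      (fun _ _ => zero_le) (Finset.mem_univ j)))
    have h0 : 0 < numChannels j.2 / (prm.N0 + queueInterference l x j) / prm.L j.2 :=
      div_pos (div_pos (numChannels_pos _)
        (add_pos_of_pos_of_nonneg prm.N0_pos (queueInterference_nonneg hl hj))) (prm.L_pos _)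
    rw [queueDepartureRate_eq, Set.indicator_of_mem (Set.mem_singleton _), Pi.one_apply, mul_one]
    exact ENNReal.mul_pos (by exact_mod_cast hj) (ENNReal.ofReal_pos.2 h0).ne'
  have hzero : ∀ (m : ℕ) (x : CellState n K), ∑ j, x j = m →
      (∃ t, 0 < transition q t x {0}) ∧ ∃ t, 0 < transition q t 0 {x} := by
    intro m
    induction m with
    | zero =>
      intro x hx
      have : x = 0 := by
        funext j
        exact Finset.sum_eq_zero_iff.1 hx j (Finset.mem_univ j)
      subst this
      exact ⟨hrefl 0, hrefl 0⟩
    | succ m ih =>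
      intro x hx
      obtain ⟨j, -, hj⟩ := Finset.exists_ne_zero_of_sum_ne_zero (hx.trans_ne m.succ_ne_zero)
      have hsum := sum_sub_single hj
      have h1 := ih (x - Pi.single j 1) (by omega)
      have h2 : x - Pi.single j 1 + Pi.single j 1 = x := by
        refine tsub_add_cancel_of_le fun k => ?_
        by_cases hk : k = j
        · subst hk
          simpa using Nat.one_le_iff_ne_zero.2 hj
        · simp [hk]
      refine ⟨htrans _ _ _ (hdown x j hj) h1.1, htrans _ _ _ h1.2 ?_⟩
      have h3 := hup (x - Pi.single j 1) j
      rwa [h2] at h3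
  exact fun x y => htrans _ _ _ (hzero _ x rfl).1 (hzero _ y rfl).2

end Comparison

end InterferenceQueues

end

/-! ### The theorem -/

theorem mainTheorem6 {K : ℕ} (prm : NetworkParams K) (S : ℝ) [Fact (0 < S)] (n : ℕ)
    (hn : 2 ≤ n) :
    -- the upper network is an irreducible Markov jump process on `ℕ ^ (N × (2 ^ K - 1))`
    (∃ P : ℝ≥0 → Kernel (CellState n K) (CellState n K),
      IsTransitionFunction P (upperRates prm S n) ∧
      (∀ ν : Measure (CellState n K), IsProbabilityMeasure ν →
        NonExplosive (upperRates prm S n) ν ∧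
        IsMarkovJumpProcess P ν (jumpProcess (upperRates prm S n))
          (jumpLaw (upperRates prm S n) ν)) ∧
      ((∀ C, 0 < prm.p C) → IsIrreducibleSemigroup P)) ∧
    -- the lower network is an irreducible Markov jump process on the same space
    (∃ P : ℝ≥0 → Kernel (CellState n K) (CellState n K),
      IsTransitionFunction P (lowerRates prm S n) ∧
      (∀ ν : Measure (CellState n K), IsProbabilityMeasure ν →
        NonExplosive (lowerRates prm S n) ν ∧
        IsMarkovJumpProcess P ν (jumpProcess (lowerRates prm S n))
          (jumpLaw (lowerRates prm S n) ν)) ∧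
      ((∀ C, 0 < prm.p C) → IsIrreducibleSemigroup P)) ∧
    -- the original dynamics is well defined for all times
    (∀ ν : Measure (Multiset (User S K)), IsProbabilityMeasure ν →
      NonExplosive (networkRates prm S) ν) ∧
    (∀ t, Measurable (discretized prm S n t)) ∧
    -- the upper network dominates the discretization of the original dynamics
    (∀ (ν : Measure (Multiset (User S K))) (ν' : Measure (CellState n K)),
      IsProbabilityMeasure ν → IsProbabilityMeasure ν' →
      StochLE (cellCounts S n) ν id ν' →
      ProcessStochLE (discretized prm S n) (jumpLaw (networkRates prm S) ν)
        (jumpProcess (upperRates prm S n)) (jumpLaw (upperRates prm S n) ν')) ∧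
    -- the lower network is dominated by the discretization of the original dynamics
    (∀ (ν : Measure (Multiset (User S K))) (ν' : Measure (CellState n K)),
      IsProbabilityMeasure ν → IsProbabilityMeasure ν' →
      StochLE id ν' (cellCounts S n) ν →
      ProcessStochLE (jumpProcess (lowerRates prm S n)) (jumpLaw (lowerRates prm S n) ν')
        (discretized prm S n) (jumpLaw (networkRates prm S) ν)) := by
  have hn0 : 0 < n := zero_lt_two.trans_le hn
  have hu : SizedRates (upperRates prm S n) _ _ _ :=
    sizedRates_queueRates prm S hn0 (lossMax_nonneg S prm)
  have hl : SizedRates (lowerRates prm S n) _ _ _ :=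
    sizedRates_queueRates prm S hn0 (lossMin_nonneg S prm)
  have hq := sizedRates_networkRates prm S
  refine ⟨⟨_, hu.isTransitionFunction, fun ν _ => ⟨hu.regularRates.nonExplosive_law ν,
      isMarkovJumpProcess_jumpProcess hu.regularRates ν⟩,
      isIrreducibleSemigroup_queueRates prm S hn0 (lossMax_nonneg S prm)⟩,
    ⟨_, hl.isTransitionFunction, fun ν _ => ⟨hl.regularRates.nonExplosive_law ν,
      isMarkovJumpProcess_jumpProcess hl.regularRates ν⟩,
      isIrreducibleSemigroup_queueRates prm S hn0 (lossMin_nonneg S prm)⟩,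
    fun ν _ => hq.regularRates.nonExplosive_law ν,
    fun t => (measurable_cellCounts S).comp (measurable_jumpProcess t),
    fun ν ν' _ _ h => ?_, fun ν ν' _ _ h => ?_⟩
  -- The cells partition the torus, so the cell counts sum to the number of users and the order of
  -- the counts implies that of the sizes.
  · exact (ratesDominated_upper prm S hn).processStochLE (measurable_cellCounts S) measurable_id
      hq hu (fun s y h => (sum_cellCounts S hn0 s).symm.trans_le
        (Finset.sum_le_sum fun j _ => h j)) h
  · exact (ratesDominated_lower prm S hn).processStochLE measurable_id (measurable_cellCounts S)
      hl hq (fun x s h => (Finset.sum_le_sum fun j _ => h j).trans_eq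
        (sum_cellCounts S hn0 s)) h
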